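/- **Setting.** Let $d,\nu\ge 1$; on $\mathbb Z^d$ let $\|x\|=\max_i|x_i|$. Let $\Omega=\mathbb T^\nu$ with normalized Haar measure $\mathbb P$ and $\mathrm{dist}(\omega,\omega')=\max_i \mathrm{dist}_{\mathbb T^1}(\omega_i,\omega_i')$, let $(\Theta,\mathfrak B,\mu)$ be a probability space, $T$ a $\mathbb P$-preserving action of $\mathbb Z^d$ on $\Omega$, and $v:\Omega\times\Theta\to\mathbb R$ measurable. Fix $A,C,A',C',B,C'',\tilde C\in(0,\infty)$ and assume: * (USR) $\mathrm{dist}(T^x\omega,T^y\omega)\ge 4C\|x-y\|^{-A}$ for all $\omega\in\Omega$ and $x\ne y$ in $\mathbb Z^d$; * (DIV) $\mathrm{dist}(T^x\omega,T^x\omega')\le C'\|x\|^{A'}\mathrm{dist}(\omega,\omega')$ for all $\omega,\omega'\in\Omega$ and $x\ne0$; * (LVB) for all $L\in\{1,2,\dots\}$ and $x\in\mathbb Z^d$ there is a $\sigma$-algebra $\mathfrak G(L,x)$ of measurable subsets of $\Omega\times\Theta$, with respect to which $(\omega,\theta)\mapsto\omega$ and all $(\omega,\theta)\mapsto v(T^y\omega,\theta)$,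 $0<\|y-x\|\le L^4$, are measurable, and conditionally on which $(\omega,\theta)\mapsto v(T^x\omega,\theta)$ has, under $\mathbb P\times\mu$, a probability density bounded by $C''L^B$; * $v(\cdot,\theta)\in C^1(\mathbb T^\nu)$, $\|v(\cdot,\theta)\|_{C^1}\le\tilde C$ (the function and its first partial derivatives are bounded by $\tilde C$), for all $\theta\in\Theta$. **Notation.** For $g>0$ and an integer $L_0$ put $a=b=\tfrac12$, $L_{-1}=0$, $L_k=\lfloor L_{k-1}^{3/2}\rfloor+1$ $(k\ge1)$, $\delta_k=g^{-a}e^{-4L_k^b}$, and $\gamma(m,L)=m(1+L^{-1/8})$. For $\Lambda_L(u)=\{x\in\mathbb Z^d:\|x-u\|\le L\}$ let $H_{\Lambda_L(u)}(\omega,\theta)$ be the restriction to $\Lambda_L(u)$, with Dirichlet boundary conditions, of $$(Hf)(x)=\sum_{\|y-x\|_1=1}f(y)+g\,v(T^x\omega,\theta)f(x),$$ and $\Sigma_{\omega,\theta}(\Lambda_L(u))$ its spectrum. Fix $k\ge0$. * A cube $\Lambda$ is *$E$-resonant at scale $k$* if $\mathrm{dist}(E,\Sigma_{\omega,\theta}(\Lambda))<g\delta_k$,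 and *partially $E$-resonant at scale $k$* if it is $E$-resonant at scale $k$ or contains a cube of radius $\ge L_{k-1}$ that is. $\Lambda_{L_k}(u)$ is *$(\omega,\theta)$-tunneling* if for some $E\in\mathbb R$ it contains two disjoint cubes of radii $\ge L_k^{1/4}$ that are partially $E$-resonant at scale $k$. Put $\mathcal T_k=\{\theta:\mathbb P\{\omega:\Lambda_{L_k}(u)\text{ is }(\omega,\theta)\text{-tunneling}\}\ge\delta_k^{1/2}\}$ (this does not depend on $u$). * $\mathcal R(k,\omega')$ is the set of $\theta$ for which there are pairwise disjoint cubes $\Lambda_{R_j}(v^{(j)})\subset\Lambda_{L_k}(u^{(j)})\subset\Lambda_{L_k^4}(0)$, $1\le j\le\nu+2$, with $L_{k-1}\le R_j\le L_k$ and $\mathrm{dist}\big(\Sigma_{\omega',\theta}(\Lambda_{R_j}(v^{(j)})),\Sigma_{\omega',\theta}(\Lambda_{R_1}(v^{(1)}))\big)\le4g\delta_k$ for $j\ge2$. Let $N_k$ be the least integer with $\frac1{2N_k}\le\delta_k^{1+1/(2\nu)}$, and let $\mathcal N_k=\Theta\setminus\bigcup_i\mathcal R(k,\omega_i)$, where $\omega_i$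 runs over the points of $\mathbb T^\nu$ with all coordinates in $\{\frac{2l+1}{2N_k}:0\le l<N_k\}$. * $\Theta_k=\bigcap_{l\le k}(\mathcal N_l\setminus\mathcal T_l)$ and $\Theta_\infty(g)=\bigcap_{k\ge0}\Theta_k$. * $\Lambda_{L_k}(u)$ is *$(m,\omega,\theta)$-localized* if every eigenfunction $\psi$ of $H_{\Lambda_{L_k}(u)}(\omega,\theta)$ with $\|\psi\|_{\ell^2}=1$ satisfies $|\psi(x)\psi(y)|\le e^{-\gamma(m,L_{k-1})\|x-y\|}$ for all $x,y\in\Lambda_{L_k}(u)$ with $\|x-y\|\ge L_k^{7/8}$; for $k=0$, $\gamma(m,L_0)$ replaces $\gamma(m,L_{-1})$. **Theorem.** There are $C_7,c_1>0$ and an integer $L_*>2$, depending only on $d,\nu,A,C,A',C',B,C'',\tilde C$, such that for every integer $L_0\ge L_*$ there is $g_0>1$, depending only on $L_0$ and the same data, with the following property. For every $g\ge g_0$ there is $m>c_1\ln g$, depending only on $g$, $L_0$ and the same data, such that for all $(\Theta,\mathfrak B,\mu)$, $T$, $v$ as above: (A) $\Theta_\infty(g)$ is measurable and $\mu(\Theta_\infty(g))\ge1-C_7g^{-a/2}$;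 (B) for all $\theta\in\Theta_\infty(g)$, $k\ge0$ and $u\in\mathbb Z^d$, $$\mathbb P\{\omega:\Lambda_{L_k}(u)\text{ is not }(m,\omega,\theta)\text{-localized}\}\le g^{-a/2}e^{-L_k^b}.$$ -/

import Mathlib

open MeasureTheory

noncomputable section

namespace DetAnderson

/-- The lattice `ℤ^d`; its norm `‖x‖ = max |x_i|` is the one of Mathlib on a product. -/
abbrev Site (d : ℕ) : Type := Fin d → ℤ

/-- The torus `𝕋^ν = (ℝ/ℤ)^ν`, with the max-distance of Mathlib on a product. Its `volume` is the
normalized Haar measure, which is the probability measure `P` below. -/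
abbrev Torus (ν : ℕ) : Type := Fin ν → UnitAddCircle

/-! ### Cubes, scales -/

/-- The lattice cube `Λ_L(u) = {x : ‖x - u‖ ≤ L}`, see `mem_cube`. -/
def cube {d : ℕ} (L : ℕ) (u : Site d) : Finset (Site d) :=
  Finset.Icc (fun i => u i - (L : ℤ)) (fun i => u i + (L : ℤ))

theorem mem_cube {d : ℕ} {L : ℕ} {u x : Site d} : x ∈ cube L u ↔ ‖x - u‖ ≤ (L : ℝ) := by
  rw [pi_norm_le_iff_of_nonneg (Nat.cast_nonneg L)]
  simp only [cube, Finset.mem_Icc, Pi.le_def, ← forall_and]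
  refine forall_congr' fun i => ?_
  rw [Pi.sub_apply, Int.norm_eq_abs, abs_le]
  constructor
  · rintro ⟨h1, h2⟩
    have h1' : ((u i - (L : ℤ) : ℤ) : ℝ) ≤ (x i : ℝ) := by exact_mod_cast h1
    have h2' : (x i : ℝ) ≤ ((u i + (L : ℤ) : ℤ) : ℝ) := by exact_mod_cast h2
    push_cast at *
    constructor <;> linarith
  · rintro ⟨h1, h2⟩
    push_cast at h1 h2
    constructor
    · have : ((u i - (L : ℤ) : ℤ) : ℝ) ≤ (x i : ℝ) := by push_cast; linarith
      exact_mod_cast this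
    · have : (x i : ℝ) ≤ ((u i + (L : ℤ) : ℤ) : ℝ) := by push_cast; linarith
      exact_mod_cast this

/-- The scales `L_0, L_1, …`: `L_k = ⌊L_{k-1} ^ (3/2)⌋ + 1`. -/
def scale (L₀ : ℕ) : ℕ → ℕ
  | 0 => L₀
  | k + 1 => ⌊(scale L₀ k : ℝ) ^ (3 / 2 : ℝ)⌋₊ + 1

/-- `L_{k-1}`, with the convention `L_{-1} = 0`. -/
def prevScale (L₀ : ℕ) : ℕ → ℕ
  | 0 => 0
  | k + 1 => scale L₀ k

/-- `δ_k = g^{-a} exp (-4 L_k^b)` with `a = b = 1/2`. -/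
def delta (L₀ : ℕ) (g : ℝ) (k : ℕ) : ℝ :=
  g ^ (-(1 / 2) : ℝ) * Real.exp (-4 * (scale L₀ k : ℝ) ^ (1 / 2 : ℝ))

/-- The decay exponent `γ(m, L) = m (1 + L^{-1/8})`. -/
def decayRate (m : ℝ) (L : ℕ) : ℝ := m * (1 + (L : ℝ) ^ (-(1 / 8) : ℝ))

/-! ### Assumptions on the dynamical system and on the hull -/

/-- `T` is a measure preserving action of the group `ℤ^d` on `𝕋^ν`. -/
structure IsDynamicalSystem {d ν : ℕ} (T : Site d → Torus ν → Torus ν) : Prop where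
  zero : ∀ ω, T 0 ω = ω
  add : ∀ x y ω, T (x + y) ω = T x (T y ω)
  measurePreserving : ∀ x, MeasurePreserving (T x) volume volume

/-- Uniformly slow returns. -/
def USR {d ν : ℕ} (A C : ℝ) (T : Site d → Torus ν → Torus ν) : Prop :=
  ∀ ω, ∀ x y : Site d, x ≠ y → 4 * C * ‖x - y‖ ^ (-A) ≤ dist (T x ω) (T y ω)

/-- Polynomially bounded local divergence of trajectories. The point `x = 0`, where `T 0 = id` while
`‖0‖ ^ A' = 0`, has to be left out. -/
def DIV {d ν : ℕ} (A' C' : ℝ) (T : Site d → Torus ν → Torus ν) : Prop :=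
  ∀ ω ω', ∀ x : Site d, x ≠ 0 → dist (T x ω) (T x ω') ≤ C' * ‖x‖ ^ A' * dist ω ω'

/-- The `ℤ^ν`-periodic function on `ℝ^ν` given by a function on the torus. -/
def periodicLift {ν : ℕ} (f : Torus ν → ℝ) (t : Fin ν → ℝ) : ℝ :=
  f fun i => (t i : UnitAddCircle)

/-- `f ∈ C¹(𝕋^ν)` with `‖f‖_{C¹} ≤ K`: `f` and its first partial derivatives are bounded by `K`. -/
structure HasC1Bound {ν : ℕ} (K : ℝ) (f : Torus ν → ℝ) : Prop where
  contDiff : ContDiff ℝ 1 (periodicLift f)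
  abs_le : ∀ ω, |f ω| ≤ K
  abs_partial_le : ∀ t i, |fderiv ℝ (periodicLift f) t (Pi.single i 1)| ≤ K

/-- The real random variable `X` admits, conditionally on the sub-σ-algebra `𝔊`, a probability
density that is bounded by `K`: `p z` is the conditional density at the sample point `z`. -/
def HasBoundedCondDensity {Z : Type*} [MeasurableSpace Z] (ρ : Measure Z) (𝔊 : MeasurableSpace Z)
    (X : Z → ℝ) (K : ℝ) : Prop :=
  ∃ p : Z → ℝ → ENNReal,
    Measurable[𝔊.prod (borel ℝ)] (Function.uncurry p) ∧
    (∀ z t, p z t ≤ ENNReal.ofReal K) ∧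
    ∀ S : Set Z, MeasurableSet[𝔊] S → ∀ I : Set ℝ, MeasurableSet I →
      ρ (S ∩ X ⁻¹' I) = ∫⁻ z in S, (∫⁻ t in I, p z t) ∂ρ

/-- Local variation bound. There are σ-algebras `𝔊 L x` of events of `𝕋^ν × Θ`, which contain all
events that depend on `ω` only, such that the values `v (T^y ω, θ)` at the other sites
`y` of `Λ_{L^4}(x)` are `𝔊 L x`-measurable, while `v (T^x ω, θ)` has, conditionally on `𝔊 L x`, a
density bounded by `K L^B`. -/
def LVB {d ν : ℕ} {Θ : Type*} [MeasurableSpace Θ] (B K : ℝ) (T : Site d → Torus ν → Torus ν)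
    (v : Torus ν → Θ → ℝ) (μ : Measure Θ) : Prop :=
  ∃ 𝔊 : ℕ → Site d → MeasurableSpace (Torus ν × Θ), ∀ L : ℕ, 1 ≤ L → ∀ x : Site d,
    𝔊 L x ≤ Prod.instMeasurableSpace ∧
    Measurable[𝔊 L x] (Prod.fst : Torus ν × Θ → Torus ν) ∧
    (∀ y ∈ cube (L ^ 4) x, y ≠ x →
      Measurable[𝔊 L x] fun z : Torus ν × Θ => v (T y z.1) z.2) ∧
    HasBoundedCondDensity ((volume : Measure (Torus ν)).prod μ) (𝔊 L x)
      (fun z => v (T x z.1) z.2) (K * (L : ℝ) ^ B)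

/-! ### Finite-volume operators -/

/-- The sample `V(x; ω, θ) = v(T^x ω, θ)` of the potential. -/
def sample {d ν : ℕ} {Θ : Type*} (T : Site d → Torus ν → Torus ν) (v : Torus ν → Θ → ℝ)
    (ω : Torus ν) (θ : Θ) : Site d → ℝ :=
  fun x => v (T x ω) θ

/-- The operator `(H f)(x) = ∑_{‖y - x‖₁ = 1} f(y) + g V(x) f(x)` restricted to the finite set `Λ`
with Dirichlet boundary conditions. -/
def hamiltonian {d : ℕ} (g : ℝ) (V : Site d → ℝ) (Λ : Finset (Site d)) : Matrix Λ Λ ℝ :=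
  Matrix.of fun x y =>
    (if ∑ i, |x.1 i - y.1 i| = 1 then 1 else 0) + (if x = y then g * V x.1 else 0)

/-- The spectrum `Σ(Λ)` of the restricted operator. -/
def spec {d : ℕ} (g : ℝ) (V : Site d → ℝ) (Λ : Finset (Site d)) : Set ℝ :=
  spectrum ℝ (hamiltonian g V Λ)

/-! ### Resonances and tunneling at scale `k`

The threshold `g δ_k` belongs to the scale `k`; it is used for all cubes inside a cube of radius
`L_k`, whatever their radius. -/

/-- `Λ_ℓ(w)` is `E`-resonant, with the threshold of the scale `k`. -/
def IsResonant {d : ℕ} (L₀ : ℕ) (g : ℝ) (k : ℕ) (V : Site d → ℝ) (E : ℝ) (ℓ : ℕ)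
    (w : Site d) : Prop :=
  Metric.infDist E (spec g V (cube ℓ w)) < g * delta L₀ g k

/-- `Λ_r(w)` is partially `E`-resonant: it is resonant itself or contains a resonant cube of
radius `ℓ ≥ L_{k-1}`. -/
def IsPartiallyResonant {d : ℕ} (L₀ : ℕ) (g : ℝ) (k : ℕ) (V : Site d → ℝ) (E : ℝ) (r : ℕ)
    (w : Site d) : Prop :=
  IsResonant L₀ g k V E r w ∨
    ∃ (ℓ : ℕ) (w' : Site d), prevScale L₀ k ≤ ℓ ∧ cube ℓ w' ⊆ cube r w ∧
      IsResonant L₀ g k V E ℓ w'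

/-- `Λ_{L_k}(u)` is tunneling: for some `E` it contains two disjoint partially `E`-resonant cubes of
radii at least `L_k^{1/4}`. -/
def IsTunneling {d : ℕ} (L₀ : ℕ) (g : ℝ) (k : ℕ) (V : Site d → ℝ) (u : Site d) : Prop :=
  ∃ (E : ℝ) (r r' : ℕ) (w w' : Site d),
    (scale L₀ k : ℝ) ^ (1 / 4 : ℝ) ≤ r ∧ (scale L₀ k : ℝ) ^ (1 / 4 : ℝ) ≤ r' ∧
    cube r w ⊆ cube (scale L₀ k) u ∧ cube r' w' ⊆ cube (scale L₀ k) u ∧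
    Disjoint (cube r w) (cube r' w') ∧
    IsPartiallyResonant L₀ g k V E r w ∧ IsPartiallyResonant L₀ g k V E r' w'

/-- There are pairwise disjoint cubes `Λ_{R_j}(c_j) ⊆ Λ_{L_k}(u_j) ⊆ Λ_{L_k^4}(0)`,
`0 ≤ j ≤ n`, with `L_{k-1} ≤ R_j ≤ L_k`, such that the spectrum in each of them is at distance
at most `4 g δ_k` from the spectrum in the cube number `0`. -/
def HasResonantFamily {d : ℕ} (L₀ : ℕ) (g : ℝ) (k n : ℕ) (V : Site d → ℝ) : Prop :=
  ∃ (R : Fin (n + 1) → ℕ) (c u : Fin (n + 1) → Site d),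
    (∀ j, prevScale L₀ k ≤ R j ∧ R j ≤ scale L₀ k) ∧
    (∀ j, cube (R j) (c j) ⊆ cube (scale L₀ k) (u j)) ∧
    (∀ j, cube (scale L₀ k) (u j) ⊆ cube (scale L₀ k ^ 4) 0) ∧
    (∀ i j, i ≠ j → Disjoint (cube (R i) (c i)) (cube (R j) (c j))) ∧
    ∀ j, j ≠ 0 → ∃ s ∈ spec g V (cube (R j) (c j)), ∃ t ∈ spec g V (cube (R 0) (c 0)),
      |s - t| ≤ 4 * (g * delta L₀ g k)

/-! ### The good parameter set -/

/-- The number `N_k` of grid points per direction: the least integer with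
`1 / (2 N_k) ≤ δ_k^{1 + 1/(2ν)}`. -/
def gridSize (L₀ : ℕ) (g : ℝ) (k ν : ℕ) : ℕ :=
  ⌈(2 * delta L₀ g k ^ (1 + 1 / (2 * (ν : ℝ))))⁻¹⌉₊

/-- The grid point of `𝕋^ν` with coordinates `(2 l_i + 1) / (2 N)`. -/
def gridPoint {ν : ℕ} (N : ℕ) (l : Fin ν → Fin N) : Torus ν :=
  fun i => (((2 * ((l i : ℕ) : ℝ) + 1) / (2 * (N : ℝ)) : ℝ) : UnitAddCircle)

/-- The set `𝒩_k`: at no grid point is there a resonant family of `ν + 2` cubes. -/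
def nonResonantSet {d ν : ℕ} {Θ : Type*} (T : Site d → Torus ν → Torus ν)
    (v : Torus ν → Θ → ℝ) (L₀ : ℕ) (g : ℝ) (k : ℕ) : Set Θ :=
  {θ | ∀ l : Fin ν → Fin (gridSize L₀ g k ν),
    ¬ HasResonantFamily L₀ g k (ν + 1) (sample T v (gridPoint _ l) θ)}

/-- The set `𝒯_k`: tunneling in cubes of radius `L_k` has probability at least `δ_k^{1/2}`. (This
probability does not depend on `u`, since `T` preserves `P`.) -/
def tunnelingSet {d ν : ℕ} {Θ : Type*} (T : Site d → Torus ν → Torus ν)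
    (v : Torus ν → Θ → ℝ) (L₀ : ℕ) (g : ℝ) (k : ℕ) : Set Θ :=
  {θ | ∃ u : Site d, ENNReal.ofReal (delta L₀ g k ^ (1 / 2 : ℝ)) ≤
    volume {ω : Torus ν | IsTunneling L₀ g k (sample T v ω θ) u}}

/-- `Θ_k = ⋂_{l ≤ k} (𝒩_l \ 𝒯_l)`. -/
def goodSet {d ν : ℕ} {Θ : Type*} (T : Site d → Torus ν → Torus ν)
    (v : Torus ν → Θ → ℝ) (L₀ : ℕ) (g : ℝ) (k : ℕ) : Set Θ :=
  ⋂ l ≤ k, nonResonantSet T v L₀ g l \ tunnelingSet T v L₀ g l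

/-- `Θ_∞ = ⋂_k Θ_k`. -/
def goodSetInfty {d ν : ℕ} {Θ : Type*} (T : Site d → Torus ν → Torus ν)
    (v : Torus ν → Θ → ℝ) (L₀ : ℕ) (g : ℝ) : Set Θ :=
  ⋂ k, goodSet T v L₀ g k

/-! ### Localized cubes -/

/-- `Λ_{L_k}(u)` is `m`-localized: every normalized eigenfunction `ψ` of the restricted operator
satisfies `|ψ(x) ψ(y)| ≤ exp (-γ(m, L_{k-1}) ‖x - y‖)` whenever `‖x - y‖ ≥ L_k^{7/8}`. For `k = 0`,
where `γ(m, L_{-1}) = γ(m, 0)` is meaningless, `γ(m, L_0)` is used: `k - 1` is truncated. -/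
def IsLocalized {d : ℕ} (L₀ : ℕ) (g m : ℝ) (k : ℕ) (V : Site d → ℝ) (u : Site d) : Prop :=
  ∀ (E : ℝ) (ψ : cube (scale L₀ k) u → ℂ),
    ((hamiltonian g V (cube (scale L₀ k) u)).map Complex.ofReal).mulVec ψ = (E : ℂ) • ψ →
    ∑ x, ‖ψ x‖ ^ 2 = 1 →
    ∀ x y : cube (scale L₀ k) u, (scale L₀ k : ℝ) ^ (7 / 8 : ℝ) ≤ ‖x.1 - y.1‖ →
      ‖ψ x * ψ y‖ ≤ Real.exp (-(decayRate m (scale L₀ (k - 1))) * ‖x.1 - y.1‖)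

end DetAnderson

end

open DetAnderson MeasureTheory

open MeasureTheory

noncomputable section

/-! The proof splits into a deterministic part, about a single sample of the potential, and a
probabilistic part, which shows that most `θ` are good.

Deterministic part. A potential is sparse (`IsSparse`) if, at every scale and energy, a cube of
radius `L_{k+1}` never contains `n + 1` disjoint partially resonant cubes of radius `L_k`. Induction
on scales (`nonSingular_of_not_isPartiallyResonant`) shows that the resolvent of a cube that is not
partially resonant decays across it. A solution is followed through concentric shells (`descent`). A
shell meeting only nonsingular `L_k`-cubes contracts by their resolvent decay, up to a resonance
loss of at most `exp (4 √L_{k+1})`. At most `3 n` shells are bad. The slow decrease of `γ(m, L_k)`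
in `k` pays for all losses. Hence an eigenfunction is small at `x` whenever a box around `x` is not
partially resonant. Without tunneling, two distant points cannot both have partially resonant boxes,
and the cube is localized (`isLocalized_of_not_isTunneling`).

Sparsity holds at all phases simultaneously once the grid points carry no resonant family
(`isSparse_sample`, with `n = ν + 1`). By DIV and the `C¹` bound, moving a phase to the nearest grid
point changes the potential on `Λ_{L_k^4}(0)` by at most `δ_k`. Thus `ν + 2` resonances at one
energy would persist as a resonant family at the grid point.

Probabilistic part. If two disjoint cubes have close spectra, the eigenvector in the first is not
small at some site `x`. Varying `V(x)` alone leaves the second spectrum fixed, and confines `V(x)`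
to a short set. The conditional density then gives a Wegner bound, a polynomial in `L_k` times `δ_k`
(`LocalVariation.measure_inter_closePair_le`). Iterated over `ν + 1` pairs it gives `δ_k ^ (ν + 1)`.
There are of order `δ_k ^ (-ν - 1/2)` grid points, so `δ_k ^ (1/2)` is left. Tunneling has joint
probability of order `δ_k`, and Markov's inequality in `θ` leaves `δ_k ^ (1/2)` too. This equals `g
^ (-1/4) exp (-2 √L_k)`, which absorbs the polynomials and is summable in `k`. For good `θ` the same
quantity bounds the probability of tunneling, hence of non-localization. -/

namespace DetAnderson

/-! ### Spectra and resolvents of real symmetric matrices. -/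

section Matrices

open Matrix

variable {n : Type*} [Fintype n] [DecidableEq n]

omit [DecidableEq n] in
theorem sum_sq_eq_sum_sq_dotProduct (b : OrthonormalBasis n ℝ (EuclideanSpace ℝ n)) (w : n → ℝ) :
    ∑ i, w i ^ 2 = ∑ j, ((b j : EuclideanSpace ℝ n).ofLp ⬝ᵥ w) ^ 2 := by
  have h := b.sum_sq_norm_inner_right (WithLp.toLp 2 w)
  rw [EuclideanSpace.real_norm_sq_eq] at h
  rw [← h]
  refine Finset.sum_congr rfl fun j _ => ?_
  rw [Real.norm_eq_abs, sq_abs, EuclideanSpace.inner_eq_star_dotProduct]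
  simp [dotProduct_comm]

/-- In the eigenbasis `A - E` acts coordinatewise, by factors of modulus at least `η`. Resolvent
bounds and the stability of spectra both come from this inequality. -/
theorem sq_mul_sum_sq_le {A : Matrix n n ℝ} (hA : A.IsHermitian) {E η : ℝ} (hη : 0 ≤ η)
    (h : ∀ s ∈ spectrum ℝ A, η ≤ |E - s|) (v : n → ℝ) :
    η ^ 2 * ∑ i, v i ^ 2 ≤ ∑ i, ((A *ᵥ v) i - E * v i) ^ 2 := by
  have h2 := sum_sq_eq_sum_sq_dotProduct hA.eigenvectorBasis (A *ᵥ v - E • v)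
  simp only [Pi.sub_apply, Pi.smul_apply, smul_eq_mul] at h2
  rw [h2, sum_sq_eq_sum_sq_dotProduct hA.eigenvectorBasis v, Finset.mul_sum]
  refine Finset.sum_le_sum fun j _ => ?_
  have h3 : (hA.eigenvectorBasis j).ofLp ⬝ᵥ (A *ᵥ v - E • v)
      = (hA.eigenvalues j - E) * ((hA.eigenvectorBasis j).ofLp ⬝ᵥ v) := by
    have hT : Aᵀ = A := by
      have h := hA.eq
      rwa [conjTranspose_eq_transpose_of_trivial] at h
    rw [dotProduct_sub, dotProduct_mulVec, ← mulVec_transpose, hT, hA.mulVec_eigenvectorBasis,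
      dotProduct_smul, smul_dotProduct]
    simp [sub_mul]
  rw [h3, mul_pow]
  refine mul_le_mul_of_nonneg_right ?_ (sq_nonneg _)
  rw [← sq_abs (hA.eigenvalues j - E), abs_sub_comm]
  exact pow_le_pow_left₀ hη
    (h _ (by rw [hA.spectrum_real_eq_range_eigenvalues]; exact ⟨j, rfl⟩)) 2

theorem exists_eigenvector {A : Matrix n n ℝ} {s : ℝ} (hs : s ∈ spectrum ℝ A) :
    ∃ v : n → ℝ, ∑ i, v i ^ 2 = 1 ∧ A *ᵥ v = s • v := by
  rw [← Matrix.spectrum_toLin', ← Module.End.hasEigenvalue_iff_mem_spectrum] at hs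
  obtain ⟨w, hw⟩ := hs.exists_hasEigenvector
  have h0 : 0 < ∑ i, w i ^ 2 := by
    obtain ⟨i, hi⟩ := Function.ne_iff.1 hw.2
    exact Finset.sum_pos' (fun i _ => sq_nonneg _) ⟨i, Finset.mem_univ _, by
      have : w i ≠ 0 := hi
      positivity⟩
  have hw1 : A *ᵥ w = s • w := by simpa using hw.apply_eq_smul
  refine ⟨(Real.sqrt (∑ i, w i ^ 2))⁻¹ • w, ?_, ?_⟩
  · simp only [Pi.smul_apply, smul_eq_mul, mul_pow, ← Finset.mul_sum, inv_pow]
    rw [Real.sq_sqrt h0.le, inv_mul_cancel₀ h0.ne']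
  · rw [mulVec_smul, hw1, smul_comm]

theorem mem_spectrum_of_eigenvector {A : Matrix n n ℝ} {s : ℝ} {v : n → ℝ} (hv : v ≠ 0)
    (h : A *ᵥ v = s • v) : s ∈ spectrum ℝ A := by
  rw [← Matrix.spectrum_toLin', ← Module.End.hasEigenvalue_iff_mem_spectrum]
  exact Module.End.hasEigenvalue_of_hasEigenvector
    (x := v) ⟨Module.End.mem_eigenspace_iff.2 (by simpa using h), hv⟩

/-- If `v` is an approximate eigenvector, then the spectrum is close. -/
theorem exists_mem_spectrum_near {A : Matrix n n ℝ} (hA : A.IsHermitian) {E ε : ℝ} (hε : 0 ≤ ε)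
    {v : n → ℝ} (hv : 0 < ∑ i, v i ^ 2)
    (h : ∑ i, ((A *ᵥ v) i - E * v i) ^ 2 ≤ ε ^ 2 * ∑ i, v i ^ 2) :
    ∃ s ∈ spectrum ℝ A, |E - s| ≤ ε := by
  have : Nonempty n := by
    by_contra hn
    rw [not_nonempty_iff] at hn
    simp at hv
  obtain ⟨j, -, hj⟩ := Finset.exists_min_image Finset.univ (fun j => |E - hA.eigenvalues j|)
    Finset.univ_nonempty
  refine ⟨hA.eigenvalues j, by rw [hA.spectrum_real_eq_range_eigenvalues]; exact ⟨j, rfl⟩, ?_⟩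
  have h1 := sq_mul_sum_sq_le hA (E := E) (abs_nonneg (E - hA.eigenvalues j)) (by
    intro s hs
    rw [hA.spectrum_real_eq_range_eigenvalues] at hs
    obtain ⟨i, rfl⟩ := hs
    exact hj i (Finset.mem_univ _)) v
  have h2 := le_of_mul_le_mul_right (h1.trans h) hv
  exact (sq_le_sq₀ (abs_nonneg _) hε).1 h2

/-- Spectra of matrices that differ by a small diagonal matrix are close. -/
theorem exists_mem_spectrum_of_diagonal_perturbation {A B : Matrix n n ℝ} (hB : B.IsHermitian)
    {ε : ℝ} (hε : 0 ≤ ε) {w : n → ℝ} (hw : ∀ i, |w i| ≤ ε) (hAB : B = A + diagonal w)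
    {s : ℝ} (hs : s ∈ spectrum ℝ A) : ∃ t ∈ spectrum ℝ B, |s - t| ≤ ε := by
  obtain ⟨v, hv, hAv⟩ := exists_eigenvector hs
  refine exists_mem_spectrum_near hB hε (v := v) (by rw [hv]; exact one_pos) ?_
  rw [Finset.mul_sum]
  refine Finset.sum_le_sum fun i _ => ?_
  have : (B *ᵥ v) i - s * v i = w i * v i := by
    rw [hAB, add_mulVec, hAv, Pi.add_apply, mulVec_diagonal]
    simp
  rw [this, mul_pow]
  refine mul_le_mul_of_nonneg_right ?_ (sq_nonneg _)
  rw [← sq_abs]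
  exact pow_le_pow_left₀ (abs_nonneg _) (hw i) 2

theorem isUnit_sub_smul_one {A : Matrix n n ℝ} {E : ℝ} (h : E ∉ spectrum ℝ A) :
    IsUnit (A - E • (1 : Matrix n n ℝ)) := by
  rw [spectrum.notMem_iff, Algebra.algebraMap_eq_smul_one] at h
  simpa using h.neg

/-- Column `y` of the resolvent is mapped by `A - E` to a unit vector, so its Euclidean norm is at
most `1 / η`. -/
theorem abs_green_le {A : Matrix n n ℝ} (hA : A.IsHermitian) {E η : ℝ} (hη : 0 < η)
    (h : ∀ s ∈ spectrum ℝ A, η ≤ |E - s|) (x y : n) :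
    |(A - E • (1 : Matrix n n ℝ))⁻¹ x y| ≤ 1 / η := by
  have hE : E ∉ spectrum ℝ A := fun hE => by
    have := h E hE
    simp at this
    linarith
  have hu := isUnit_sub_smul_one hE
  set G := (A - E • (1 : Matrix n n ℝ))⁻¹ with hG
  have h1 := sq_mul_sum_sq_le hA hη.le h (fun i => G i y)
  have h2 : ∀ i, (A *ᵥ (fun i => G i y)) i - E * G i y = (1 : Matrix n n ℝ) i y := by
    intro i
    have h3 : ((A - E • (1 : Matrix n n ℝ)) * G) i y = (1 : Matrix n n ℝ) i y := by
      rw [hG, Matrix.mul_nonsing_inv _ ((Matrix.isUnit_iff_isUnit_det _).1 hu)]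
    rw [sub_mul, Matrix.sub_apply, smul_mul, one_mul, Matrix.smul_apply] at h3
    simpa [Matrix.mul_apply, mulVec, dotProduct] using h3
  simp only [h2] at h1
  have h4 : ∑ i, ((1 : Matrix n n ℝ) i y) ^ 2 = 1 := by
    simp [Matrix.one_apply]
  rw [h4] at h1
  have h5 : (G x y) ^ 2 ≤ ∑ i, (G i y) ^ 2 :=
    Finset.single_le_sum (f := fun i => (G i y) ^ 2) (fun i _ => sq_nonneg _) (Finset.mem_univ x)
  have h6 : (η * |G x y|) ^ 2 ≤ 1 ^ 2 := by
    rw [mul_pow, sq_abs]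
    nlinarith [sq_nonneg η]
  have h7 := (sq_le_sq₀ (by positivity) zero_le_one).1 h6
  rw [le_div_iff₀ hη]
  linarith

end Matrices

/-! ### Finite-volume operators and the geometric resolvent expansion. -/

section Hamiltonian

open Matrix

variable {d : ℕ}

/-- The indicator of nearest neighbours. -/
def hop (x y : Site d) : ℝ := if ∑ i, |x i - y i| = 1 then 1 else 0

theorem hop_nonneg (x y : Site d) : 0 ≤ hop x y := by unfold hop; split_ifs <;> norm_num

theorem hop_le_one (x y : Site d) : hop x y ≤ 1 := by unfold hop; split_ifs <;> norm_num

theorem hop_comm (x y : Site d) : hop x y = hop y x := by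
  unfold hop
  simp only [abs_sub_comm]

theorem hop_self (x : Site d) : hop x x = 0 := by simp [hop]

theorem hamiltonian_apply (g : ℝ) (V : Site d → ℝ) (Λ : Finset (Site d)) (x y : Λ) :
    hamiltonian g V Λ x y = hop x.1 y.1 + if x = y then g * V x.1 else 0 := rfl

theorem isHermitian_hamiltonian (g : ℝ) (V : Site d → ℝ) (Λ : Finset (Site d)) :
    (hamiltonian g V Λ).IsHermitian := by
  ext x y
  simp only [conjTranspose_apply, hamiltonian_apply, star_trivial]
  rw [hop_comm]
  by_cases h : x = y
  · subst h; rfl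
  · simp [h, Ne.symm h]

theorem hamiltonian_mulVec (g : ℝ) (V : Site d → ℝ) (Λ : Finset (Site d)) (f : Site d → ℝ)
    (x : Λ) : (hamiltonian g V Λ *ᵥ fun y => f y.1) x
      = ∑ y ∈ Λ, hop x.1 y * f y + g * V x.1 * f x.1 := by
  simp only [mulVec, dotProduct, hamiltonian_apply, add_mul, Finset.sum_add_distrib]
  congr 1
  · exact Finset.sum_coe_sort Λ fun y => hop x.1 y * f y
  · simp [ite_mul]

/-- The resolvent of the restricted operator. -/
def green (g : ℝ) (V : Site d → ℝ) (E : ℝ) (Λ : Finset (Site d)) : Matrix Λ Λ ℝ :=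
  (hamiltonian g V Λ - E • (1 : Matrix Λ Λ ℝ))⁻¹

/-- `f` solves `(H_Λ - E) f = 0` at the site `x`. -/
def SolvesAt (g : ℝ) (V : Site d → ℝ) (E : ℝ) (Λ : Finset (Site d)) (f : Site d → ℝ)
    (x : Site d) : Prop :=
  ∑ y ∈ Λ, hop x y * f y + g * V x * f x = E * f x

/-- On `D` the equation says that `(H_D - E) f` is minus the hopping terms that leave `D`; inverting
gives the geometric resolvent expansion. -/
theorem eq_sum_green {g : ℝ} {V : Site d → ℝ} {E : ℝ} {Λ D : Finset (Site d)} {f : Site d → ℝ}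
    (hD : D ⊆ Λ) (hE : E ∉ spec g V D) (hf : ∀ x ∈ D, SolvesAt g V E Λ f x) (x : D) :
    f x.1 = -∑ x' : D, green g V E D x x' * ∑ y ∈ Λ \ D, hop x'.1 y * f y := by
  have hu := isUnit_sub_smul_one hE
  have h1 : (hamiltonian g V D - E • (1 : Matrix D D ℝ)) *ᵥ (fun y : D => f y.1)
      = fun x' : D => -∑ y ∈ Λ \ D, hop x'.1 y * f y := by
    ext x'
    rw [sub_mulVec, Pi.sub_apply, hamiltonian_mulVec, smul_mulVec, one_mulVec, Pi.smul_apply,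
      smul_eq_mul]
    have := hf x'.1 x'.2
    unfold SolvesAt at this
    rw [← Finset.sum_sdiff hD] at this
    linarith
  have h2 := congrArg (fun w => (green g V E D *ᵥ w) x) h1
  simp only [mulVec_mulVec] at h2
  rw [green, Matrix.nonsing_inv_mul _ ((Matrix.isUnit_iff_isUnit_det _).1 hu), one_mulVec] at h2
  rw [h2, ← green]
  simp [mulVec, dotProduct]

/-- Only bonds `(x', y)` leaving `D` contribute; `card ^ 2` counts all pairs crudely. -/
theorem abs_le_of_green {g : ℝ} {V : Site d → ℝ} {E : ℝ} {Λ D : Finset (Site d)}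
    {f : Site d → ℝ} (hD : D ⊆ Λ) (hE : E ∉ spec g V D) (hf : ∀ x ∈ D, SolvesAt g V E Λ f x)
    (x : D) {κ M : ℝ} (hκ : 0 ≤ κ) (hM : 0 ≤ M)
    (hG : ∀ x' : D, ∀ y ∈ Λ, y ∉ D → hop x'.1 y ≠ 0 → |green g V E D x x'| ≤ κ ∧ |f y| ≤ M) :
    |f x.1| ≤ (Λ.card : ℝ) ^ 2 * (κ * M) := by
  rw [eq_sum_green hD hE hf x, abs_neg]
  have hterm : ∀ x' : D, |green g V E D x x' * ∑ y ∈ Λ \ D, hop x'.1 y * f y|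
      ≤ Λ.card * (κ * M) := by
    intro x'
    rw [Finset.mul_sum]
    refine (Finset.abs_sum_le_sum_abs _ _).trans ?_
    refine (Finset.sum_le_card_nsmul _ _ (κ * M) ?_).trans ?_
    · intro y hy
      rw [Finset.mem_sdiff] at hy
      by_cases h0 : hop x'.1 y = 0
      · rw [h0]; simp; positivity
      · obtain ⟨h1, h2⟩ := hG x' y hy.1 hy.2 h0
        rw [abs_mul, abs_mul, abs_of_nonneg (hop_nonneg _ _)]
        have := hop_le_one x'.1 y
        have h3 : hop x'.1 y * |f y| ≤ 1 * M := by gcongr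
        rw [one_mul] at h3
        exact mul_le_mul h1 h3 (mul_nonneg (hop_nonneg _ _) (abs_nonneg _)) hκ
    · rw [nsmul_eq_mul]
      gcongr
      exact Finset.sdiff_subset
  refine (Finset.abs_sum_le_sum_abs _ _).trans ?_
  refine (Finset.sum_le_card_nsmul _ _ _ fun x' _ => hterm x').trans ?_
  rw [nsmul_eq_mul, sq, mul_assoc]
  gcongr
  simpa using Finset.card_le_card hD

theorem spec_finite (g : ℝ) (V : Site d → ℝ) (Λ : Finset (Site d)) : (spec g V Λ).Finite := by
  rw [spec, (isHermitian_hamiltonian g V Λ).spectrum_real_eq_range_eigenvalues]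
  exact Set.finite_range _

theorem spec_ncard_le (g : ℝ) (V : Site d → ℝ) (Λ : Finset (Site d)) :
    (spec_finite g V Λ).toFinset.card ≤ Λ.card := by
  rw [← Set.ncard_eq_toFinset_card _ (spec_finite g V Λ)]
  rw [spec, (isHermitian_hamiltonian g V Λ).spectrum_real_eq_range_eigenvalues, ← Set.image_univ]
  refine (Set.ncard_image_le Set.finite_univ).trans ?_
  rw [Set.ncard_univ]
  simp

theorem spec_nonempty (g : ℝ) (V : Site d → ℝ) {Λ : Finset (Site d)} (hΛ : Λ.Nonempty) :
    (spec g V Λ).Nonempty := by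
  rw [spec, (isHermitian_hamiltonian g V Λ).spectrum_real_eq_range_eigenvalues]
  have : Nonempty Λ := hΛ.to_subtype
  exact Set.range_nonempty _

theorem hamiltonian_eq_add_diagonal (g : ℝ) (V V' : Site d → ℝ) (Λ : Finset (Site d)) :
    hamiltonian g V' Λ = hamiltonian g V Λ + diagonal fun x : Λ => g * (V' x.1 - V x.1) := by
  ext x y
  simp only [Matrix.add_apply, hamiltonian_apply, diagonal_apply]
  by_cases h : x = y
  · subst h; simp; ring
  · simp [h]

theorem exists_mem_spec_near {g : ℝ} (hg : 0 ≤ g) {V V' : Site d → ℝ} {Λ : Finset (Site d)}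
    {ε : ℝ} (hε : 0 ≤ ε) (h : ∀ x ∈ Λ, |V' x - V x| ≤ ε) {s : ℝ} (hs : s ∈ spec g V Λ) :
    ∃ t ∈ spec g V' Λ, |s - t| ≤ g * ε := by
  refine exists_mem_spectrum_of_diagonal_perturbation (isHermitian_hamiltonian g V' Λ)
    (by positivity) (fun x => ?_) (hamiltonian_eq_add_diagonal g V V' Λ) hs
  rw [abs_mul, abs_of_nonneg hg]
  exact mul_le_mul_of_nonneg_left (h x.1 x.2) hg

theorem spec_congr {g : ℝ} {V V' : Site d → ℝ} {Λ : Finset (Site d)}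
    (h : ∀ x ∈ Λ, V x = V' x) : spec g V Λ = spec g V' Λ := by
  unfold spec
  congr 1
  ext x y
  simp only [hamiltonian_apply, h x.1 x.2]

/-- Translation of a potential. -/
def shift (u : Site d) (V : Site d → ℝ) : Site d → ℝ := fun x => V (x + u)

theorem mem_cube_iff {L : ℕ} {u x : Site d} :
    x ∈ cube L u ↔ ∀ i, u i - (L : ℤ) ≤ x i ∧ x i ≤ u i + (L : ℤ) := by
  simp only [cube, Finset.mem_Icc, Pi.le_def, ← forall_and]

theorem mem_cube_add {L : ℕ} {u w x : Site d} : x + u ∈ cube L (w + u) ↔ x ∈ cube L w := by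
  simp only [mem_cube_iff, Pi.add_apply]
  exact forall_congr' fun i => by constructor <;> rintro ⟨_, _⟩ <;> constructor <;> omega

theorem spec_shift (g : ℝ) (V : Site d → ℝ) (ℓ : ℕ) (w u : Site d) :
    spec g (shift u V) (cube ℓ w) = spec g V (cube ℓ (w + u)) := by
  let e : cube ℓ w ≃ cube ℓ (w + u) :=
    { toFun := fun x => ⟨x.1 + u, mem_cube_add.2 x.2⟩
      invFun := fun x => ⟨x.1 - u, (mem_cube_add (u := u)).1 ((sub_add_cancel x.1 u).symm ▸ x.2)⟩
      left_inv := fun x => by simp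
      right_inv := fun x => by simp }
  have h : hamiltonian g V (cube ℓ (w + u))
      = Matrix.reindexAlgEquiv ℝ ℝ e (hamiltonian g (shift u V) (cube ℓ w)) := by
    ext x y
    simp only [coe_reindexAlgEquiv, reindex_apply, submatrix_apply, hamiltonian_apply, e,
      Equiv.coe_fn_symm_mk, shift, hop, Pi.sub_apply, sub_sub_sub_cancel_right, sub_add_cancel,
      sub_left_inj, Subtype.ext_iff]
  unfold spec
  rw [h, AlgEquiv.spectrum_eq]

end Hamiltonian

/-! ### Geometry of cubes pushed into a larger cube. -/

section Boxes

variable {d : ℕ}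

/-- The centre of the cube of radius `r` inside `Λ_L(u)` that is closest to `x`. -/
def clampCenter (L : ℕ) (u : Site d) (r : ℕ) (x : Site d) : Site d :=
  fun i => max (u i - ((L : ℤ) - r)) (min (x i) (u i + ((L : ℤ) - r)))

/-- The cube of radius `r` around `x`, pushed into `Λ_L(u)`. -/
def box (L : ℕ) (u : Site d) (r : ℕ) (x : Site d) : Finset (Site d) :=
  cube r (clampCenter L u r x)

theorem mem_box_iff {L r : ℕ} {u x z : Site d} : z ∈ box L u r x ↔
    ∀ i, max (u i - ((L : ℤ) - r)) (min (x i) (u i + ((L : ℤ) - r))) - (r : ℤ) ≤ z i ∧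
      z i ≤ max (u i - ((L : ℤ) - r)) (min (x i) (u i + ((L : ℤ) - r))) + (r : ℤ) :=
  mem_cube_iff

theorem box_subset {L r : ℕ} {u x : Site d} (hr : r ≤ L) : box L u r x ⊆ cube L u := by
  intro z hz
  rw [mem_box_iff] at hz
  rw [mem_cube_iff]
  intro i
  have := hz i
  omega

theorem self_mem_box {L r : ℕ} {u x : Site d} (hr : r ≤ L) (hx : x ∈ cube L u) :
    x ∈ box L u r x := by
  rw [mem_cube_iff] at hx
  rw [mem_box_iff]
  intro i
  have := hx i
  omega

/-- Radii of pushed cubes add as in the triangle inequality while they fit into `Λ_L(u)`. Near the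
boundary the cubes are pushed, not truncated, so that resonance hypotheses, which concern full
cubes, apply to them. -/
theorem box_subset_box {L r s : ℕ} {u x z : Site d} (hrs : r + s ≤ L) (hx : x ∈ cube L u)
    (hz : z ∈ box L u r x) : box L u s z ⊆ box L u (r + s) x := by
  intro p hp
  rw [mem_cube_iff] at hx
  rw [mem_box_iff] at hz hp ⊢
  intro i
  have h1 := hz i
  have h2 := hp i
  have h3 := hx i
  push_cast
  omega

theorem box_mono {L r r' : ℕ} {u x : Site d} (h : r ≤ r') (hr : r' ≤ L) (hx : x ∈ cube L u) :
    box L u r x ⊆ box L u r' x := by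
  intro p hp
  rw [mem_cube_iff] at hx
  rw [mem_box_iff] at hp ⊢
  intro i
  have h2 := hp i
  have h3 := hx i
  omega

/-- Pushing moves the centre by at most `r`, so a point of the box is within `2 * r` of `z`, but in
general not within `r`. -/
theorem mem_box_two_mul {L r : ℕ} {u x p z : Site d} (hr : 2 * r ≤ L) (hx : x ∈ cube L u)
    (hz : z ∈ cube L u) (hp : p ∈ box L u r z) : z ∈ box L u (2 * r) p := by
  rw [mem_cube_iff] at hx hz
  rw [mem_box_iff] at hp ⊢
  intro i
  have h1 := hp i
  have h2 := hx i
  have h3 := hz i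
  push_cast
  omega

theorem disjoint_box {L r r' ℓ : ℕ} {u x z z' : Site d} (hx : x ∈ cube L u)
    (hz : z ∈ box L u r x) (hz' : z' ∈ cube L u) (hz'r : z' ∉ box L u r' x)
    (hr : r + 3 * ℓ ≤ r') (hr' : r' ≤ L) : Disjoint (box L u ℓ z) (box L u ℓ z') := by
  rw [Finset.disjoint_left]
  intro p hp hp'
  have h1 := box_subset_box (by omega) hx hz hp
  have h2 := mem_box_two_mul (by omega) hx hz' hp'
  exact hz'r (box_mono hr hr' hx
    (by have := box_subset_box (s := 2 * ℓ) (by omega) hx h1 h2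
        rwa [show r + ℓ + 2 * ℓ = r + 3 * ℓ by ring] at this))

theorem abs_sub_le_one_of_hop {x y : Site d} (h : hop x y ≠ 0) (i : Fin d) :
    |x i - y i| ≤ 1 := by
  have h1 : ∑ i, |x i - y i| = 1 := by
    by_contra h2
    exact h (by simp [hop, h2])
  rw [← h1]
  exact Finset.single_le_sum (f := fun i => |x i - y i|) (fun i _ => abs_nonneg _)
    (Finset.mem_univ i)

theorem mem_box_succ_of_hop {L r : ℕ} {u x y z : Site d} (hr : r + 1 ≤ L) (hx : x ∈ cube L u)
    (hz : z ∈ box L u r x) (hy : y ∈ cube L u) (h : hop z y ≠ 0) : y ∈ box L u (r + 1) x := by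
  rw [mem_cube_iff] at hx hy
  rw [mem_box_iff] at hz ⊢
  intro i
  have h1 := hz i
  have h2 := hx i
  have h3 := hy i
  have h4 := abs_le.1 (abs_sub_le_one_of_hop h i)
  push_cast
  omega

/-- `y` lies on a face of the cube `Λ_r(c)` that does not belong to the half containing `x`. -/
def IsFar (r : ℕ) (c x y : Site d) : Prop :=
  ∃ i, (y i = c i + r ∧ x i ≤ c i) ∨ (y i = c i - r ∧ c i ≤ x i)

/-- A face with a neighbour still inside `Λ_L(u)` is not on the boundary of `Λ_L(u)`, so the centre
was not pushed away from it. Hence `x` lies in the opposite half, although it need not be the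
centre. The expansion only ever leaves the box through such faces. -/
theorem isFar_of_hop {L r : ℕ} {u x y z : Site d} (hr : r ≤ L) (hx : x ∈ cube L u)
    (hz : z ∈ box L u r x) (hy : y ∈ cube L u) (hyr : y ∉ box L u r x) (h : hop z y ≠ 0) :
    IsFar r (clampCenter L u r x) x z := by
  rw [mem_cube_iff] at hx hy
  rw [mem_box_iff] at hz hyr
  push Not at hyr
  obtain ⟨i, hi⟩ := hyr
  refine ⟨i, ?_⟩
  have h1 := hz i
  have h2 := hx i
  have h3 := hy i
  have h4 := abs_le.1 (abs_sub_le_one_of_hop h i)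
  unfold clampCenter
  omega

theorem notMem_box_of_isFar {L r : ℕ} {u x y : Site d} (hr : r < L) (hx : x ∈ cube L u)
    (h : IsFar L u x y) : y ∉ box L u r x := by
  obtain ⟨i, hi⟩ := h
  intro hy
  rw [mem_cube_iff] at hx
  rw [mem_box_iff] at hy
  have h1 := hy i
  have h2 := hx i
  omega

theorem norm_sub_le_iff {x y : Site d} {n : ℕ} : ‖x - y‖ ≤ (n : ℝ) ↔ ∀ i, |x i - y i| ≤ (n : ℤ) := by
  rw [← mem_cube, mem_cube_iff]
  refine forall_congr' fun i => ?_
  rw [abs_le]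
  constructor <;> rintro ⟨_, _⟩ <;> constructor <;> omega

/-- Each of the two points is within `2 * r` of any common point of the boxes. -/
theorem disjoint_box_of_lt {L r : ℕ} {u x y : Site d} (hr : r ≤ L) (hx : x ∈ cube L u)
    (hy : y ∈ cube L u) (h : 4 * (r : ℝ) < ‖x - y‖) :
    Disjoint (box L u r x) (box L u r y) := by
  rw [Finset.disjoint_left]
  intro p hp hp'
  apply absurd h
  rw [not_lt]
  have : ‖x - y‖ ≤ ((4 * r : ℕ) : ℝ) := by
    rw [norm_sub_le_iff]
    intro i
    rw [mem_cube_iff] at hx hy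
    rw [mem_box_iff] at hp hp'
    have h1 := hp i
    have h2 := hp' i
    have h3 := hx i
    have h4 := hy i
    rw [abs_le]
    push_cast
    omega
  simpa using this

theorem cube_subset_cube_iff {r L : ℕ} {w u : Site d} :
    cube r w ⊆ cube L u ↔ ∀ i, u i - (L : ℤ) ≤ w i - r ∧ w i + r ≤ u i + (L : ℤ) := by
  constructor
  · intro h i
    have h1 : (fun i => w i - (r : ℤ)) ∈ cube r w := by
      rw [mem_cube_iff]; intro j; omega
    have h2 : (fun i => w i + (r : ℤ)) ∈ cube r w := by
      rw [mem_cube_iff]; intro j; omega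
    have h3 := mem_cube_iff.1 (h h1) i
    have h4 := mem_cube_iff.1 (h h2) i

    omega
  · intro h x hx
    rw [mem_cube_iff] at hx ⊢
    intro i
    have := h i
    have := hx i
    omega

theorem radius_le_of_cube_subset (hd : 1 ≤ d) {r L : ℕ} {w u : Site d} (h : cube r w ⊆ cube L u) :
    r ≤ L := by
  have := cube_subset_cube_iff.1 h ⟨0, hd⟩
  omega

theorem self_mem_cube (L : ℕ) (u : Site d) : u ∈ cube L u := by
  rw [mem_cube_iff]; intro i; omega

theorem cube_nonempty (L : ℕ) (u : Site d) : (cube L u).Nonempty := ⟨u, self_mem_cube L u⟩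

theorem card_cube (L : ℕ) (u : Site d) : (cube L u).card = (2 * L + 1) ^ d := by
  rw [cube, Pi.card_Icc]
  simp only [Int.card_Icc]
  rw [Finset.prod_congr rfl (g := fun _ => 2 * L + 1) (fun i _ => by omega)]
  simp

end Boxes

/-! ### Decay of solutions through concentric shells. -/

section Descent

variable {d : ℕ}

/-- Off-diagonal decay of the resolvent in `Λ_ℓ(w)`, from one half of the cube to the opposite
face. -/
def NonSingular (g : ℝ) (V : Site d → ℝ) (E κ : ℝ) (ℓ : ℕ) (w : Site d) : Prop :=
  E ∉ spec g V (cube ℓ w) ∧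
    ∀ x y : cube ℓ w, IsFar ℓ w x.1 y.1 → |green g V E (cube ℓ w) x y| ≤ κ

theorem abs_le_of_nonSingular {g : ℝ} {V : Site d → ℝ} {E κ : ℝ} {L ℓ : ℕ} {u z : Site d}
    {f : Site d → ℝ} {M : ℝ} (hℓ : ℓ + 1 ≤ L) (hz : z ∈ cube L u)
    (hns : NonSingular g V E κ ℓ (clampCenter L u ℓ z)) (hκ : 0 ≤ κ) (hM : 0 ≤ M)
    (hsol : ∀ x ∈ box L u ℓ z, SolvesAt g V E (cube L u) f x)
    (hf : ∀ y ∈ box L u (ℓ + 1) z, |f y| ≤ M) :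
    |f z| ≤ ((cube L u).card : ℝ) ^ 2 * (κ * M) := by
  refine abs_le_of_green (box_subset (by omega)) hns.1 hsol ⟨z, self_mem_box (by omega) hz⟩ hκ hM ?_
  intro x' y hy hyb hop
  exact ⟨hns.2 _ _ (isFar_of_hop (by omega) hz x'.2 hy hyb hop),
    hf y (mem_box_succ_of_hop hℓ hz x'.2 hy hop)⟩

/-- Two expansions are chained. The box of radius `r`, with the a priori bound `Γ`, leads to a point
just outside it; the nonsingular cube around that point gives the gain `κ`. The radius grows by `1 +
(ℓ + 1)`, and each expansion costs `card ^ 2`. -/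
theorem descent_step {g : ℝ} {V : Site d → ℝ} {E Γ κ : ℝ} {L ℓ r R : ℕ} {u x₀ : Site d}
    {f : Site d → ℝ} {M : ℝ} (hx₀ : x₀ ∈ cube L u) (hR : R < L) (hr : r + ℓ + 2 ≤ R)
    (hsol : ∀ x ∈ box L u R x₀, SolvesAt g V E (cube L u) f x)
    (hE : E ∉ spec g V (box L u r x₀))
    (hΓ : ∀ x x', |green g V E (box L u r x₀) x x'| ≤ Γ) (hΓ0 : 0 ≤ Γ) (hκ : 0 ≤ κ) (hM : 0 ≤ M)
    (hgood : ∀ z ∈ box L u (r + 1) x₀, z ∉ box L u r x₀ →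
      NonSingular g V E κ ℓ (clampCenter L u ℓ z))
    (hf : ∀ y ∈ box L u (r + ℓ + 2) x₀, |f y| ≤ M) :
    ∀ x ∈ box L u r x₀, |f x| ≤ ((cube L u).card : ℝ) ^ 4 * (Γ * κ) * M := by
  intro x hx
  have key : |f x| ≤ ((cube L u).card : ℝ) ^ 2 * (Γ * (((cube L u).card : ℝ) ^ 2 * (κ * M))) := by
    refine abs_le_of_green (box_subset (by omega)) hE (fun y hy => hsol y
      (box_mono (by omega) (by omega) hx₀ hy)) ⟨x, hx⟩ hΓ0 (by positivity) ?_
    intro x' y hy hyb hop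
    refine ⟨hΓ _ _, ?_⟩
    have hy1 : y ∈ box L u (r + 1) x₀ := mem_box_succ_of_hop (by omega) hx₀ x'.2 hy hop
    refine abs_le_of_nonSingular (by omega) hy (hgood y hy1 hyb) hκ hM ?_ ?_
    · intro p hp
      exact hsol p (box_mono (by omega) (by omega) hx₀
        (box_subset_box (by omega) hx₀ hy1 hp))
    · intro p hp
      have := box_subset_box (s := ℓ + 1) (by omega) hx₀ hy1 hp
      exact hf p (by rwa [show r + 1 + (ℓ + 1) = r + ℓ + 2 by ring] at this)
  refine key.trans (le_of_eq ?_)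
  ring

/-- The radii around `x₀` for which the next sphere carries the centre of a bad cube. -/
theorem card_bad_radii_le {L ℓ R J n : ℕ} {u x₀ : Site d} (hx₀ : x₀ ∈ cube L u) (hR : R < L)
    (hJ : ℓ + J * (ℓ + 2) ≤ R) (Bad : Site d → Prop)
    (hfam : ∀ z : Fin (n + 1) → Site d,
      (∀ j, box L u ℓ (z j) ⊆ box L u R x₀ ∧ Bad (z j)) →
      (∀ i j, i ≠ j → Disjoint (box L u ℓ (z i)) (box L u ℓ (z j))) → False)
    (s : Finset ℕ) (hs : ∀ j ∈ s, j < J ∧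
      ∃ z ∈ box L u (ℓ + j * (ℓ + 2) + 1) x₀, z ∉ box L u (ℓ + j * (ℓ + 2)) x₀ ∧ Bad z) :
    s.card ≤ 3 * n := by
  classical
  have hjJ : ∀ j, j < J → ℓ + j * (ℓ + 2) + (ℓ + 2) ≤ R := by
    intro j hj
    have : (j + 1) * (ℓ + 2) ≤ J * (ℓ + 2) := Nat.mul_le_mul_right _ hj
    rw [Nat.succ_mul] at this
    omega
  -- Distinct bad radii in one residue class mod 3 differ by at least `3 * (ℓ + 2)`, which makes the
  -- corresponding `ℓ`-boxes disjoint. So each class has at most `n` elements.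
  have h1 : s.card ≤ n * (s.image (· % 3)).card := by
    refine Finset.card_le_mul_card_image s n ?_
    intro a _
    by_contra hcard
    push Not at hcard
    obtain ⟨t, ht, htc⟩ := Finset.exists_subset_card_eq (show n + 1 ≤ _ from hcard)
    have ht' : ∀ j ∈ t, j ∈ s ∧ j % 3 = a := fun j hj => by simpa using ht hj
    choose! z hz using fun j hj => (hs j (ht' j hj).1).2
    have e := t.equivFinOfCardEq htc
    refine hfam (fun i => z (e.symm i).1) (fun i => ?_) ?_
    · have hi := (e.symm i).2
      have h2 := hjJ _ (hs _ (ht' _ hi).1).1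
      refine ⟨?_, (hz _ hi).2.2⟩
      exact (box_subset_box (by omega) hx₀ (hz _ hi).1).trans
        (box_mono (by omega) (by omega) hx₀)
    · have main : ∀ j ∈ t, ∀ j' ∈ t, j < j' →
          Disjoint (box L u ℓ (z j)) (box L u ℓ (z j')) := by
        intro j hj j' hj' hlt
        have hJ' := hjJ _ (hs _ (ht' _ hj').1).1
        have h3 : j + 3 ≤ j' := by
          have := (ht' _ hj).2
          have := (ht' _ hj').2
          omega
        have h4 := Nat.mul_le_mul_right (ℓ + 2) h3
        rw [add_mul] at h4
        refine disjoint_box hx₀ (hz j hj).1 (box_subset (by omega) (hz j' hj').1)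
          (hz j' hj').2.1 (by omega) (by omega)
      intro i i' hne
      have hne' : (e.symm i).1 ≠ (e.symm i').1 := fun h => hne (e.symm.injective (Subtype.ext h))
      rcases lt_or_gt_of_ne hne' with h | h
      · exact main _ (e.symm i).2 _ (e.symm i').2 h
      · exact (main _ (e.symm i').2 _ (e.symm i).2 h).symm
  have h2 : (s.image (· % 3)).card ≤ 3 := by
    refine (Finset.card_le_card (t := Finset.range 3) ?_).trans (by simp)
    intro a ha
    obtain ⟨j, -, rfl⟩ := Finset.mem_image.1 ha
    exact Finset.mem_range.2 (Nat.mod_lt _ (by norm_num))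
  calc s.card ≤ n * (s.image (· % 3)).card := h1
    _ ≤ n * 3 := Nat.mul_le_mul_left _ h2
    _ = 3 * n := mul_comm _ _

/-- Decay of a solution, when at most `n` disjoint cubes of radius `ℓ` are singular. -/
theorem descent {g : ℝ} {V : Site d → ℝ} {E Γ κ : ℝ} {L ℓ R J n : ℕ} {u x₀ : Site d}
    {f : Site d → ℝ} {M : ℝ} (hx₀ : x₀ ∈ cube L u) (hR : R < L) (hJ : ℓ + J * (ℓ + 2) ≤ R)
    (hsol : ∀ x ∈ box L u R x₀, SolvesAt g V E (cube L u) f x)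
    (hΓ : ∀ r, ℓ ≤ r → r ≤ R → E ∉ spec g V (box L u r x₀) ∧
      ∀ x x', |green g V E (box L u r x₀) x x'| ≤ Γ)
    (hΓ0 : 0 ≤ Γ) (hκ : 0 ≤ κ) (hM : 0 ≤ M)
    (hq : ((cube L u).card : ℝ) ^ 4 * (Γ * κ) ≤ 1)
    (hfam : ∀ z : Fin (n + 1) → Site d,
      (∀ j, box L u ℓ (z j) ⊆ box L u R x₀ ∧
        ¬ NonSingular g V E κ ℓ (clampCenter L u ℓ (z j))) →
      (∀ i j, i ≠ j → Disjoint (box L u ℓ (z i)) (box L u ℓ (z j))) → False)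
    (hf : ∀ y ∈ box L u R x₀, |f y| ≤ M) :
    |f x₀| ≤ (((cube L u).card : ℝ) ^ 4 * (Γ * κ)) ^ (J - 3 * n) * M := by
  classical
  set q := ((cube L u).card : ℝ) ^ 4 * (Γ * κ) with hqdef
  have hq0 : 0 ≤ q := by positivity
  let isBad : ℕ → Prop := fun j => ∃ z ∈ box L u (ℓ + j * (ℓ + 2) + 1) x₀,
    z ∉ box L u (ℓ + j * (ℓ + 2)) x₀ ∧ ¬ NonSingular g V E κ ℓ (clampCenter L u ℓ z)
  have hjJ : ∀ j, j ≤ J → ℓ + j * (ℓ + 2) ≤ R := by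
    intro j hj
    have : j * (ℓ + 2) ≤ J * (ℓ + 2) := Nat.mul_le_mul_right _ hj
    omega
  -- Induction from the outermost radius inwards; the exponent counts the good radii still to be
  -- crossed. At a bad radius nothing is gained and the bound of the larger box is reused.
  have key : ∀ i j, j + i = J → ∀ x ∈ box L u (ℓ + j * (ℓ + 2)) x₀,
      |f x| ≤ q ^ ((Finset.Ico j J).filter fun j => ¬ isBad j).card * M := by
    intro i
    induction i with
    | zero =>
      rintro j rfl x hx
      simpa using hf x (box_mono (r' := R) (hjJ j le_rfl) (by omega) hx₀ hx)
    | succ i ih =>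
      intro j hj x hx
      have ih' := ih (j + 1) (by omega)
      have hIco : Finset.Ico j J = insert j (Finset.Ico (j + 1) J) := by
        ext a; simp only [Finset.mem_Ico, Finset.mem_insert]; omega
      have hjb := hjJ (j + 1) (by omega)
      have hmul : ℓ + (j + 1) * (ℓ + 2) = ℓ + j * (ℓ + 2) + ℓ + 2 := by ring
      rw [hmul] at ih' hjb
      have hE := hΓ (ℓ + j * (ℓ + 2)) (by omega) (by omega)
      rw [hIco, Finset.filter_insert]
      by_cases hb : isBad j
      · rw [if_neg (not_not.2 hb)]
        exact ih' x (box_mono (r' := ℓ + j * (ℓ + 2) + ℓ + 2) (by omega) (by omega) hx₀ hx)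
      · rw [if_pos hb, Finset.card_insert_of_notMem (by simp), pow_succ', mul_assoc]
        refine descent_step hx₀ hR hjb hsol hE.1 hE.2 hΓ0 hκ (by positivity) ?_ ih' x hx
        intro z hz hz'
        by_contra hns
        exact hb ⟨z, hz, hz', hns⟩
  have h0 := key J 0 (zero_add J) x₀ (self_mem_box (by omega) hx₀)
  refine h0.trans (mul_le_mul_of_nonneg_right (pow_le_pow_of_le_one hq0 hq ?_) hM)
  have hbad := card_bad_radii_le hx₀ hR hJ
    (fun z => ¬ NonSingular g V E κ ℓ (clampCenter L u ℓ z)) hfam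
    ((Finset.range J).filter isBad) (fun j hj => by simpa [isBad] using hj)
  have hsum := Finset.card_filter_add_card_filter_not (s := Finset.range J) isBad
  rw [Finset.card_range] at hsum
  rw [← Finset.range_eq_Ico]
  omega

/-- Decay of a solution, when all sites are non-resonant. -/
theorem descent_sites {g : ℝ} {V : Site d → ℝ} {E η : ℝ} {L R : ℕ} {u x₀ : Site d}
    {f : Site d → ℝ} {M : ℝ} (hx₀ : x₀ ∈ cube L u) (hR : R < L) (hη : 0 < η)
    (hsol : ∀ x ∈ box L u R x₀, SolvesAt g V E (cube L u) f x)
    (hV : ∀ x ∈ box L u R x₀, η ≤ |g * V x - E|) (hM : 0 ≤ M)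
    (hf : ∀ y ∈ box L u R x₀, |f y| ≤ M) :
    |f x₀| ≤ ((cube L u).card / η) ^ R * M := by
  have key : ∀ i, i ≤ R → ∀ x ∈ box L u (R - i) x₀,
      |f x| ≤ ((cube L u).card / η) ^ i * M := by
    intro i
    induction i with
    | zero => intro _ x hx; simpa using hf x hx
    | succ i ih =>
      intro hi x hx
      have hxR := box_mono (by omega) (by omega : R ≤ L) hx₀ hx
      have h1 := hsol x hxR
      unfold SolvesAt at h1
      have h2 : (g * V x - E) * f x = -∑ y ∈ cube L u, hop x y * f y := by linarith
      have h3 := hV x hxR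
      have h4 : |g * V x - E| * |f x| ≤ (cube L u).card * (((cube L u).card / η) ^ i * M) := by
        rw [← abs_mul, h2, abs_neg]
        refine (Finset.abs_sum_le_sum_abs _ _).trans ?_
        rw [← nsmul_eq_mul]
        refine Finset.sum_le_card_nsmul _ _ _ fun y hy => ?_
        by_cases h0 : hop x y = 0
        · rw [h0]; simp; positivity
        · rw [abs_mul, abs_of_nonneg (hop_nonneg _ _)]
          have h5 := ih (by omega) y (by
            have := mem_box_succ_of_hop (by omega) hx₀ hx hy h0
            rwa [show R - (i + 1) + 1 = R - i by omega] at this)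
          calc hop x y * |f y| ≤ 1 * |f y| := by gcongr; exact hop_le_one _ _
            _ ≤ _ := by rwa [one_mul]
      rw [pow_succ', mul_assoc, div_mul_eq_mul_div, le_div_iff₀ hη]
      calc |f x| * η ≤ |f x| * |g * V x - E| := by gcongr
        _ ≤ _ := by rwa [mul_comm]
  exact key R le_rfl x₀ (self_mem_box (by omega) hx₀)

end Descent

/-! ### Elementary properties of the scales and thresholds. -/

section Scales

theorem rpow_le_scale_succ (L₀ k : ℕ) : (scale L₀ k : ℝ) ^ (3 / 2 : ℝ) ≤ scale L₀ (k + 1) := by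
  rw [scale]
  push_cast
  exact (Nat.lt_floor_add_one _).le

theorem scale_succ_le {L₀ k : ℕ} (h : 1 ≤ scale L₀ k) :
    (scale L₀ (k + 1) : ℝ) ≤ 2 * (scale L₀ k : ℝ) ^ (3 / 2 : ℝ) := by
  rw [scale]
  push_cast
  have h1 : (1 : ℝ) ≤ (scale L₀ k : ℝ) ^ (3 / 2 : ℝ) :=
    Real.one_le_rpow (by exact_mod_cast h) (by norm_num)
  have := Nat.floor_le (zero_le_one.trans h1)
  linarith

theorem scale_lt_succ (L₀ k : ℕ) : scale L₀ k < scale L₀ (k + 1) := by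
  rcases Nat.eq_zero_or_pos (scale L₀ k) with h | h
  · rw [h, scale]; positivity
  · rw [scale, Nat.lt_succ_iff]
    apply Nat.le_floor
    calc (scale L₀ k : ℝ) = (scale L₀ k : ℝ) ^ (1 : ℝ) := (Real.rpow_one _).symm
      _ ≤ _ := Real.rpow_le_rpow_of_exponent_le (by exact_mod_cast h) (by norm_num)

theorem scale_strictMono (L₀ : ℕ) : StrictMono (scale L₀) :=
  strictMono_nat_of_lt_succ (scale_lt_succ L₀)

theorem le_scale (L₀ k : ℕ) : L₀ ≤ scale L₀ k := (scale_strictMono L₀).monotone (Nat.zero_le k)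

theorem prevScale_le (L₀ k : ℕ) : prevScale L₀ k ≤ scale L₀ k := by
  cases k with
  | zero => exact Nat.zero_le _
  | succ k => exact (scale_lt_succ L₀ k).le

theorem delta_pos (L₀ : ℕ) {g : ℝ} (hg : 0 < g) (k : ℕ) : 0 < delta L₀ g k := by
  unfold delta
  positivity

theorem mul_delta_eq (L₀ : ℕ) {g : ℝ} (hg : 0 < g) (k : ℕ) :
    g * delta L₀ g k = g ^ (1 / 2 : ℝ) * Real.exp (-4 * (scale L₀ k : ℝ) ^ (1 / 2 : ℝ)) := by
  rw [delta, ← mul_assoc]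
  congr 1
  nth_rw 1 [← Real.rpow_one g]
  rw [← Real.rpow_add hg]
  norm_num

theorem one_div_mul_delta_le (L₀ : ℕ) {g : ℝ} (hg : 1 ≤ g) (k : ℕ) :
    1 / (g * delta L₀ g k) ≤ Real.exp (4 * (scale L₀ k : ℝ) ^ (1 / 2 : ℝ)) := by
  rw [mul_delta_eq L₀ (by linarith), one_div, mul_inv, ← Real.exp_neg]
  have h1 : (g ^ (1 / 2 : ℝ))⁻¹ ≤ 1 :=
    inv_le_one_of_one_le₀ (Real.one_le_rpow hg (by norm_num))
  calc _ ≤ 1 * Real.exp (-(-4 * (scale L₀ k : ℝ) ^ (1 / 2 : ℝ))) := by gcongr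
    _ = _ := by rw [one_mul, neg_mul, neg_neg]

theorem decayRate_le {m : ℝ} (hm : 0 ≤ m) {L : ℕ} (hL : 1 ≤ L) : decayRate m L ≤ 2 * m := by
  unfold decayRate
  have : (L : ℝ) ^ (-(1 / 8) : ℝ) ≤ 1 :=
    Real.rpow_le_one_of_one_le_of_nonpos (by exact_mod_cast hL) (by norm_num)
  nlinarith

end Scales

/-! ### Numerical inequalities between consecutive scales. -/

section Numerics

/-- With `t = ℓ ^ (1/16)` the exponents become integers: `ℓ ^ (3/2) = t ^ 24` and `ℓ ^ (-1/8) = (t ^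
2)⁻¹`. Then `5 * t ^ 24` bounds `2 L + 1`, and the power `4 * d` is the volume factor of one descent
step. -/
theorem exists_threshold (d c : ℕ) : ∃ T : ℝ, 100 ≤ T ∧ (c : ℝ) ≤ T ∧
    ∀ t, T ≤ t → (5 * t ^ 24) ^ (4 * d) ≤ Real.exp t := by
  have h := (Real.tendsto_pow_mul_exp_neg_atTop_nhds_zero (24 * (4 * d))).const_mul
    ((5 : ℝ) ^ (4 * d))
  rw [mul_zero] at h
  have h1 := (h.eventually (ge_mem_nhds one_pos)).and
    ((Filter.eventually_ge_atTop (100 : ℝ)).and (Filter.eventually_ge_atTop (c : ℝ)))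
  obtain ⟨T, hT⟩ := Filter.eventually_atTop.1 h1
  refine ⟨T, (hT T le_rfl).2.1, (hT T le_rfl).2.2, fun t ht => ?_⟩
  have h2 := (hT t ht).1
  rw [mul_pow, ← pow_mul, ← mul_one (Real.exp t)]
  calc (5 : ℝ) ^ (4 * d) * t ^ (24 * (4 * d))
      = Real.exp t * (5 ^ (4 * d) * (t ^ (24 * (4 * d)) * Real.exp (-t))) := by
        rw [Real.exp_neg]; field_simp
    _ ≤ Real.exp t * 1 := by gcongr

/-- The relation between consecutive scales, in terms of `t = ℓ ^ (1/16)`. -/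
structure ScalePair (T t : ℝ) (ℓ L : ℕ) : Prop where
  le : T ≤ t
  small : (ℓ : ℝ) = t ^ 16
  lower : t ^ 24 ≤ (L : ℝ)
  upper : (L : ℝ) ≤ 2 * t ^ 24

theorem scalePair {T : ℝ} (hT : 1 ≤ T) {L₀ k : ℕ} (h : T ^ 16 ≤ (L₀ : ℝ)) :
    ScalePair T ((scale L₀ k : ℝ) ^ (1 / 16 : ℝ)) (scale L₀ k) (scale L₀ (k + 1)) := by
  have h0 : (0 : ℝ) ≤ scale L₀ k := Nat.cast_nonneg _
  have h1 : T ^ 16 ≤ (scale L₀ k : ℝ) := h.trans (by exact_mod_cast le_scale L₀ k)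
  have h2 : (1 : ℝ) ≤ scale L₀ k := (one_le_pow₀ hT).trans h1
  have h24 : ((scale L₀ k : ℝ) ^ (1 / 16 : ℝ)) ^ 24 = (scale L₀ k : ℝ) ^ (3 / 2 : ℝ) := by
    rw [← Real.rpow_natCast, ← Real.rpow_mul h0]; norm_num
  refine ⟨?_, ?_, ?_, ?_⟩
  · calc T = (T ^ 16) ^ (1 / 16 : ℝ) := by
          rw [← Real.rpow_natCast, ← Real.rpow_mul (by linarith)]; norm_num
      _ ≤ _ := by gcongr
  · rw [← Real.rpow_natCast, ← Real.rpow_mul h0]; norm_num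
  · rw [h24]; exact rpow_le_scale_succ L₀ k
  · rw [h24]; exact scale_succ_le (by exact_mod_cast h2)

variable {T t : ℝ} {ℓ L : ℕ}

theorem ScalePair.decayRate_mul (h : ScalePair T t ℓ L) (hT : 100 ≤ T) (m : ℝ) :
    decayRate m ℓ * ℓ = m * (t ^ 16 + t ^ 14) := by
  have ht : 0 < t := by linarith [h.le]
  have h1 : (ℓ : ℝ) ^ (-(1 / 8) : ℝ) = (t ^ 2)⁻¹ := by
    rw [h.small, ← Real.rpow_natCast, ← Real.rpow_mul ht.le, ← Real.rpow_natCast,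
      ← Real.rpow_neg ht.le]
    norm_num
  rw [decayRate, h1, h.small]
  field_simp

theorem ScalePair.sqrt_le (h : ScalePair T t ℓ L) (hT : 100 ≤ T) :
    (L : ℝ) ^ (1 / 2 : ℝ) ≤ 2 * t ^ 12 := by
  have ht : 0 < t := by linarith [h.le]
  rw [← Real.sqrt_eq_rpow]
  apply Real.sqrt_le_iff.2
  refine ⟨by positivity, h.upper.trans ?_⟩
  have : 0 < t ^ 24 := by positivity
  nlinarith

/-- This is the contraction factor of one good shell. The `9` is `1` for the volume factor plus `8`
for `Γ`, since `4 √L ≤ 8 t ^ 12`; `m ≥ 1` puts both losses under the factor `m`. -/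
theorem ScalePair.quotient_le (h : ScalePair T t ℓ L) (hT : 100 ≤ T) {d : ℕ}
    (hTd : ∀ t, T ≤ t → (5 * t ^ 24) ^ (4 * d) ≤ Real.exp t) {m Γ : ℝ} (hm : 1 ≤ m)
    (hΓ0 : 0 ≤ Γ) (hΓ : Γ ≤ Real.exp (4 * (L : ℝ) ^ (1 / 2 : ℝ))) :
    (((2 * L + 1) ^ d : ℕ) : ℝ) ^ 4 * (Γ * Real.exp (-(decayRate m ℓ * ℓ)))
      ≤ Real.exp (-(m * (t ^ 16 + t ^ 14 - 9 * t ^ 12))) := by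
  have ht : 1 ≤ t := by linarith [h.le]
  have h1 : (((2 * L + 1) ^ d : ℕ) : ℝ) ^ 4 ≤ Real.exp (t ^ 12) := by
    calc (((2 * L + 1) ^ d : ℕ) : ℝ) ^ 4 = (2 * (L : ℝ) + 1) ^ (4 * d) := by
          push_cast; rw [← pow_mul, mul_comm d 4]
      _ ≤ (5 * t ^ 24) ^ (4 * d) := by
          have := one_le_pow₀ (n := 24) ht
          gcongr
          linarith [h.upper]
      _ ≤ Real.exp t := hTd t h.le
      _ ≤ Real.exp (t ^ 12) := Real.exp_le_exp.2 (le_self_pow₀ ht (by norm_num))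
  have h2 : Γ ≤ Real.exp (8 * t ^ 12) :=
    hΓ.trans (Real.exp_le_exp.2 (by linarith [h.sqrt_le hT]))
  rw [h.decayRate_mul hT]
  calc _ ≤ Real.exp (t ^ 12) * (Real.exp (8 * t ^ 12) * Real.exp (-(m * (t ^ 16 + t ^ 14)))) := by
        gcongr
    _ = Real.exp (9 * t ^ 12 - m * (t ^ 16 + t ^ 14)) := by
        rw [← Real.exp_add, ← Real.exp_add]; ring_nf
    _ ≤ _ := by
        apply Real.exp_le_exp.2
        have : 0 < t ^ 12 := by positivity
        nlinarith

/-- A lower bound for the exponent produced by `descent`: the starting radius `ℓ` and the rounding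
of the division cost at most two shells. -/
theorem le_div_sub {r ℓ n : ℕ} (h : ℓ ≤ r) :
    (r : ℝ) / (ℓ + 2) - (n + 2) ≤ (((r - ℓ) / (ℓ + 2) - n : ℕ) : ℝ) := by
  have h1 : (r - ℓ : ℕ) < (ℓ + 2) * ((r - ℓ) / (ℓ + 2) + 1) :=
    Nat.lt_mul_div_succ _ (by omega)
  have h2 : (r : ℝ) ≤ (ℓ + 2) * (((r - ℓ) / (ℓ + 2) : ℕ) + 2) := by
    have : r ≤ (ℓ + 2) * ((r - ℓ) / (ℓ + 2) + 2) := by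
      rw [mul_add] at h1 ⊢
      omega
    exact_mod_cast this
  have h3 : (r : ℝ) / (ℓ + 2) ≤ ((r - ℓ) / (ℓ + 2) : ℕ) + 2 := by
    rw [div_le_iff₀ (by positivity)]
    linarith
  have h4 : (((r - ℓ) / (ℓ + 2) : ℕ) : ℝ) ≤ (((r - ℓ) / (ℓ + 2) - n : ℕ) : ℝ) + n := by
    exact_mod_cast le_tsub_add
  linarith

theorem pow_le_exp_neg {q s : ℝ} (hq : 0 ≤ q) (h : q ≤ Real.exp (-s)) (p : ℕ) :
    q ^ p ≤ Real.exp (-(p * s)) := by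
  calc q ^ p ≤ Real.exp (-s) ^ p := by gcongr
    _ = _ := by rw [← Real.exp_nat_mul]; ring_nf

theorem ScalePair.rate_pos (h : ScalePair T t ℓ L) (hT : 100 ≤ T) :
    0 < t ^ 16 + t ^ 14 - 9 * t ^ 12 := by
  have ht : 100 ≤ t := hT.trans h.le
  have e : t ^ 16 + t ^ 14 - 9 * t ^ 12 = t ^ 12 * (t ^ 4 + (t ^ 2 - 9)) := by ring
  have : 0 < t ^ 2 - 9 := by nlinarith
  rw [e]
  positivity

/-- The `L / (ℓ + 2)` shells supply about `L (1 + t⁻² - 12 t⁻⁴)`, while the next rate asks only for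
`L (1 + t⁻³)`, because `L ^ (-1/8) ≤ t⁻³`. The difference of order `L t⁻²` pays for the lost shells
and for one more resolvent bound. This is the purpose of the correction in `decayRate`. -/
theorem ScalePair.polynomial_le (h : ScalePair T t ℓ L) (hT : 100 ≤ T) {c : ℕ} (hc : (c : ℝ) ≤ T)
    {p : ℝ} (hp : (L : ℝ) / (ℓ + 2) - c ≤ p) :
    (L : ℝ) + L * (t ^ 3)⁻¹ + 8 * t ^ 12 ≤ p * (t ^ 16 + t ^ 14 - 9 * t ^ 12) := by
  have ht : 100 ≤ t := hT.trans h.le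
  have hct : (c : ℝ) ≤ t := hc.trans h.le
  have ht0 : 0 < t := by linarith
  have h12 : 0 < t ^ 12 := by positivity
  have hQ := h.rate_pos hT
  refine le_trans ?_ (mul_le_mul_of_nonneg_right hp hQ.le)
  have h1 : (1 + (t ^ 2)⁻¹ - 12 * (t ^ 4)⁻¹) * (ℓ + 2) ≤ t ^ 16 + t ^ 14 - 9 * t ^ 12 := by
    rw [h.small]
    have e : (1 + (t ^ 2)⁻¹ - 12 * (t ^ 4)⁻¹) * (t ^ 16 + 2)
        = t ^ 16 + t ^ 14 - 12 * t ^ 12 + 2 + 2 * (t ^ 2)⁻¹ - 24 * (t ^ 4)⁻¹ := by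
      field_simp; ring
    rw [e]
    have i1 : (t ^ 2)⁻¹ ≤ 1 := inv_le_one_of_one_le₀ (one_le_pow₀ (by linarith))
    have i2 : 0 < (t ^ 4)⁻¹ := by positivity
    have i3 : 100 ≤ t ^ 12 := ht.trans (le_self_pow₀ (by linarith) (by norm_num))
    linarith
  have h2 : (L : ℝ) * (1 + (t ^ 2)⁻¹ - 12 * (t ^ 4)⁻¹)
      ≤ (L : ℝ) / (ℓ + 2) * (t ^ 16 + t ^ 14 - 9 * t ^ 12) := by
    rw [div_mul_eq_mul_div, le_div_iff₀ (by positivity), mul_assoc]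
    gcongr
  -- The `c` lost shells and the resolvent bound cost at most `3 * t ^ 17`, whereas `L * (t ^ 4)⁻¹`
  -- is at least `t ^ 20`.
  have h3 : (c : ℝ) * (t ^ 16 + t ^ 14 - 9 * t ^ 12) + 8 * t ^ 12 ≤ L * (t ^ 4)⁻¹ := by
    have : t ^ 20 ≤ L * (t ^ 4)⁻¹ := by
      rw [← div_eq_mul_inv, le_div_iff₀ (by positivity)]
      calc t ^ 20 * t ^ 4 = t ^ 24 := by ring
        _ ≤ (L : ℝ) := h.lower
    refine le_trans ?_ this
    calc (c : ℝ) * (t ^ 16 + t ^ 14 - 9 * t ^ 12) + 8 * t ^ 12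
        ≤ t * (2 * t ^ 16) + t ^ 17 := by
          have a1 : t ^ 16 + t ^ 14 - 9 * t ^ 12 ≤ 2 * t ^ 16 := by
            have : t ^ 14 ≤ t ^ 16 := pow_le_pow_right₀ (by linarith) (by norm_num)
            linarith
          have a2 : 8 * t ^ 12 ≤ t ^ 17 := by
            have : t ^ 13 ≤ t ^ 17 := pow_le_pow_right₀ (by linarith) (by norm_num)
            nlinarith
          gcongr
      _ = 3 * t ^ 17 := by ring
      _ ≤ t * t ^ 17 := by gcongr; linarith
      _ = t ^ 18 := by ring
      _ ≤ t ^ 20 := pow_le_pow_right₀ (by linarith) (by norm_num)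
  have h4 : (t ^ 3)⁻¹ + 13 * (t ^ 4)⁻¹ ≤ (t ^ 2)⁻¹ := by
    have e : (t ^ 2)⁻¹ - ((t ^ 3)⁻¹ + 13 * (t ^ 4)⁻¹) = (t ^ 2 - t - 13) * (t ^ 4)⁻¹ := by
      field_simp; ring
    have : 0 ≤ (t ^ 2 - t - 13) * (t ^ 4)⁻¹ := mul_nonneg (by nlinarith) (by positivity)
    linarith
  have hL : (0 : ℝ) ≤ L := Nat.cast_nonneg _
  have h5 := mul_le_mul_of_nonneg_left h4 hL
  nlinarith

/-- Closes the induction on the rate. Besides the `n` discounted shells, two are lost in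
`le_div_sub` and one because the descent stops at radius `L - 1`. The final `Γ` is the a priori
bound on the resolvent entries. -/
theorem ScalePair.decay_step (h : ScalePair T t ℓ L) (hT : 100 ≤ T) {n : ℕ}
    (hn : ((n + 3 : ℕ) : ℝ) ≤ T) {m q Γ : ℝ} (hm : 1 ≤ m) (hq0 : 0 ≤ q)
    (hq : q ≤ Real.exp (-(m * (t ^ 16 + t ^ 14 - 9 * t ^ 12)))) (hℓ : ℓ < L)
    (hΓ0 : 0 ≤ Γ) (hΓ : Γ ≤ Real.exp (4 * (L : ℝ) ^ (1 / 2 : ℝ))) :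
    q ^ ((L - 1 - ℓ) / (ℓ + 2) - n) * Γ ≤ Real.exp (-(decayRate m L * L)) := by
  have ht : 0 < t := by linarith [h.le]
  set p := (L - 1 - ℓ) / (ℓ + 2) - n with hpdef
  have hp : (L : ℝ) / (ℓ + 2) - ((n + 3 : ℕ) : ℝ) ≤ p := by
    have h1 := le_div_sub (n := n) (show ℓ ≤ L - 1 by omega)
    have h2 : ((L - 1 : ℕ) : ℝ) = L - 1 := by
      rw [Nat.cast_sub (by omega)]; simp
    rw [h2, sub_div] at h1
    have h3 : (1 : ℝ) / (ℓ + 2) ≤ 1 := by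
      rw [div_le_one (by positivity)]
      linarith [(Nat.cast_nonneg ℓ : (0 : ℝ) ≤ ℓ)]
    push_cast
    linarith
  have hpoly := h.polynomial_le hT hn hp
  have hrate : (L : ℝ) ^ (-(1 / 8) : ℝ) ≤ (t ^ 3)⁻¹ := by
    have : (t ^ 24) ^ (-(1 / 8) : ℝ) = (t ^ 3)⁻¹ := by
      rw [← Real.rpow_natCast, ← Real.rpow_mul ht.le, ← Real.rpow_natCast,
        ← Real.rpow_neg ht.le]
      norm_num
    rw [← this]
    exact Real.rpow_le_rpow_of_nonpos (by positivity) h.lower (by norm_num)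
  have hs := h.sqrt_le hT
  calc q ^ p * Γ ≤ Real.exp (-(p * (m * (t ^ 16 + t ^ 14 - 9 * t ^ 12))))
        * Real.exp (8 * t ^ 12) := by
        have := pow_le_exp_neg hq0 hq p
        have h2 : Γ ≤ Real.exp (8 * t ^ 12) :=
          hΓ.trans (Real.exp_le_exp.2 (by linarith))
        gcongr
    _ = Real.exp (8 * t ^ 12 - p * (m * (t ^ 16 + t ^ 14 - 9 * t ^ 12))) := by
        rw [← Real.exp_add]; ring_nf
    _ ≤ _ := by
        apply Real.exp_le_exp.2
        unfold decayRate
        have hL : (0 : ℝ) ≤ L := Nat.cast_nonneg _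
        have h1 := mul_le_mul_of_nonneg_left hrate hL
        have h2 := mul_le_mul_of_nonneg_left hpoly (zero_le_one.trans hm)
        have h3 := mul_le_mul_of_nonneg_left h1 (zero_le_one.trans hm)
        have h4 : 8 * t ^ 12 ≤ m * (8 * t ^ 12) := le_mul_of_one_le_left (by positivity) hm
        nlinarith

/-- A radius of order `L ^ (7/8)`, at least `t ^ 21 / 16`, still contains many shells of width about
`t ^ 16`, so discarding `n` of them and all rounding costs at most half of the rate. -/
theorem ScalePair.decay_localization (h : ScalePair T t ℓ L) (hT : 100 ≤ T) {n : ℕ}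
    (hn : ((n + 2 : ℕ) : ℝ) ≤ T) {m q : ℝ} (hm : 1 ≤ m) (hq0 : 0 ≤ q)
    (hq : q ≤ Real.exp (-(m * (t ^ 16 + t ^ 14 - 9 * t ^ 12)))) {r : ℕ}
    (hr : t ^ 21 / 16 ≤ r) :
    q ^ ((r - ℓ) / (ℓ + 2) - n) ≤ Real.exp (-(m * r / 2)) := by
  have ht : 100 ≤ t := hT.trans h.le
  have h21 : 6 * t ^ 17 ≤ r := by
    refine le_trans ?_ hr
    have : t ^ 21 = t ^ 17 * t ^ 4 := by ring
    have h4 : (100 : ℝ) ^ 4 ≤ t ^ 4 := by gcongr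
    have : 0 < t ^ 17 := by positivity
    nlinarith
  have hℓr : ℓ ≤ r := by
    have h1 : (ℓ : ℝ) ≤ r := by
      rw [h.small]
      have : t ^ 16 ≤ t ^ 17 := pow_le_pow_right₀ (by linarith) (by norm_num)
      have : 0 < t ^ 17 := by positivity
      linarith
    exact_mod_cast h1
  have hp := le_div_sub (n := n) hℓr
  refine (pow_le_exp_neg hq0 hq _).trans (Real.exp_le_exp.2 ?_)
  set p := (r - ℓ) / (ℓ + 2) - n
  have hnt : (n : ℝ) + 2 ≤ t := by
    have := hn.trans h.le
    push_cast at this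
    linarith
  have h16 : 100 ≤ t ^ 16 := ht.trans (le_self_pow₀ (by linarith) (by norm_num))
  have h2 : (r : ℝ) / 2 ≤ p * t ^ 16 := by
    have h3 : (r : ℝ) / (t ^ 16 + 2) - t ≤ p := by
      rw [h.small] at hp
      linarith
    have h4 : (r : ℝ) * (2 / 3) ≤ r / (t ^ 16 + 2) * t ^ 16 := by
      rw [div_mul_eq_mul_div (r : ℝ), le_div_iff₀ (by positivity)]
      have : (0 : ℝ) ≤ r := Nat.cast_nonneg _
      nlinarith
    have h5 := mul_le_mul_of_nonneg_right h3 (show 0 ≤ t ^ 16 by positivity)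
    have h6 : t * t ^ 16 = t ^ 17 := by ring
    nlinarith
  have h3 : t ^ 16 ≤ t ^ 16 + t ^ 14 - 9 * t ^ 12 := by
    have : t ^ 14 = t ^ 12 * t ^ 2 := by ring
    have h4 : (100 : ℝ) ^ 2 ≤ t ^ 2 := by gcongr
    have : 0 < t ^ 12 := by positivity
    nlinarith
  have h4 : (p : ℝ) * t ^ 16 ≤ p * (t ^ 16 + t ^ 14 - 9 * t ^ 12) := by gcongr
  have h5 := mul_le_mul_of_nonneg_left (h2.trans h4) (zero_le_one.trans hm)
  linarith

end Numerics

/-! ### Multi-scale induction and localization for a sparse potential. -/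

section MultiScale

variable {d : ℕ} {L₀ : ℕ} {g : ℝ} {V : Site d → ℝ}

/-- At no scale and for no energy are there `n + 1` disjoint partially resonant cubes in a cube
of the next scale. -/
def IsSparse (L₀ : ℕ) (g : ℝ) (n : ℕ) (V : Site d → ℝ) : Prop :=
  ∀ (k : ℕ) (E : ℝ) (u : Site d) (w : Fin (n + 1) → Site d),
    (∀ j, cube (scale L₀ k) (w j) ⊆ cube (scale L₀ (k + 1)) u) →
    (∀ j, IsPartiallyResonant L₀ g k V E (scale L₀ k) (w j)) →
    (∀ i j, i ≠ j → Disjoint (cube (scale L₀ k) (w i)) (cube (scale L₀ k) (w j))) → False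

/-- The numerical conditions on the initial scale, on the coupling and on the decay rate. -/
structure Admissible (d n L₀ : ℕ) (g m T : ℝ) : Prop where
  one_le_g : 1 ≤ g
  one_le_m : 1 ≤ m
  hT : 100 ≤ T
  hn : ((3 * n + 3 : ℕ) : ℝ) ≤ T
  hTd : ∀ t, T ≤ t → (5 * t ^ 24) ^ (4 * d) ≤ Real.exp t
  hL₀ : T ^ 16 ≤ (L₀ : ℝ)
  initial : (((2 * L₀ + 1) ^ d : ℕ) : ℝ) / (g * delta L₀ g 0) ≤ Real.exp (-(2 * m))

theorem le_abs_sub_of_not_isResonant {k ℓ : ℕ} {E : ℝ} {w : Site d}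
    (h : ¬ IsResonant L₀ g k V E ℓ w) :
    ∀ s ∈ spec g V (cube ℓ w), g * delta L₀ g k ≤ |E - s| := by
  intro s hs
  unfold IsResonant at h
  push Not at h
  exact h.trans ((Metric.infDist_le_dist_of_mem hs).trans_eq (Real.dist_eq _ _))

theorem notMem_spec_of_not_isResonant (hg : 0 < g) {k ℓ : ℕ} {E : ℝ} {w : Site d}
    (h : ¬ IsResonant L₀ g k V E ℓ w) : E ∉ spec g V (cube ℓ w) := by
  intro hE
  have h1 := le_abs_sub_of_not_isResonant h E hE
  have := mul_pos hg (delta_pos L₀ hg k)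
  simp at h1
  linarith

theorem abs_green_le_of_not_isResonant (hg : 0 < g) {k ℓ : ℕ} {E : ℝ} {w : Site d}
    (h : ¬ IsResonant L₀ g k V E ℓ w) (x y) :
    |green g V E (cube ℓ w) x y| ≤ 1 / (g * delta L₀ g k) :=
  abs_green_le (isHermitian_hamiltonian g V _) (mul_pos hg (delta_pos L₀ hg k))
    (le_abs_sub_of_not_isResonant h) x y

/-- Since `L_{-1} = 0`, absence of partial resonance at scale `0` also covers cubes of radius `0`;
this lemma turns that into a lower bound for `|g V(x) - E|`. -/
theorem mem_spec_site (g : ℝ) (V : Site d → ℝ) (x : Site d) : g * V x ∈ spec g V (cube 0 x) := by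
  have h0 : ∀ y : cube 0 x, y.1 = x := by
    intro y
    have := mem_cube_iff.1 y.2
    funext i
    have := this i
    push_cast at this
    omega
  refine mem_spectrum_of_eigenvector (v := fun _ => 1) ?_ ?_
  · exact fun h => one_ne_zero (congrFun h ⟨x, self_mem_cube 0 x⟩)
  · funext y
    have h1 := hamiltonian_mulVec g V (cube 0 x) (fun _ => 1) y
    have h2 : cube 0 x = {x} := by
      ext z
      rw [Finset.mem_singleton]
      exact ⟨fun hz => h0 ⟨z, hz⟩, fun hz => hz ▸ self_mem_cube 0 x⟩
    rw [h1, h0 y, Finset.sum_eq_zero]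
    · simp
    · intro z hz
      rw [show z = x from h0 ⟨z, hz⟩, hop_self, zero_mul]

/-- Extension of a function on a finite set of sites by zero. -/
def extendZero {Λ : Finset (Site d)} (f : Λ → ℝ) (z : Site d) : ℝ :=
  if h : z ∈ Λ then f ⟨z, h⟩ else 0

theorem extendZero_apply {Λ : Finset (Site d)} (f : Λ → ℝ) (x : Λ) : extendZero f x.1 = f x := by
  simp [extendZero]

/-- The column `y` of the resolvent, extended by zero. -/
def greenColumn (g : ℝ) (V : Site d → ℝ) (E : ℝ) (Λ : Finset (Site d)) (y : Λ) : Site d → ℝ :=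
  extendZero fun z => green g V E Λ z y

theorem greenColumn_apply (E : ℝ) (Λ : Finset (Site d)) (y z : Λ) :
    greenColumn g V E Λ y z.1 = green g V E Λ z y :=
  extendZero_apply _ z

-- Away from its source `y` a resolvent column is a solution, so the descent applies to it on any
-- box that misses `y`.
open Matrix in
theorem solvesAt_greenColumn {E : ℝ} {Λ : Finset (Site d)} (hE : E ∉ spec g V Λ) (y : Λ)
    {z : Site d} (hz : z ∈ Λ) (hzy : z ≠ y.1) : SolvesAt g V E Λ (greenColumn g V E Λ y) z := by
  have hu := isUnit_sub_smul_one hE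
  have h1 : ((hamiltonian g V Λ - E • (1 : Matrix Λ Λ ℝ)) * green g V E Λ) ⟨z, hz⟩ y = 0 := by
    rw [green, Matrix.mul_nonsing_inv _ ((Matrix.isUnit_iff_isUnit_det _).1 hu),
      Matrix.one_apply_ne]
    exact fun h => hzy (congrArg Subtype.val h)
  have h2 := hamiltonian_mulVec g V Λ (greenColumn g V E Λ y) ⟨z, hz⟩
  simp only [greenColumn_apply] at h2
  rw [sub_mul, Matrix.sub_apply, smul_mul, one_mul, Matrix.smul_apply, smul_eq_mul,
    Matrix.mul_apply] at h1
  unfold SolvesAt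
  have h3 := greenColumn_apply (g := g) (V := V) E Λ y ⟨z, hz⟩
  simp only at h2 h3
  rw [← h2, h3]
  simp only [mulVec, dotProduct]
  linarith

section Sparse

variable {n : ℕ} {m T : ℝ}

theorem Admissible.scalePair (h : Admissible d n L₀ g m T) (k : ℕ) :
    ScalePair T ((scale L₀ k : ℝ) ^ (1 / 16 : ℝ)) (scale L₀ k) (scale L₀ (k + 1)) :=
  DetAnderson.scalePair (by linarith [h.hT]) h.hL₀

theorem Admissible.le_scale (h : Admissible d n L₀ g m T) (k : ℕ) :
    10 ^ 32 ≤ scale L₀ k := by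
  have h1 : (100 : ℝ) ^ 16 ≤ T ^ 16 := by gcongr; exact h.hT
  have h2 : (10 : ℝ) ^ 32 ≤ (L₀ : ℝ) := le_trans (by norm_num) (h1.trans h.hL₀)
  exact le_trans (by exact_mod_cast h2) (DetAnderson.le_scale L₀ k)

/-- The descent goes site by site, each step gaining `card / (g δ_0) ≤ exp (-2 m)`. The a priori
bound `1 / (g δ_0)` serves as one more factor, making `L` factors in all, and `2 m` dominates the
rate `γ(m, L_0)`. -/
theorem nonSingular_initial (h : Admissible d n L₀ g m T) {E : ℝ} {w : Site d}
    (hnr : ¬ IsPartiallyResonant L₀ g 0 V E (scale L₀ 0) w) :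
    NonSingular g V E (Real.exp (-(decayRate m (scale L₀ 0) * scale L₀ 0))) (scale L₀ 0) w := by
  have hg : 0 < g := by linarith [h.one_le_g]
  have hL := h.le_scale 0
  unfold IsPartiallyResonant at hnr
  push Not at hnr
  obtain ⟨hnr1, hnr2⟩ := hnr
  have hη := mul_pos hg (delta_pos L₀ hg 0)
  have hE := notMem_spec_of_not_isResonant hg hnr1
  set L := scale L₀ 0
  refine ⟨hE, fun x y hfar => ?_⟩
  have hcard : (1 : ℝ) ≤ (cube L w).card := by
    exact_mod_cast Finset.card_pos.2 (cube_nonempty L w)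
  have hy : y.1 ∉ box L w (L - 1) x.1 := notMem_box_of_isFar (by omega) x.2 hfar
  have hsub : box L w (L - 1) x.1 ⊆ cube L w := box_subset (by omega)
  have h1 := descent_sites (f := greenColumn g V E (cube L w) y) (E := E) (R := L - 1)
    (M := 1 / (g * delta L₀ g 0)) x.2 (by omega) hη
    (fun z hz => solvesAt_greenColumn hE y (hsub hz) (fun hzy => hy (hzy ▸ hz)))
    (fun z hz => by
      have hz1 := hnr2 0 z (Nat.zero_le _) (fun p hp => by
        have : p = z := by
          have := mem_cube_iff.1 hp
          funext i
          have := this i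
          push_cast at this
          omega
        exact this ▸ hsub hz)
      rw [abs_sub_comm]
      exact le_abs_sub_of_not_isResonant hz1 _ (mem_spec_site g V z))
    (by positivity)
    (fun z hz => by
      have := greenColumn_apply (g := g) (V := V) E (cube L w) y ⟨z, hsub hz⟩
      simp only at this
      rw [this]
      exact abs_green_le_of_not_isResonant hg hnr1 _ _)
  rw [greenColumn_apply] at h1
  refine h1.trans ?_
  have h2 : ((cube L w).card : ℝ) / (g * delta L₀ g 0) ≤ Real.exp (-(2 * m)) := by
    rw [card_cube]
    exact h.initial
  calc ((cube L w).card / (g * delta L₀ g 0)) ^ (L - 1) * (1 / (g * delta L₀ g 0))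
      ≤ ((cube L w).card / (g * delta L₀ g 0)) ^ (L - 1)
          * ((cube L w).card / (g * delta L₀ g 0)) := by gcongr
    _ = ((cube L w).card / (g * delta L₀ g 0)) ^ L := by
        rw [← pow_succ, Nat.sub_add_cancel (by omega)]
    _ ≤ Real.exp (-(L * (2 * m))) := pow_le_exp_neg (by positivity) h2 L
    _ ≤ _ := by
        apply Real.exp_le_exp.2
        have := decayRate_le (L := L) (zero_le_one.trans h.one_le_m) (by omega)
        have h3 := mul_le_mul_of_nonneg_right this (Nat.cast_nonneg (α := ℝ) L)
        linarith

/-- Non-resonance of all subcubes of radius at least `L_k` bounds the resolvents of the concentric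
boxes used in `descent`. By induction a singular `L_k`-cube is partially resonant at the same
energy, so sparsity allows at most `n` disjoint ones. -/
theorem nonSingular_of_not_isPartiallyResonant (h : Admissible d n L₀ g m T)
    (hV : IsSparse L₀ g n V) : ∀ (k : ℕ) (E : ℝ) (w : Site d),
    ¬ IsPartiallyResonant L₀ g k V E (scale L₀ k) w →
    NonSingular g V E (Real.exp (-(decayRate m (scale L₀ k) * scale L₀ k))) (scale L₀ k) w := by
  intro k
  induction k with
  | zero => exact fun E w hnr => nonSingular_initial h hnr
  | succ k ih =>
    intro E w hnr
    have hg : 0 < g := by linarith [h.one_le_g]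
    have hs := h.scalePair k
    have hlt := scale_lt_succ L₀ k
    unfold IsPartiallyResonant at hnr
    push Not at hnr
    obtain ⟨hnr1, hnr2⟩ := hnr
    have hη := mul_pos hg (delta_pos L₀ hg (k + 1))
    have hE := notMem_spec_of_not_isResonant hg hnr1
    have hΓ := one_div_mul_delta_le L₀ h.one_le_g (k + 1)
    have hq := hs.quotient_le h.hT h.hTd h.one_le_m (one_div_nonneg.2 hη.le) hΓ
    have hΓ0 : 0 ≤ 1 / (g * delta L₀ g (k + 1)) := one_div_nonneg.2 hη.le
    have hgr := abs_green_le_of_not_isResonant hg hnr1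
    have hnr3 : ∀ r x, scale L₀ k ≤ r → r ≤ scale L₀ (k + 1) →
        ¬ IsResonant L₀ g (k + 1) V E r (clampCenter (scale L₀ (k + 1)) w r x) :=
      fun r x hr hr' => hnr2 r _ hr (box_subset hr')
    have hfam := hV k E w
    set L := scale L₀ (k + 1)
    set ℓ := scale L₀ k
    set Γ := 1 / (g * delta L₀ g (k + 1)) with hΓdef
    set κ := Real.exp (-(decayRate m ℓ * ℓ))
    refine ⟨hE, fun x y hfar => ?_⟩
    have hκ0 : 0 ≤ κ := (Real.exp_pos _).le
    have hy : y.1 ∉ box L w (L - 1) x.1 := notMem_box_of_isFar (by omega) x.2 hfar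
    have hsub : box L w (L - 1) x.1 ⊆ cube L w := box_subset (by omega)
    rw [← card_cube L w] at hq
    have hn3 : ((3 * n + 3 : ℕ) : ℝ) ≤ T := h.hn
    have hquad : 0 < (((scale L₀ k : ℝ) ^ (1 / 16 : ℝ)) ^ 16 + ((scale L₀ k : ℝ) ^ (1 / 16 : ℝ)) ^ 14
        - 9 * ((scale L₀ k : ℝ) ^ (1 / 16 : ℝ)) ^ 12) := hs.rate_pos h.hT
    have h1 := descent (f := greenColumn g V E (cube L w) y) (E := E) (R := L - 1) (M := Γ)
      (J := (L - 1 - ℓ) / (ℓ + 2)) (n := n) (Γ := Γ) (κ := κ) (ℓ := ℓ) x.2 (by omega)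
      (by have := Nat.div_mul_le_self (L - 1 - ℓ) (ℓ + 2); omega)
      (fun z hz => solvesAt_greenColumn hE y (hsub hz) (fun hzy => hy (hzy ▸ hz)))
      (fun r hr hr' => ⟨notMem_spec_of_not_isResonant hg (hnr3 r x.1 hr (by omega)),
        abs_green_le_of_not_isResonant hg (hnr3 r x.1 hr (by omega))⟩)
      hΓ0 hκ0 hΓ0
      (hq.trans (Real.exp_le_one_iff.2 (neg_nonpos.2
        (mul_nonneg (zero_le_one.trans h.one_le_m) hquad.le))))
      (fun z hz hdisj => hfam (fun j => clampCenter L w ℓ (z j))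
        (fun j => (hz j).1.trans hsub)
        (fun j => by
          by_contra hcon
          exact (hz j).2 (ih E _ hcon)) hdisj)
      (fun z hz => by
        have := greenColumn_apply (g := g) (V := V) E (cube L w) y ⟨z, hsub hz⟩
        simp only at this
        rw [this]
        exact hgr _ _)
    rw [greenColumn_apply] at h1
    exact h1.trans (hs.decay_step h.hT hn3 h.one_le_m (by positivity) hq hlt hΓ0 hΓ)

/-- Decay of a solution inside a cube that is not partially resonant. -/
theorem abs_le_of_not_isPartiallyResonant (h : Admissible d n L₀ g m T)
    (hV : IsSparse L₀ g n V) {k : ℕ} {E : ℝ} {u x : Site d} (hx : x ∈ cube (scale L₀ k) u)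
    {r : ℕ} (hrL : r < scale L₀ k) (hr : (scale L₀ k : ℝ) ^ (7 / 8 : ℝ) / 16 ≤ r)
    (hnr : ¬ IsPartiallyResonant L₀ g k V E r (clampCenter (scale L₀ k) u r x))
    {f : Site d → ℝ} (hf : ∀ y ∈ cube (scale L₀ k) u, |f y| ≤ 1)
    (hsol : ∀ y ∈ cube (scale L₀ k) u, SolvesAt g V E (cube (scale L₀ k) u) f y) :
    |f x| ≤ Real.exp (-(m * r / 2)) := by
  have hg : 0 < g := by linarith [h.one_le_g]
  have hsub : box (scale L₀ k) u r x ⊆ cube (scale L₀ k) u := box_subset hrL.le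
  unfold IsPartiallyResonant at hnr
  push Not at hnr
  obtain ⟨-, hnr2⟩ := hnr
  have hη := mul_pos hg (delta_pos L₀ hg k)
  cases k with
  | zero =>
    have h1 := descent_sites (f := f) (E := E) (R := r) (M := 1) hx hrL hη
      (fun z hz => hsol z (hsub hz))
      (fun z hz => by
        have hz1 := hnr2 0 z (Nat.zero_le _) (fun p hp => by
          have : p = z := by
            have := mem_cube_iff.1 hp
            funext i
            have := this i
            push_cast at this
            omega
          exact this ▸ hz)
        rw [abs_sub_comm]
        exact le_abs_sub_of_not_isResonant hz1 _ (mem_spec_site g V z))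
      zero_le_one (fun z hz => hf z (hsub hz))
    rw [mul_one] at h1
    have h2 : ((cube (scale L₀ 0) u).card : ℝ) / (g * delta L₀ g 0) ≤ Real.exp (-(2 * m)) := by
      rw [card_cube]
      exact h.initial
    refine h1.trans ((pow_le_exp_neg (by positivity) h2 r).trans (Real.exp_le_exp.2 ?_))
    have : 0 ≤ m * r := mul_nonneg (zero_le_one.trans h.one_le_m) (Nat.cast_nonneg r)
    linarith
  | succ k =>
    have hs := h.scalePair k
    have hlt := scale_lt_succ L₀ k
    have hΓ := one_div_mul_delta_le L₀ h.one_le_g (k + 1)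
    have hΓ0 : 0 ≤ 1 / (g * delta L₀ g (k + 1)) := one_div_nonneg.2 hη.le
    have hq := hs.quotient_le h.hT h.hTd h.one_le_m hΓ0 hΓ
    have hfam := hV k E u
    have ht := hs.le
    have hT := h.hT
    have hr' : ((scale L₀ k : ℝ) ^ (1 / 16 : ℝ)) ^ 21 / 16 ≤ r := by
      refine le_trans ?_ hr
      have ht0 : 0 < (scale L₀ k : ℝ) ^ (1 / 16 : ℝ) := by linarith
      set t := (scale L₀ k : ℝ) ^ (1 / 16 : ℝ)
      have : (t ^ 24) ^ (7 / 8 : ℝ) = t ^ 21 := by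
        rw [← Real.rpow_natCast, ← Real.rpow_mul ht0.le, ← Real.rpow_natCast]
        norm_num
      rw [← this]
      have := hs.lower
      gcongr
    rw [← card_cube _ u] at hq
    have hℓr : scale L₀ k ≤ r := by
      have h1 : (scale L₀ k : ℝ) ≤ r := by
        refine hs.small.le.trans (le_trans ?_ hr')
        set t := (scale L₀ k : ℝ) ^ (1 / 16 : ℝ)
        have h2 : (100 : ℝ) ≤ t ^ 5 := (hT.trans ht).trans (le_self_pow₀ (by linarith) (by norm_num))
        have h3 : 0 < t ^ 16 := pow_pos (by linarith) _
        have h4 : t ^ 21 = t ^ 16 * t ^ 5 := by ring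
        nlinarith
      exact_mod_cast h1
    have h1 := descent (f := f) (E := E) (R := r) (M := 1)
      (J := (r - scale L₀ k) / (scale L₀ k + 2)) (n := n) (Γ := 1 / (g * delta L₀ g (k + 1)))
      (κ := Real.exp (-(decayRate m (scale L₀ k) * scale L₀ k))) (ℓ := scale L₀ k) (g := g) (V := V)
      hx hrL
      (by have := Nat.div_mul_le_self (r - scale L₀ k) (scale L₀ k + 2); omega)
      (fun z hz => hsol z (hsub hz))
      (fun s hs hs' => by
        have := hnr2 s _ hs (box_mono (x := x) (u := u) hs' hrL.le hx)
        exact ⟨notMem_spec_of_not_isResonant hg this, abs_green_le_of_not_isResonant hg this⟩)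
      hΓ0 (Real.exp_pos _).le zero_le_one
      (hq.trans (Real.exp_le_one_iff.2 (neg_nonpos.2
        (mul_nonneg (zero_le_one.trans h.one_le_m) (hs.rate_pos h.hT).le))))
      (fun z hz hdisj => hfam (fun j => clampCenter (scale L₀ (k + 1)) u (scale L₀ k) (z j))
        (fun j => (hz j).1.trans hsub)
        (fun j => by
          by_contra hcon
          exact (hz j).2 (nonSingular_of_not_isPartiallyResonant h hV k E _ hcon)) hdisj)
      (fun z hz => hf z (hsub hz))
    rw [mul_one] at h1
    refine h1.trans (hs.decay_localization h.hT (le_trans ?_ h.hn) h.one_le_m (by positivity) hq hr')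
    norm_cast
    omega

/-- A cube that is not tunneling is localized. -/
theorem isLocalized_of_not_isTunneling (h : Admissible d n L₀ g m T)
    (hV : IsSparse L₀ g n V) {k : ℕ} {u : Site d} (hnt : ¬ IsTunneling L₀ g k V u) :
    IsLocalized L₀ g (m / 128) k V u := by
  have hL := h.le_scale k
  have hL1 := h.le_scale (k - 1)
  have hdecay := fun {E u x} => abs_le_of_not_isPartiallyResonant (k := k) (E := E) (u := u)
    (x := x) h hV
  unfold IsLocalized
  unfold IsTunneling at hnt
  set L := scale L₀ k with hLdef
  intro E ψ hψ hnorm x y hxy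
  have hLr : (10 : ℝ) ^ 32 ≤ L := by exact_mod_cast hL
  set N := ‖x.1 - y.1‖ with hN
  have hroot : (10 : ℝ) ^ 16 ≤ (L : ℝ) ^ (1 / 2 : ℝ) := by
    calc (10 : ℝ) ^ 16 = ((10 : ℝ) ^ 32) ^ (1 / 2 : ℝ) := by
          rw [← Real.rpow_natCast, ← Real.rpow_natCast, ← Real.rpow_mul (by norm_num)]; norm_num
      _ ≤ _ := by gcongr
  have hN1 : (10 : ℝ) ^ 16 ≤ N := by
    refine hroot.trans (le_trans ?_ hxy)
    exact Real.rpow_le_rpow_of_exponent_le (by linarith) (by norm_num)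
  have hNL : N ≤ 2 * L := by
    have h1 := mem_cube.1 x.2
    have h2 := mem_cube.1 y.2
    calc N = ‖(x.1 - u) - (y.1 - u)‖ := by rw [hN]; congr 1; abel
      _ ≤ ‖x.1 - u‖ + ‖y.1 - u‖ := norm_sub_le _ _
      _ ≤ 2 * L := by linarith
  -- The upper bound gives `4 * r < N`, hence disjoint boxes around `x` and `y`; the lower bound
  -- keeps `r` above `L ^ (7/8) / 16`, as the descent requires.
  obtain ⟨r, hr1, hr2⟩ : ∃ r : ℕ, (r : ℝ) ≤ N / 8 ∧ N / 16 ≤ r :=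
    ⟨⌊N / 8⌋₊, Nat.floor_le (by linarith), by
      have := Nat.lt_floor_add_one (N / 8)
      linarith⟩
  have hrL : r < L := by
    have : (r : ℝ) < L := by linarith
    exact_mod_cast this
  have hr3 : (L : ℝ) ^ (7 / 8 : ℝ) / 16 ≤ r := by linarith
  have hr4 : (L : ℝ) ^ (1 / 4 : ℝ) ≤ r := by
    refine le_trans ?_ hr3
    have e : (L : ℝ) ^ (7 / 8 : ℝ) = L ^ (1 / 4 : ℝ) * L ^ (5 / 8 : ℝ) := by
      rw [← Real.rpow_add (by linarith)]; norm_num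
    have h5 : (10 : ℝ) ^ 16 ≤ (L : ℝ) ^ (5 / 8 : ℝ) :=
      hroot.trans (Real.rpow_le_rpow_of_exponent_le (by linarith) (by norm_num))
    have h6 : 0 ≤ (L : ℝ) ^ (1 / 4 : ℝ) := by positivity
    rw [e]
    nlinarith
  -- It suffices that `ψ` is small at one of the two points, the other value being at most `1`. The
  -- exponent matches because `γ(m / 128, ·) ≤ m / 64`.
  have hor : ∀ z z' : cube L u, (‖ψ z‖ ≤ Real.exp (-(m * N / 64))) → ‖ψ z * ψ z'‖ ≤
      Real.exp (-(decayRate (m / 128) (scale L₀ (k - 1))) * N) := by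
    intro z z' hz
    have hz' : ‖ψ z'‖ ≤ 1 := by
      have h1 : ‖ψ z'‖ ^ 2 ≤ 1 := by
        rw [← hnorm]
        exact Finset.single_le_sum (f := fun i => ‖ψ i‖ ^ 2) (fun i _ => sq_nonneg _)
          (Finset.mem_univ z')
      exact (sq_le_one_iff₀ (norm_nonneg _)).1 h1
    rw [norm_mul]
    calc ‖ψ z‖ * ‖ψ z'‖ ≤ Real.exp (-(m * N / 64)) * 1 := by gcongr
      _ ≤ _ := by
        rw [mul_one]
        apply Real.exp_le_exp.2
        have := decayRate_le (m := m / 128) (by linarith [h.one_le_m])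
          (show 1 ≤ scale L₀ (k - 1) by omega)
        have hN0 : 0 ≤ N := by linarith
        have := mul_le_mul_of_nonneg_right this hN0
        linarith
  have hcomp : ∀ z : cube L u,
      ¬ IsPartiallyResonant L₀ g k V E r (clampCenter L u r z.1) →
      ‖ψ z‖ ≤ Real.exp (-(m * N / 64)) := by
    intro z hz
    -- The operator is real, so the real and imaginary parts of `ψ` are real solutions and can be
    -- estimated separately.
    have hpart : ∀ φ : ℂ →ₗ[ℝ] ℝ, (∀ c, |φ c| ≤ ‖c‖) →
        |φ (ψ z)| ≤ Real.exp (-(m * r / 2)) := by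
      intro φ hφ
      have h1 := hdecay z.2 hrL hr3 hz (f := extendZero fun y => φ (ψ y)) ?_ ?_
      · rwa [extendZero_apply] at h1
      · intro p hp
        rw [extendZero_apply (x := ⟨p, hp⟩)]
        refine (hφ _).trans ?_
        have h1 : ‖ψ ⟨p, hp⟩‖ ^ 2 ≤ 1 := by
          rw [← hnorm]
          exact Finset.single_le_sum (f := fun i => ‖ψ i‖ ^ 2) (fun i _ => sq_nonneg _)
            (Finset.mem_univ (⟨p, hp⟩ : cube L u))
        exact (sq_le_one_iff₀ (norm_nonneg _)).1 h1
      · intro p hp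
        have h2 := congrArg φ (congrFun hψ ⟨p, hp⟩)
        have h3 := hamiltonian_mulVec g V (cube L u) (extendZero fun y => φ (ψ y)) ⟨p, hp⟩
        unfold SolvesAt
        rw [← h3, extendZero_apply (x := ⟨p, hp⟩)]
        simp only [extendZero_apply]
        simp only [Matrix.mulVec, dotProduct, map_sum, Matrix.map_apply, Pi.smul_apply,
          smul_eq_mul] at h2 ⊢
        have hre : ∀ (a : ℝ) (c : ℂ), φ ((a : ℂ) * c) = a * φ c := by
          intro a c
          rw [← Complex.real_smul, map_smul, smul_eq_mul]
        simpa only [hre] using h2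
    have hre := hpart Complex.reLm Complex.abs_re_le_norm
    have him := hpart Complex.imLm Complex.abs_im_le_norm
    have hm := h.one_le_m
    calc ‖ψ z‖ ≤ |(ψ z).re| + |(ψ z).im| := Complex.norm_le_abs_re_add_abs_im _
      _ ≤ Real.exp (-(m * r / 2)) + Real.exp (-(m * r / 2)) := add_le_add hre him
      _ = 2 * Real.exp (-(m * r / 2)) := by ring
      _ ≤ Real.exp 1 * Real.exp (-(m * r / 2)) := by
        gcongr
        linarith [Real.add_one_le_exp (1 : ℝ)]
      _ ≤ _ := by
        rw [← Real.exp_add]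
        apply Real.exp_le_exp.2
        -- The descent yields `m r / 2 ≥ m N / 32`; half of that is given up to absorb the factor
        -- `exp 1`, using that `N` is huge.
        have h1 : m * (N / 16) ≤ m * r := by gcongr
        have h2 : 1 * 10 ^ 16 ≤ m * N := by gcongr
        linarith
  by_cases hx : IsPartiallyResonant L₀ g k V E r (clampCenter L u r x.1)
  · by_cases hy : IsPartiallyResonant L₀ g k V E r (clampCenter L u r y.1)
    · exact absurd ⟨E, r, r, _, _, hr4, hr4, box_subset hrL.le, box_subset hrL.le,
        disjoint_box_of_lt hrL.le x.2 y.2 (by linarith), hx, hy⟩ hnt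
    · rw [mul_comm (ψ x)]
      exact hor y x (hcomp y hy)
  · exact hor x y (hcomp x hx)

end Sparse
end MultiScale

/-! ### Lipschitz bounds and grid points on the torus. -/

section Torus

variable {ν : ℕ}

theorem coe_add_intCast (x : ℝ) (n : ℤ) : ((x + n : ℝ) : UnitAddCircle) = x := by
  have : ((n : ℝ) : UnitAddCircle) = 0 :=
    (AddCircle.coe_eq_zero_iff _).2 ⟨n, by simp⟩
  rw [AddCircle.coe_add, this, add_zero]

theorem dist_coe_le (x y : ℝ) : dist (x : UnitAddCircle) y ≤ |x - y| := by
  rw [dist_eq_norm, ← AddCircle.coe_sub, UnitAddCircle.norm_eq]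
  have := round_le (x - y) 0
  simpa using this

theorem exists_lift (ω ω' : UnitAddCircle) :
    ∃ t t' : ℝ, (t : UnitAddCircle) = ω ∧ (t' : UnitAddCircle) = ω' ∧ |t - t'| = dist ω ω' := by
  obtain ⟨t, rfl⟩ := QuotientAddGroup.mk_surjective ω
  obtain ⟨s, rfl⟩ := QuotientAddGroup.mk_surjective ω'
  refine ⟨t, s + round (t - s), rfl, coe_add_intCast s _, ?_⟩
  change _ = dist (t : UnitAddCircle) (s : UnitAddCircle)
  rw [dist_eq_norm, ← AddCircle.coe_sub, UnitAddCircle.norm_eq]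
  ring_nf

/-- Lifts realizing the distance in every coordinate reduce this to the mean value inequality on
`ℝ^ν`. For the max norm, the norm of the differential is at most the sum of the `ν` partial
derivatives. -/
theorem HasC1Bound.abs_sub_le {K : ℝ} (hK : 0 ≤ K) {f : Torus ν → ℝ} (hf : HasC1Bound K f)
    (ω ω' : Torus ν) : |f ω - f ω'| ≤ ν * K * dist ω ω' := by
  choose t t' ht ht' h using fun i => exists_lift (ω i) (ω' i)
  have hd : ‖t - t'‖ ≤ dist ω ω' := by
    rw [pi_norm_le_iff_of_nonneg dist_nonneg]
    intro i
    rw [Pi.sub_apply, Real.norm_eq_abs, h]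
    exact dist_le_pi_dist _ _ i
  have hbound : ∀ s, ‖fderiv ℝ (periodicLift f) s‖ ≤ ν * K := by
    intro s
    refine ContinuousLinearMap.opNorm_le_bound _ (by positivity) fun x => ?_
    have hx : x = ∑ i, x i • (Pi.single i 1 : Fin ν → ℝ) := by
      ext j
      simp [Finset.sum_apply, Pi.single_apply]
    calc ‖fderiv ℝ (periodicLift f) s x‖
        = ‖∑ i, x i * fderiv ℝ (periodicLift f) s (Pi.single i 1)‖ := by
          nth_rw 1 [hx]
          simp [map_sum]
      _ ≤ ∑ i : Fin ν, ‖x‖ * K := by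
          refine (norm_sum_le _ _).trans (Finset.sum_le_sum fun i _ => ?_)
          rw [norm_mul]
          exact mul_le_mul (norm_le_pi_norm x i) (hf.abs_partial_le s i) (norm_nonneg _)
            (norm_nonneg _)
      _ = ν * K * ‖x‖ := by simp; ring
  have h1 := Convex.norm_image_sub_le_of_norm_fderiv_le (𝕜 := ℝ) (s := Set.univ)
    (fun x _ => (hf.contDiff.differentiable one_ne_zero).differentiableAt)
    (fun x _ => hbound x) convex_univ (Set.mem_univ t') (Set.mem_univ t)
  have e : ∀ s : Fin ν → ℝ, periodicLift f s = f fun i => (s i : UnitAddCircle) := fun _ => rfl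
  rw [e, e, funext ht, funext ht', Real.norm_eq_abs] at h1
  refine h1.trans ?_
  gcongr

theorem exists_gridPoint_near {N : ℕ} (hN : 0 < N) (ω : Torus ν) :
    ∃ l : Fin ν → Fin N, dist ω (gridPoint N l) ≤ 1 / (2 * (N : ℝ)) := by
  have hNr : (0 : ℝ) < N := by exact_mod_cast hN
  have h1 : ∀ i, ∃ l : Fin N, dist (ω i)
      (((2 * ((l : ℕ) : ℝ) + 1) / (2 * (N : ℝ)) : ℝ) : UnitAddCircle) ≤ 1 / (2 * (N : ℝ)) := by
    intro i
    obtain ⟨s, hs⟩ := QuotientAddGroup.mk_surjective (ω i)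
    have hs' : ((Int.fract s : ℝ) : UnitAddCircle) = ω i := by
      rw [← hs]
      have := coe_add_intCast (Int.fract s) ⌊s⌋
      rw [Int.fract_add_floor] at this
      exact this.symm
    have h0 := Int.fract_nonneg s
    have h2 := Int.fract_lt_one s
    have h3 := Nat.floor_le (mul_nonneg h0 hNr.le)
    have h4 := Nat.lt_floor_add_one (Int.fract s * N)
    refine ⟨⟨⌊Int.fract s * N⌋₊, ?_⟩, ?_⟩
    · rw [Nat.floor_lt (mul_nonneg h0 hNr.le)]
      nlinarith
    · rw [← hs']
      refine (dist_coe_le _ _).trans ?_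
      simp only
      rw [abs_le]
      have e : Int.fract s - (2 * (⌊Int.fract s * N⌋₊ : ℝ) + 1) / (2 * N)
          = (2 * (Int.fract s * N - ⌊Int.fract s * N⌋₊) - 1) / (2 * N) := by
        field_simp
        ring
      rw [e, ← neg_div]
      constructor <;> gcongr <;> linarith
  choose l hl using h1
  exact ⟨l, (dist_pi_le_iff (by positivity)).2 hl⟩

end Torus

/-! ### From grid points to sparsity at every phase. -/

section Sampling

variable {d ν : ℕ} {Θ : Type*} {T : Site d → Torus ν → Torus ν} {v : Torus ν → Θ → ℝ}

theorem shift_sample (hT : IsDynamicalSystem T) (u : Site d) (ω : Torus ν) (θ : Θ) :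
    shift u (sample T v ω θ) = sample T v (T u ω) θ := by
  funext x
  simp only [shift, sample, hT.add]

/-- The constant `C' + 1` covers the site `0`, which DIV leaves out. -/
theorem dist_action_le (hT : IsDynamicalSystem T) {A' C' : ℝ} (hA' : 0 < A') (hC' : 0 < C')
    (hDIV : DIV A' C' T) {M : ℕ} (hM : 1 ≤ M) {x : Site d} (hx : x ∈ cube M 0) (ω ω' : Torus ν) :
    dist (T x ω) (T x ω') ≤ (C' + 1) * (M : ℝ) ^ A' * dist ω ω' := by
  have hM1 : (1 : ℝ) ≤ (M : ℝ) ^ A' := Real.one_le_rpow (by exact_mod_cast hM) hA'.le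
  by_cases h : x = 0
  · rw [h, hT.zero, hT.zero]
    refine le_mul_of_one_le_left dist_nonneg ?_
    nlinarith
  · refine (hDIV ω ω' x h).trans ?_
    have := mem_cube.1 hx
    rw [sub_zero] at this
    gcongr
    linarith

theorem abs_sample_sub_le (hT : IsDynamicalSystem T) {A' C' K : ℝ} (hA' : 0 < A') (hC' : 0 < C')
    (hK : 0 ≤ K) (hDIV : DIV A' C' T) {θ : Θ} (hv : HasC1Bound K fun ω => v ω θ) {M : ℕ}
    (hM : 1 ≤ M) {x : Site d} (hx : x ∈ cube M 0) (ω ω' : Torus ν) :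
    |sample T v ω θ x - sample T v ω' θ x| ≤ ν * K * ((C' + 1) * (M : ℝ) ^ A' * dist ω ω') :=
  (hv.abs_sub_le hK _ _).trans (by
    have := dist_action_le hT hA' hC' hDIV hM hx ω ω'
    gcongr)

theorem IsPartiallyResonant.exists_subcube {L₀ k : ℕ} {g E : ℝ} {V : Site d → ℝ} {r : ℕ}
    {w : Site d} (hr : prevScale L₀ k ≤ r) (h : IsPartiallyResonant L₀ g k V E r w) :
    ∃ (ℓ : ℕ) (w' : Site d), prevScale L₀ k ≤ ℓ ∧ cube ℓ w' ⊆ cube r w ∧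
      IsResonant L₀ g k V E ℓ w' := by
  rcases h with h | h
  · exact ⟨r, w, hr, subset_rfl, h⟩
  · exact h

theorem IsResonant.exists_mem_spec {L₀ k : ℕ} {g E : ℝ} {V : Site d → ℝ} {r : ℕ} {w : Site d}
    (h : IsResonant L₀ g k V E r w) :
    ∃ s ∈ spec g V (cube r w), |E - s| < g * delta L₀ g k := by
  obtain ⟨s, hs, h1⟩ := (Metric.infDist_lt_iff (spec_nonempty g V (cube_nonempty r w))).1 h
  exact ⟨s, hs, by rwa [← Real.dist_eq]⟩

theorem cube_subset_translate {r L : ℕ} {w u : Site d} (z : Site d) (h : cube r w ⊆ cube L u) :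
    cube r (w - z) ⊆ cube L (u - z) := by
  intro x hx
  have h1 : x + z ∈ cube r w := by
    have := (mem_cube_add (u := z) (w := w - z)).2 hx
    rwa [sub_add_cancel] at this
  have h2 := h h1
  rw [← sub_add_cancel u z] at h2
  exact mem_cube_add.1 h2

theorem disjoint_cube_translate {r L : ℕ} {w u : Site d} (z : Site d)
    (h : Disjoint (cube r w) (cube L u)) : Disjoint (cube r (w - z)) (cube L (u - z)) := by
  rw [Finset.disjoint_left] at h ⊢
  intro x hx hx'
  have h1 := (mem_cube_add (u := z)).2 hx
  have h2 := (mem_cube_add (u := z)).2 hx'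
  rw [sub_add_cancel] at h1 h2
  exact h h1 h2

theorem scale_succ_le_pow_four {L₀ k : ℕ} (h : 2 ≤ scale L₀ k) :
    scale L₀ (k + 1) ≤ scale L₀ k ^ 4 := by
  have h1 : ⌊(scale L₀ k : ℝ) ^ (3 / 2 : ℝ)⌋₊ ≤ scale L₀ k ^ 2 := by
    apply Nat.floor_le_of_le
    push_cast
    rw [← Real.rpow_natCast]
    exact Real.rpow_le_rpow_of_exponent_le (by exact_mod_cast (by omega : 1 ≤ scale L₀ k))
      (by norm_num)
  have h2 : 4 ≤ scale L₀ k ^ 2 := by nlinarith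
  have h3 : scale L₀ k ^ 4 = scale L₀ k ^ 2 * scale L₀ k ^ 2 := by ring
  rw [scale, h3]
  nlinarith

theorem gridSize_pos (L₀ : ℕ) {g : ℝ} (hg : 0 < g) (k ν : ℕ) : 0 < gridSize L₀ g k ν := by
  have := delta_pos L₀ hg k
  unfold gridSize
  rw [Nat.ceil_pos]
  positivity

theorem one_div_two_mul_gridSize_le (L₀ : ℕ) {g : ℝ} (hg : 0 < g) (k ν : ℕ) :
    1 / (2 * (gridSize L₀ g k ν : ℝ)) ≤ delta L₀ g k ^ (1 + 1 / (2 * (ν : ℝ))) := by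
  have hd := delta_pos L₀ hg k
  have h1 : (2 * delta L₀ g k ^ (1 + 1 / (2 * (ν : ℝ))))⁻¹ ≤ gridSize L₀ g k ν := Nat.le_ceil _
  have hp : 0 < delta L₀ g k ^ (1 + 1 / (2 * (ν : ℝ))) := by positivity
  rw [inv_le_iff_one_le_mul₀ (by positivity)] at h1
  have hN : (0 : ℝ) < gridSize L₀ g k ν := by exact_mod_cast gridSize_pos L₀ hg k ν
  rw [div_le_iff₀ (by positivity)]
  linarith

/-- A uniform absence of resonant families at the grid points implies sparsity for all phases. -/
theorem isSparse_sample (hd : 1 ≤ d) (hT : IsDynamicalSystem T) {A' C' K : ℝ} (hA' : 0 < A') (hC' : 0 < C')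
    (hK : 0 ≤ K) (hDIV : DIV A' C' T) {θ : Θ} (hv : HasC1Bound K fun ω => v ω θ)
    {L₀ : ℕ} (hL₀ : 2 ≤ L₀) {g : ℝ} (hg : 0 < g) (hθ : ∀ k, θ ∈ nonResonantSet T v L₀ g k)
    (hnum : ∀ k, ν * K * ((C' + 1) * ((scale L₀ k ^ 4 : ℕ) : ℝ) ^ A' *
      delta L₀ g k ^ (1 + 1 / (2 * (ν : ℝ)))) ≤ delta L₀ g k) (ω : Torus ν) :
    IsSparse L₀ g (ν + 1) (sample T v ω θ) := by
  intro k E u w hsub hres hdisj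
  have hscale : 2 ≤ scale L₀ k := hL₀.trans (le_scale L₀ k)
  -- Each partially resonant cube is replaced by a resonant subcube of radius at least `L_{k-1}`, as
  -- required in a resonant family.
  choose R c hR hRc hRres using fun j => (hres j).exists_subcube (prevScale_le L₀ k)
  choose s hs hEs using fun j => (hRres j).exists_mem_spec
  -- By covariance, translating the cubes by `-u` amounts to replacing `ω` by `T u ω`, so the
  -- configuration may be placed around the origin.
  obtain ⟨l, hl⟩ := exists_gridPoint_near (gridSize_pos L₀ hg k ν) (T u ω)
  have hδ := delta_pos L₀ hg k
  have hcube : ∀ j, cube (scale L₀ k) (w j - u) ⊆ cube (scale L₀ k ^ 4) 0 := by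
    intro j
    have h1 := cube_subset_translate u (hsub j)
    rw [sub_self] at h1
    refine h1.trans ?_
    intro x hx
    rw [mem_cube_iff] at hx ⊢
    intro i
    have := hx i
    have := scale_succ_le_pow_four hscale
    zify at this
    push_cast
    omega
  have hclose : ∀ x ∈ cube (scale L₀ k ^ 4) 0,
      |sample T v (gridPoint _ l) θ x - sample T v (T u ω) θ x| ≤ delta L₀ g k := by
    intro x hx
    refine (abs_sample_sub_le hT hA' hC' hK hDIV hv (Nat.one_le_pow _ _ (by omega)) hx _ _).trans ?_
    refine le_trans ?_ (hnum k)
    have := hl.trans (one_div_two_mul_gridSize_le L₀ hg k ν)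
    rw [dist_comm] at this
    gcongr
  have hnear : ∀ j, ∃ t ∈ spec g (sample T v (gridPoint _ l) θ) (cube (R j) (c j - u)),
      |s j - t| ≤ g * delta L₀ g k := by
    intro j
    have h1 : s j ∈ spec g (sample T v (T u ω) θ) (cube (R j) (c j - u)) := by
      rw [← shift_sample hT, spec_shift, sub_add_cancel]
      exact hs j
    exact exists_mem_spec_near hg.le hδ.le
      (fun x hx => hclose x (hcube j (cube_subset_translate u (hRc j) hx))) h1
  choose t ht hst using hnear
  refine hθ k l ⟨R, fun j => c j - u, fun j => w j - u, fun j => ⟨hR j, ?_⟩,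
    fun j => cube_subset_translate u (hRc j), hcube, fun i j hij => ?_, fun j _ =>
    ⟨t j, ht j, t 0, ht 0, ?_⟩⟩
  · exact radius_le_of_cube_subset hd (hRc j)
  · exact disjoint_cube_translate u
      (Finset.disjoint_of_subset_left (hRc i) (Finset.disjoint_of_subset_right (hRc j)
        (hdisj i j hij)))
  -- The `4` consists of the two distances to the common energy `E` and the two spectral
  -- displacements due to the change of phase, each at most `g δ_k`.
  · have h1 := abs_le.1 (hst j)
    have h2 := abs_le.1 (hst 0)
    have h3 := abs_lt.1 (hEs j)
    have h4 := abs_lt.1 (hEs 0)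
    rw [abs_le]
    constructor <;> linarith

end Sampling

/-! ### Tunneling is an open condition on the potential. -/

section Topology

open Filter Topology

variable {d : ℕ} {g : ℝ}

theorem eventually_abs_sub_le (Λ : Finset (Site d)) (V : Site d → ℝ) {ε : ℝ} (hε : 0 < ε) :
    ∀ᶠ V' in 𝓝 V, ∀ x ∈ Λ, |V' x - V x| ≤ ε := by
  rw [eventually_all_finset]
  intro x _
  have h : Tendsto (fun V' : Site d → ℝ => V' x) (𝓝 V) (𝓝 (V x)) :=
    (continuous_apply x).tendsto V
  filter_upwards [h.eventually (Metric.closedBall_mem_nhds (V x) hε)] with V' hV'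
  exact hV'

theorem IsResonant.eventually (hg : 0 < g) {L₀ k ℓ : ℕ} {E : ℝ} {w : Site d} {V : Site d → ℝ}
    (h : IsResonant L₀ g k V E ℓ w) : ∀ᶠ V' in 𝓝 V, IsResonant L₀ g k V' E ℓ w := by
  obtain ⟨s, hs, hEs⟩ := h.exists_mem_spec
  have hε : 0 < (g * delta L₀ g k - |E - s|) / (2 * g) := by
    apply div_pos <;> linarith
  filter_upwards [eventually_abs_sub_le (cube ℓ w) V hε] with V' hV'
  obtain ⟨t, ht, hst⟩ := exists_mem_spec_near hg.le hε.le hV' hs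
  refine (Metric.infDist_le_dist_of_mem ht).trans_lt ?_
  rw [Real.dist_eq]
  have e : g * ((g * delta L₀ g k - |E - s|) / (2 * g)) = (g * delta L₀ g k - |E - s|) / 2 := by
    field_simp
  rw [e] at hst
  have := abs_sub_le E s t
  linarith

theorem IsPartiallyResonant.eventually (hg : 0 < g) {L₀ k ℓ : ℕ} {E : ℝ} {w : Site d}
    {V : Site d → ℝ} (h : IsPartiallyResonant L₀ g k V E ℓ w) :
    ∀ᶠ V' in 𝓝 V, IsPartiallyResonant L₀ g k V' E ℓ w := by
  rcases h with h | ⟨r, w', h1, h2, h3⟩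
  · exact (h.eventually hg).mono fun _ h => Or.inl h
  · exact (h3.eventually hg).mono fun _ h => Or.inr ⟨r, w', h1, h2, h⟩

/-- Resonance is a strict inequality and spectra move continuously, so the same energy and cubes
still work nearby. Openness gives measurability although the energy ranges over an uncountable set.
-/
theorem isOpen_isTunneling (hg : 0 < g) (L₀ k : ℕ) (u : Site d) :
    IsOpen {V : Site d → ℝ | IsTunneling L₀ g k V u} := by
  rw [isOpen_iff_eventually]
  rintro V ⟨E, r, r', w, w', h1, h2, h3, h4, h5, h6, h7⟩
  filter_upwards [h6.eventually hg, h7.eventually hg] with V' h6' h7'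
  exact ⟨E, r, r', w, w', h1, h2, h3, h4, h5, h6', h7'⟩

end Topology

/-! ### Pairs of cubes with close spectra, and the effect of varying one site. -/

section ClosePairs

open Matrix

variable {d : ℕ} {g : ℝ}

/-- The potentials for which the spectra in `Λ₁` and in `Λ₂` are at distance at most `c`. -/
def closePair (g c : ℝ) (Λ₁ Λ₂ : Finset (Site d)) : Set (Site d → ℝ) :=
  {V | ∃ s ∈ spec g V Λ₁, ∃ t ∈ spec g V Λ₂, |s - t| ≤ c}

/-- The potentials for which some eigenvalue `E` in `Λ₂` has in `Λ₁` a normalized approximate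
eigenvector that is not small at `x`. -/
def closePairAt (g c : ℝ) (Λ₁ Λ₂ : Finset (Site d)) (x : Λ₁) : Set (Site d → ℝ) :=
  {V | ∃ E ∈ spec g V Λ₂, ∃ ψ : Λ₁ → ℝ, ∑ i, ψ i ^ 2 = 1 ∧
    ∑ i, ((hamiltonian g V Λ₁ *ᵥ ψ) i - E * ψ i) ^ 2 ≤ c ^ 2 ∧ 1 ≤ (Λ₁.card : ℝ) * ψ x ^ 2}

/-- A normalized eigenvector has weight at least `1 / card` at some site; conversely an approximate
eigenvector forces a nearby eigenvalue. Taking `E` from the spectrum in `Λ₂` keeps it fixed when the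
potential varies in `Λ₁` only. -/
theorem closePair_eq_iUnion {c : ℝ} (hc : 0 ≤ c) (Λ₁ Λ₂ : Finset (Site d)) :
    closePair g c Λ₁ Λ₂ = ⋃ x : Λ₁, closePairAt g c Λ₁ Λ₂ x := by
  ext V
  rw [Set.mem_iUnion]
  constructor
  · rintro ⟨s, hs, t, ht, hst⟩
    obtain ⟨ψ, hψ, hAψ⟩ := exists_eigenvector hs
    have hex : ∃ x : Λ₁, 1 ≤ (Λ₁.card : ℝ) * ψ x ^ 2 := by
      by_contra hcon
      push Not at hcon
      have hne : (Finset.univ : Finset Λ₁).Nonempty := by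
        by_contra hn
        rw [Finset.not_nonempty_iff_eq_empty] at hn
        rw [hn] at hψ
        simp at hψ
      have h1 := Finset.sum_lt_sum_of_nonempty hne fun x _ => hcon x
      rw [← Finset.mul_sum, hψ] at h1
      simp at h1
    obtain ⟨x, hx⟩ := hex
    refine ⟨x, t, ht, ψ, hψ, ?_, hx⟩
    have h2 : ∀ i, ((hamiltonian g V Λ₁ *ᵥ ψ) i - t * ψ i) ^ 2 = (s - t) ^ 2 * ψ i ^ 2 := by
      intro i
      rw [hAψ, Pi.smul_apply, smul_eq_mul]
      ring
    simp only [h2]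
    rw [← Finset.mul_sum, hψ, mul_one]
    exact sq_le_sq' (by linarith [(abs_le.1 hst).1]) (abs_le.1 hst).2
  · rintro ⟨x, E, hE, ψ, hψ, h1, -⟩
    obtain ⟨s, hs, hs'⟩ := exists_mem_spectrum_near (isHermitian_hamiltonian g V Λ₁) hc
      (v := ψ) (by rw [hψ]; exact one_pos) (by rwa [hψ, mul_one])
    exact ⟨s, hs, E, hE, by rwa [abs_sub_comm]⟩

theorem continuous_hamiltonian_mulVec (Λ : Finset (Site d)) {X : Type*} [TopologicalSpace X]
    {V : X → Site d → ℝ} {ψ : X → Λ → ℝ} (hV : Continuous V) (hψ : Continuous ψ) (i : Λ) :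
    Continuous fun p => (hamiltonian g (V p) Λ *ᵥ ψ p) i := by
  simp only [mulVec, dotProduct, hamiltonian_apply]
  refine continuous_finsetSum _ fun j _ => ?_
  refine Continuous.mul ?_ ((continuous_apply j).comp hψ)
  refine continuous_const.add ?_
  by_cases h : i = j
  · simp only [h, if_true]
    exact continuous_const.mul ((continuous_apply j.1).comp hV)
  · simp only [h, if_false]
    exact continuous_const

/-- The set is the projection of a closed set along a compact factor, the unit balls containing both
vectors. The energy needs no variable of its own, being the Rayleigh quotient of the eigenvector in
`Λ₂`. -/
theorem isClosed_closePairAt (c : ℝ) (Λ₁ Λ₂ : Finset (Site d)) (x : Λ₁) :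
    IsClosed (closePairAt g c Λ₁ Λ₂ x) := by
  let B₁ := Metric.closedBall (0 : Λ₁ → ℝ) 1
  let B₂ := Metric.closedBall (0 : Λ₂ → ℝ) 1
  have : CompactSpace B₁ := isCompact_iff_compactSpace.1 (isCompact_closedBall _ _)
  have : CompactSpace B₂ := isCompact_iff_compactSpace.1 (isCompact_closedBall _ _)
  let e : (Site d → ℝ) × (B₁ × B₂) → ℝ := fun p =>
    ∑ i, p.2.2.1 i * (hamiltonian g p.1 Λ₂ *ᵥ p.2.2.1) i
  let C : Set ((Site d → ℝ) × (B₁ × B₂)) := {p |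
    ∑ i, p.2.2.1 i ^ 2 = 1 ∧ (∀ i, (hamiltonian g p.1 Λ₂ *ᵥ p.2.2.1) i = e p * p.2.2.1 i) ∧
    ∑ i, p.2.1.1 i ^ 2 = 1 ∧
    ∑ i, ((hamiltonian g p.1 Λ₁ *ᵥ p.2.1.1) i - e p * p.2.1.1 i) ^ 2 ≤ c ^ 2 ∧
    1 ≤ (Λ₁.card : ℝ) * p.2.1.1 x ^ 2}
  have h1 : Continuous fun p : (Site d → ℝ) × (B₁ × B₂) => p.2.1.1 := by fun_prop
  have h2 : Continuous fun p : (Site d → ℝ) × (B₁ × B₂) => p.2.2.1 := by fun_prop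
  have h1i : ∀ i, Continuous fun p : (Site d → ℝ) × (B₁ × B₂) => p.2.1.1 i :=
    fun i => (continuous_apply i).comp h1
  have h2i : ∀ i, Continuous fun p : (Site d → ℝ) × (B₁ × B₂) => p.2.2.1 i :=
    fun i => (continuous_apply i).comp h2
  have hH1 := fun i => continuous_hamiltonian_mulVec (g := g) Λ₁ continuous_fst h1 i
  have hH2 := fun i => continuous_hamiltonian_mulVec (g := g) Λ₂ continuous_fst h2 i
  have he : Continuous e := continuous_finsetSum _ fun i _ => (h2i i).mul (hH2 i)
  have hC : IsClosed C := by
    refine IsClosed.inter ?_ (IsClosed.inter ?_ (IsClosed.inter ?_ (IsClosed.inter ?_ ?_)))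
    · exact isClosed_eq (continuous_finsetSum _ fun i _ => (h2i i).pow 2) continuous_const
    · change IsClosed {p : (Site d → ℝ) × (B₁ × B₂) |
        ∀ i, (hamiltonian g p.1 Λ₂ *ᵥ p.2.2.1) i = e p * p.2.2.1 i}
      simp only [Set.ofPred_forall]
      exact isClosed_iInter fun i => isClosed_eq (hH2 i) (he.mul (h2i i))
    · exact isClosed_eq (continuous_finsetSum _ fun i _ => (h1i i).pow 2) continuous_const
    · exact isClosed_le (continuous_finsetSum _ fun i _ =>
        ((hH1 i).sub (he.mul (h1i i))).pow 2) continuous_const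
    · exact isClosed_le continuous_const (continuous_const.mul ((h1i x).pow 2))
  have hball : ∀ {Λ : Finset (Site d)} (φ : Λ → ℝ), ∑ i, φ i ^ 2 = 1 →
      φ ∈ Metric.closedBall (0 : Λ → ℝ) 1 := by
    intro Λ φ hφ
    rw [mem_closedBall_zero_iff, pi_norm_le_iff_of_nonneg zero_le_one]
    intro i
    have : φ i ^ 2 ≤ 1 := by
      rw [← hφ]
      exact Finset.single_le_sum (f := fun i => φ i ^ 2) (fun i _ => sq_nonneg _)
        (Finset.mem_univ i)
    exact (sq_le_one_iff_abs_le_one _).1 this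
  have himage : closePairAt g c Λ₁ Λ₂ x = Prod.fst '' C := by
    ext V
    constructor
    · rintro ⟨E, hE, ψ, hψ, h3, h4⟩
      obtain ⟨φ, hφ, hHφ⟩ := exists_eigenvector hE
      have heE : ∑ i, φ i * (hamiltonian g V Λ₂ *ᵥ φ) i = E := by
        rw [hHφ]
        calc ∑ i, φ i * (E • φ) i = E * ∑ i, φ i ^ 2 := by
              rw [Finset.mul_sum]
              exact Finset.sum_congr rfl fun i _ => by rw [Pi.smul_apply, smul_eq_mul]; ring
          _ = E := by rw [hφ, mul_one]
      refine ⟨(V, ⟨ψ, hball ψ hψ⟩, ⟨φ, hball φ hφ⟩), ⟨hφ, fun i => ?_, hψ, ?_, h4⟩, rfl⟩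
      · simp only [e]
        rw [heE, hHφ]
        rfl
      · simp only [e]
        rwa [heE]
    · rintro ⟨⟨V', ψ, φ⟩, ⟨h3, h4, h5, h6, h7⟩, rfl⟩
      refine ⟨_, mem_spectrum_of_eigenvector (v := φ.1) ?_ (funext h4), ψ.1, h5, h6, h7⟩
      intro h0
      simp only at h3
      rw [h0] at h3
      simp at h3
  rw [himage]
  exact isClosedMap_fst_of_compactSpace _ hC

theorem isClosed_closePair {c : ℝ} (hc : 0 ≤ c) (Λ₁ Λ₂ : Finset (Site d)) :
    IsClosed (closePair g c Λ₁ Λ₂) := by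
  rw [closePair_eq_iUnion hc]
  exact isClosed_iUnion_of_finite fun x => isClosed_closePairAt c Λ₁ Λ₂ x

theorem closePair_congr {V V' : Site d → ℝ} {c : ℝ} {Λ₁ Λ₂ : Finset (Site d)}
    (h₁ : ∀ x ∈ Λ₁, V x = V' x) (h₂ : ∀ x ∈ Λ₂, V x = V' x) :
    V ∈ closePair g c Λ₁ Λ₂ ↔ V' ∈ closePair g c Λ₁ Λ₂ := by
  simp only [closePair, Set.mem_ofPred_eq, spec_congr h₁, spec_congr h₂]

theorem closePairAt_congr {V V' : Site d → ℝ} {c : ℝ} {Λ₁ Λ₂ : Finset (Site d)} {x : Λ₁}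
    (h₁ : ∀ x ∈ Λ₁, V x = V' x) (h₂ : ∀ x ∈ Λ₂, V x = V' x) :
    V ∈ closePairAt g c Λ₁ Λ₂ x ↔ V' ∈ closePairAt g c Λ₁ Λ₂ x := by
  have : hamiltonian g V Λ₁ = hamiltonian g V' Λ₁ := by
    ext i j
    simp only [hamiltonian_apply, h₁ i.1 i.2]
  simp only [closePairAt, Set.mem_ofPred_eq, spec_congr h₂, this]

/-- Two potentials that differ at the site `x` only and have approximate eigenvectors with the
same energy that are not small at `x` are close. -/
theorem abs_sub_le_of_approximate_eigenvectors (hg : 0 < g) {Λ : Finset (Site d)} {x : Λ}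
    {V V' : Site d → ℝ} (hVV : ∀ y ∈ Λ, y ≠ x.1 → V y = V' y) {E c : ℝ} (hc : 0 ≤ c)
    {ψ ψ' : Λ → ℝ} (hψ : ∑ i, ψ i ^ 2 = 1) (hψ' : ∑ i, ψ' i ^ 2 = 1)
    (h : ∑ i, ((hamiltonian g V Λ *ᵥ ψ) i - E * ψ i) ^ 2 ≤ c ^ 2)
    (h' : ∑ i, ((hamiltonian g V' Λ *ᵥ ψ') i - E * ψ' i) ^ 2 ≤ c ^ 2)
    (hx : 1 ≤ (Λ.card : ℝ) * ψ x ^ 2) (hx' : 1 ≤ (Λ.card : ℝ) * ψ' x ^ 2) :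
    |V x.1 - V' x.1| ≤ 2 * c * Λ.card / g := by
  have cs : ∀ a b : Λ → ℝ, ∑ i, a i ^ 2 = 1 → ∑ i, b i ^ 2 ≤ c ^ 2 → |∑ i, a i * b i| ≤ c := by
    intro a b ha hb
    have h1 := Finset.sum_mul_sq_le_sq_mul_sq Finset.univ a b
    rw [ha, one_mul] at h1
    exact abs_le_of_sq_le_sq (h1.trans hb) hc
  have e1 := cs ψ' _ hψ' h
  have e2 := cs ψ _ hψ h'
  have hsymm : ∑ i, ψ' i * (hamiltonian g V' Λ *ᵥ ψ) i
      = ∑ i, ψ i * (hamiltonian g V' Λ *ᵥ ψ') i := by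
    have hT : (hamiltonian g V' Λ)ᵀ = hamiltonian g V' Λ := by
      have h := (isHermitian_hamiltonian g V' Λ).eq
      rwa [conjTranspose_eq_transpose_of_trivial] at h
    change ψ' ⬝ᵥ _ = ψ ⬝ᵥ _
    rw [dotProduct_mulVec, ← mulVec_transpose, hT, dotProduct_comm]
  have hdiag : ∑ i, ψ' i * (hamiltonian g V Λ *ᵥ ψ) i
      = ∑ i, ψ' i * (hamiltonian g V' Λ *ᵥ ψ) i + g * (V x.1 - V' x.1) * (ψ' x * ψ x) := by
    rw [hamiltonian_eq_add_diagonal g V' V Λ, add_mulVec]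
    simp only [Pi.add_apply, mul_add, Finset.sum_add_distrib, mulVec_diagonal]
    congr 1
    rw [Finset.sum_eq_single x]
    · ring
    · intro b _ hb
      rw [hVV b.1 b.2 fun h => hb (Subtype.ext h)]
      ring
    · simp
  -- Each approximate eigenvalue equation is paired with the other vector. By symmetry everything
  -- cancels except the potential difference at `x` and the two errors.
  have key : g * (V x.1 - V' x.1) * (ψ' x * ψ x)
      = (∑ i, ψ' i * ((hamiltonian g V Λ *ᵥ ψ) i - E * ψ i))
        - ∑ i, ψ i * ((hamiltonian g V' Λ *ᵥ ψ') i - E * ψ' i) := by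
    simp only [mul_sub, Finset.sum_sub_distrib]
    have : ∑ i, ψ' i * (E * ψ i) = ∑ i, ψ i * (E * ψ' i) :=
      Finset.sum_congr rfl fun i _ => by ring
    rw [this]
    linarith
  have hbound : |g * (V x.1 - V' x.1) * (ψ' x * ψ x)| ≤ 2 * c := by
    rw [key]
    have := abs_sub (∑ i, ψ' i * ((hamiltonian g V Λ *ᵥ ψ) i - E * ψ i))
      (∑ i, ψ i * ((hamiltonian g V' Λ *ᵥ ψ') i - E * ψ' i))
    linarith
  have hn : (0 : ℝ) ≤ Λ.card := Nat.cast_nonneg _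
  have hprod : 1 ≤ Λ.card * |ψ' x * ψ x| := by
    have h1 : (1 : ℝ) * 1 ≤ (Λ.card * ψ x ^ 2) * (Λ.card * ψ' x ^ 2) :=
      mul_le_mul hx hx' zero_le_one (zero_le_one.trans hx)
    have h2 : (1 : ℝ) ^ 2 ≤ (Λ.card * |ψ' x * ψ x|) ^ 2 := by
      rw [mul_pow, sq_abs]
      linarith
    exact (sq_le_sq₀ zero_le_one (by positivity)).1 h2
  rw [abs_mul, abs_mul, abs_of_pos hg] at hbound
  rw [le_div_iff₀ hg]
  have h3 := mul_le_mul_of_nonneg_left hprod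
    (mul_nonneg hg.le (abs_nonneg (V x.1 - V' x.1)))
  have h4 := mul_le_mul_of_nonneg_left hbound hn
  linarith

/-- The spectrum in `Λ₂` does not see the value at `x`. For each of its points the admissible values
form a set of diameter at most `2 c card / g`, and there are at most `Λ₂.card` points. -/
theorem volume_update_closePairAt_le (hg : 0 < g) {c : ℝ} (hc : 0 ≤ c)
    {Λ₁ Λ₂ : Finset (Site d)} (x : Λ₁) (hx : x.1 ∉ Λ₂) (V : Site d → ℝ) :
    volume {t : ℝ | Function.update V x.1 t ∈ closePairAt g c Λ₁ Λ₂ x}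
      ≤ ENNReal.ofReal (Λ₂.card * (2 * c * Λ₁.card / g)) := by
  classical
  have hspec : ∀ t, spec g (Function.update V x.1 t) Λ₂ = spec g V Λ₂ := fun t =>
    spec_congr fun y hy => Function.update_of_ne (fun h : y = x.1 => hx (by rw [← h]; exact hy)) _ _
  let I : ℝ → Set ℝ := fun E => {t | ∃ ψ : Λ₁ → ℝ, ∑ i, ψ i ^ 2 = 1 ∧
    ∑ i, ((hamiltonian g (Function.update V x.1 t) Λ₁ *ᵥ ψ) i - E * ψ i) ^ 2 ≤ c ^ 2 ∧
    1 ≤ (Λ₁.card : ℝ) * ψ x ^ 2}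
  have hI : ∀ E, volume (I E) ≤ ENNReal.ofReal (2 * c * Λ₁.card / g) := by
    intro E
    refine (Real.volume_le_diam _).trans (Metric.ediam_le ?_)
    rintro t ⟨ψ, h1, h2, h3⟩ t' ⟨ψ', h1', h2', h3'⟩
    rw [edist_dist, Real.dist_eq]
    refine ENNReal.ofReal_le_ofReal ?_
    have := abs_sub_le_of_approximate_eigenvectors hg (x := x)
      (V := Function.update V x.1 t) (V' := Function.update V x.1 t')
      (fun y _ hy => by rw [Function.update_of_ne hy, Function.update_of_ne hy])
      hc h1 h1' h2 h2' h3 h3'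
    simpa using this
  have hsub : {t : ℝ | Function.update V x.1 t ∈ closePairAt g c Λ₁ Λ₂ x}
      ⊆ ⋃ E ∈ (spec_finite g V Λ₂).toFinset, I E := by
    rintro t ⟨E, hE, ψ, hψ⟩
    rw [hspec] at hE
    simp only [Set.mem_iUnion]
    exact ⟨E, by simpa using hE, ψ, hψ⟩
  refine (measure_mono hsub).trans ((measure_biUnion_finset_le _ _).trans ?_)
  refine (Finset.sum_le_card_nsmul _ _ _ fun E _ => hI E).trans ?_
  rw [nsmul_eq_mul, ENNReal.ofReal_mul (Nat.cast_nonneg _), ENNReal.ofReal_natCast]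
  gcongr
  exact spec_ncard_le g V Λ₂

end ClosePairs

/-! ### Events with small slices under a bounded conditional density. -/

section ConditionalDensity

/-- The hypothesis identifies the joint law of `(π, X)` on `π ⁻¹' S` as the density `p` with respect
to the product of the law of `π` and Lebesgue measure. Bounding `p` by `κ` and each slice of `W` by
`b` then suffices. -/
theorem measure_inter_le_of_density {Z Y : Type*} [MeasurableSpace Z] [MeasurableSpace Y]
    (ρ : Measure Z) [IsFiniteMeasure ρ] {π : Z → Y} (hπ : Measurable π) {X : Z → ℝ}
    (hX : Measurable X) {p : Y → ℝ → ENNReal} (hp : Measurable (Function.uncurry p)) {κ : ENNReal}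
    (hpκ : ∀ y t, p y t ≤ κ)
    (h : ∀ S : Set Y, MeasurableSet S → ∀ I : Set ℝ, MeasurableSet I →
      ρ (π ⁻¹' S ∩ X ⁻¹' I) = ∫⁻ z in π ⁻¹' S, (∫⁻ t in I, p (π z) t) ∂ρ)
    {S : Set Y} (hS : MeasurableSet S) {W : Set (Y × ℝ)} (hW : MeasurableSet W) {b : ENNReal}
    (hb : ∀ y, volume {t | (y, t) ∈ W} ≤ b) :
    ρ (π ⁻¹' S ∩ {z | (π z, X z) ∈ W}) ≤ κ * b * ρ (π ⁻¹' S) := by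
  have hprod : Measurable fun z => (π z, X z) := hπ.prodMk hX
  have heq : (ρ.restrict (π ⁻¹' S)).map (fun z => (π z, X z))
      = (((ρ.map π).restrict S).prod volume).withDensity (Function.uncurry p) := by
    refine Measure.ext_prod fun {s t} hs ht => ?_
    rw [Measure.map_apply hprod (hs.prod ht), Measure.restrict_apply (hprod (hs.prod ht)),
      withDensity_apply _ (hs.prod ht), ← Measure.prod_restrict,
      lintegral_prod _ hp.aemeasurable, Measure.restrict_restrict hs]
    have e : (fun z => (π z, X z)) ⁻¹' s ×ˢ t ∩ π ⁻¹' S = π ⁻¹' (s ∩ S) ∩ X ⁻¹' t := by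
      ext z
      simp only [Set.mem_inter_iff, Set.mem_preimage, Set.mem_prod]
      tauto
    have hmeas : Measurable fun y => ∫⁻ t in t, p y t := hp.lintegral_prod_right'
    rw [e, h _ (hs.inter hS) t ht]
    exact (setLIntegral_map (hs.inter hS) hmeas hπ).symm
  have h1 : ρ (π ⁻¹' S ∩ {z | (π z, X z) ∈ W})
      = (ρ.restrict (π ⁻¹' S)).map (fun z => (π z, X z)) W := by
    rw [Measure.map_apply hprod hW, Measure.restrict_apply (hprod hW), Set.inter_comm]
    rfl
  rw [h1, heq, withDensity_apply _ hW]
  calc ∫⁻ a in W, Function.uncurry p a ∂((ρ.map π).restrict S).prod volume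
      ≤ ∫⁻ _ in W, κ ∂((ρ.map π).restrict S).prod volume :=
        lintegral_mono fun a => hpκ a.1 a.2
    _ = κ * (((ρ.map π).restrict S).prod volume) W := setLIntegral_const _ _
    _ = κ * ∫⁻ y, volume (Prod.mk y ⁻¹' W) ∂(ρ.map π).restrict S := by
        rw [Measure.prod_apply hW]
    _ ≤ κ * ∫⁻ _, b ∂(ρ.map π).restrict S := by
        gcongr with y
        exact hb y
    _ = κ * b * ρ (π ⁻¹' S) := by
        rw [lintegral_const, Measure.restrict_apply_univ, Measure.map_apply hπ hS, mul_assoc]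

theorem HasBoundedCondDensity.measure_inter_le {Z : Type*} {𝔊 mZ : MeasurableSpace Z}
    {ρ : Measure Z} [IsFiniteMeasure ρ] (h𝔊 : 𝔊 ≤ mZ) {X : Z → ℝ}
    (hX : Measurable X) {κ : ℝ} (h : HasBoundedCondDensity ρ 𝔊 X κ) {S : Set Z}
    (hS : MeasurableSet[𝔊] S) {W : Set (Z × ℝ)} (hW : MeasurableSet[𝔊.prod (borel ℝ)] W)
    {b : ENNReal} (hb : ∀ z, volume {t | (z, t) ∈ W} ≤ b) :
    ρ (S ∩ {z | (z, X z) ∈ W}) ≤ ENNReal.ofReal κ * b * ρ S := by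
  obtain ⟨p, hp, hpκ, h1⟩ := h
  -- The target is `Z` itself with the smaller σ-algebra `𝔊`, and `π` is the identity.
  exact @measure_inter_le_of_density Z Z mZ 𝔊 ρ _ id (fun s hs => h𝔊 s hs) X hX p hp _ hpκ h1 S hS
    W hW b hb

end ConditionalDensity

/-! ### Wegner bounds for pairs and families of cubes. -/

section Wegner

variable {d ν : ℕ} {Θ : Type*} [MeasurableSpace Θ] {T : Site d → Torus ν → Torus ν}
  {v : Torus ν → Θ → ℝ} {μ : Measure Θ} {g : ℝ}

/-- The sample of the potential as a function on the probability space. -/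
def jointSample (T : Site d → Torus ν → Torus ν) (v : Torus ν → Θ → ℝ) (z : Torus ν × Θ) :
    Site d → ℝ :=
  sample T v z.1 z.2

theorem measurable_jointSample (hT : IsDynamicalSystem T) (hv : Measurable (Function.uncurry v)) :
    Measurable (jointSample T v) :=
  measurable_pi_lambda _ fun x =>
    hv.comp (((hT.measurePreserving x).measurable.comp measurable_fst).prodMk measurable_snd)

/-- The σ-algebras of the local variation bound at one scale. -/
structure LocalVariation (T : Site d → Torus ν → Torus ν) (v : Torus ν → Θ → ℝ) (μ : Measure Θ)
    (𝔊 : Site d → MeasurableSpace (Torus ν × Θ)) (M : ℕ) (κ : ℝ) : Prop where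
  le : ∀ x, 𝔊 x ≤ Prod.instMeasurableSpace
  measurable_fst : ∀ x, Measurable[𝔊 x] (Prod.fst : Torus ν × Θ → Torus ν)
  measurable_sample : ∀ x, ∀ y ∈ cube M x, y ≠ x →
    Measurable[𝔊 x] fun z : Torus ν × Θ => jointSample T v z y
  density : ∀ x, HasBoundedCondDensity ((volume : Measure (Torus ν)).prod μ) (𝔊 x)
    (fun z => jointSample T v z x) κ

variable {𝔊 : Site d → MeasurableSpace (Torus ν × Θ)} {M : ℕ} {κ : ℝ}

/-- The sample without the value at `x` and without the values far from `x`. -/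
def cutSample (T : Site d → Torus ν → Torus ν) (v : Torus ν → Θ → ℝ) (M : ℕ) (x : Site d)
    (z : Torus ν × Θ) : Site d → ℝ :=
  fun y => if y ∈ cube M x ∧ y ≠ x then jointSample T v z y else 0

theorem LocalVariation.measurable_cutSample (h : LocalVariation T v μ 𝔊 M κ) (x : Site d) :
    Measurable[𝔊 x] (cutSample T v M x) := by
  refine @measurable_pi_lambda _ _ _ (𝔊 x) _ _ fun y => ?_
  by_cases hy : y ∈ cube M x ∧ y ≠ x
  · simp only [cutSample, hy]
    simpa [hy] using h.measurable_sample x y hy.1 hy.2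
  · simp only [cutSample, hy, if_false]
    exact @measurable_const _ _ _ (𝔊 x) _

omit [MeasurableSpace Θ] in
theorem cutSample_eq {x y : Site d} {z : Torus ν × Θ} (hy : y ∈ cube M x) (hyx : y ≠ x) :
    cutSample T v M x z y = jointSample T v z y := by
  simp [cutSample, hy, hyx]

theorem LocalVariation.measurableSet_closePair (h : LocalVariation T v μ 𝔊 M κ) {c : ℝ}
    (hc : 0 ≤ c) {x : Site d} {Λ₁ Λ₂ : Finset (Site d)} (h₁ : Λ₁ ⊆ cube M x) (h₂ : Λ₂ ⊆ cube M x)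
    (hx₁ : x ∉ Λ₁) (hx₂ : x ∉ Λ₂) :
    MeasurableSet[𝔊 x] {z | jointSample T v z ∈ closePair g c Λ₁ Λ₂} := by
  have e : {z | jointSample T v z ∈ closePair g c Λ₁ Λ₂}
      = cutSample T v M x ⁻¹' closePair g c Λ₁ Λ₂ := by
    ext z
    exact closePair_congr
      (fun y hy => (cutSample_eq (h₁ hy) (fun h => hx₁ (h ▸ hy))).symm)
      (fun y hy => (cutSample_eq (h₂ hy) (fun h => hx₂ (h ▸ hy))).symm)
  rw [e]
  exact h.measurable_cutSample x (isClosed_closePair hc Λ₁ Λ₂).measurableSet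

/-- A Wegner type bound for pairs of spectra, given the past. -/
theorem LocalVariation.measure_inter_closePair_le [IsProbabilityMeasure μ]
    [IsProbabilityMeasure (volume : Measure (Torus ν))]
    (h : LocalVariation T v μ 𝔊 M κ) (hT : IsDynamicalSystem T)
    (hv : Measurable (Function.uncurry v)) (hg : 0 < g) {c : ℝ} (hc : 0 ≤ c) (hκ : 0 ≤ κ)
    {Λ₁ Λ₂ : Finset (Site d)} (hdisj : Disjoint Λ₁ Λ₂) (h₁ : ∀ x ∈ Λ₁, Λ₁ ⊆ cube M x)
    (h₂ : ∀ x ∈ Λ₁, Λ₂ ⊆ cube M x) {S : Set (Torus ν × Θ)}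
    (hS : ∀ x ∈ Λ₁, MeasurableSet[𝔊 x] S) :
    ((volume : Measure (Torus ν)).prod μ) (S ∩ {z | jointSample T v z ∈ closePair g c Λ₁ Λ₂})
      ≤ ENNReal.ofReal (Λ₁.card * (κ * (Λ₂.card * (2 * c * Λ₁.card / g))))
        * ((volume : Measure (Torus ν)).prod μ) S := by
  have hsite : ∀ x : Λ₁, ((volume : Measure (Torus ν)).prod μ)
      (S ∩ {z | jointSample T v z ∈ closePairAt g c Λ₁ Λ₂ x})
      ≤ ENNReal.ofReal (κ * (Λ₂.card * (2 * c * Λ₁.card / g)))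
        * ((volume : Measure (Torus ν)).prod μ) S := by
    intro x
    have hx₂ : x.1 ∉ Λ₂ := Finset.disjoint_left.1 hdisj x.2
    -- The value at `x` is made a free variable, the other relevant values being `𝔊 x`-measurable;
    -- the event is recovered by inserting the actual value.
    let W : Set ((Torus ν × Θ) × ℝ) :=
      {q | Function.update (cutSample T v M x.1 q.1) x.1 q.2 ∈ closePairAt g c Λ₁ Λ₂ x}
    have hupd : @Measurable _ _ ((𝔊 x.1).prod (borel ℝ)) _ fun q : (Torus ν × Θ) × ℝ =>
        Function.update (cutSample T v M x.1 q.1) x.1 q.2 := by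
      refine @measurable_pi_lambda _ _ _ ((𝔊 x.1).prod (borel ℝ)) _ _ fun y => ?_
      by_cases hy : y = x.1
      · subst hy
        simp only [Function.update_self]
        exact @measurable_snd _ _ (𝔊 x.1) (borel ℝ)
      · simp only [Function.update_of_ne hy]
        exact ((measurable_pi_apply y).comp (h.measurable_cutSample x.1)).comp
          (@_root_.measurable_fst _ _ (𝔊 x.1) (borel ℝ))
    have hW : MeasurableSet[(𝔊 x.1).prod (borel ℝ)] W :=
      hupd (isClosed_closePairAt c Λ₁ Λ₂ x).measurableSet
    have hXm : Measurable fun z => jointSample T v z x.1 :=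
      (measurable_pi_apply x.1).comp (measurable_jointSample hT hv)
    have hb : ∀ z, volume {t : ℝ | (z, t) ∈ W}
        ≤ ENNReal.ofReal (Λ₂.card * (2 * c * Λ₁.card / g)) := fun z =>
      volume_update_closePairAt_le hg hc x hx₂ (cutSample T v M x.1 z)
    have h3 := (h.density x.1).measure_inter_le (h.le x.1) hXm (hS x.1 x.2) hW hb
    rw [← ENNReal.ofReal_mul hκ] at h3
    refine le_trans (le_of_eq ?_) h3
    congr 2
    ext z
    refine closePairAt_congr (fun y hy => ?_) (fun y hy => ?_)
    · by_cases hyx : y = x.1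
      · subst hyx
        simp
      · rw [Function.update_of_ne hyx, cutSample_eq (h₁ _ x.2 hy) hyx]
    · have hyx : y ≠ x.1 := fun h => hx₂ (h ▸ hy)
      rw [Function.update_of_ne hyx, cutSample_eq (h₂ _ x.2 hy) hyx]
  have hunion : S ∩ {z | jointSample T v z ∈ closePair g c Λ₁ Λ₂}
      ⊆ ⋃ x : Λ₁, S ∩ {z | jointSample T v z ∈ closePairAt g c Λ₁ Λ₂ x} := by
    rintro z ⟨hz, hz'⟩
    rw [Set.mem_ofPred_eq, closePair_eq_iUnion hc, Set.mem_iUnion] at hz'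
    obtain ⟨x, hx⟩ := hz'
    exact Set.mem_iUnion.2 ⟨x, hz, hx⟩
  refine (measure_mono hunion).trans ((measure_iUnion_fintype_le _ _).trans ?_)
  refine (Finset.sum_le_card_nsmul _ _ _ fun x _ => hsite x).trans (le_of_eq ?_)
  rw [nsmul_eq_mul, Finset.card_univ, Fintype.card_coe, ENNReal.ofReal_mul (Nat.cast_nonneg _),
    ENNReal.ofReal_natCast]
  ring

/-- The bound for several spectra close to the one in the cube number `0`. -/
theorem LocalVariation.measure_family_le [IsProbabilityMeasure μ]
    [IsProbabilityMeasure (volume : Measure (Torus ν))]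
    (h : LocalVariation T v μ 𝔊 M κ) (hT : IsDynamicalSystem T)
    (hv : Measurable (Function.uncurry v)) (hg : 0 < g) {c : ℝ} (hc : 0 ≤ c) (hκ : 0 ≤ κ)
    {n : ℕ} (Λ : Fin (n + 1) → Finset (Site d)) (hdisj : ∀ i j, i ≠ j → Disjoint (Λ i) (Λ j))
    (hΛ : ∀ i j, ∀ x ∈ Λ i, Λ j ⊆ cube M x) {N : ℝ} (hN : ∀ i, ((Λ i).card : ℝ) ≤ N)
    {U : Set (Torus ν)} (hU : MeasurableSet U) :
    ((volume : Measure (Torus ν)).prod μ) {z | z.1 ∈ U ∧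
        ∀ j, j ≠ 0 → jointSample T v z ∈ closePair g c (Λ j) (Λ 0)}
      ≤ ENNReal.ofReal (N * (κ * (N * (2 * c * N / g)))) ^ n * volume U := by
  classical
  have hN0 : 0 ≤ N := le_trans (Nat.cast_nonneg _) (hN 0)
  set β := ENNReal.ofReal (N * (κ * (N * (2 * c * N / g)))) with hβ
  -- Each further cube `Λ i` contributes a factor `β`. The events already imposed involve only `ω`,
  -- `Λ 0` and the other cubes, so they are `𝔊 x`-measurable for every `x ∈ Λ i`.
  have key : ∀ t : Finset (Fin (n + 1)), 0 ∉ t →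
      ((volume : Measure (Torus ν)).prod μ) {z | z.1 ∈ U ∧
        ∀ j ∈ t, jointSample T v z ∈ closePair g c (Λ j) (Λ 0)} ≤ β ^ t.card * volume U := by
    intro t
    induction t using Finset.induction_on with
    | empty =>
      intro _
      have e : {z : Torus ν × Θ | z.1 ∈ U ∧ ∀ j ∈ (∅ : Finset (Fin (n + 1))),
          jointSample T v z ∈ closePair g c (Λ j) (Λ 0)} = U ×ˢ Set.univ := by
        ext z; simp
      rw [e, Measure.prod_prod]
      simp
    | insert i t hit ih =>
      intro h0
      have hi0 : i ≠ 0 := fun h => h0 (h ▸ Finset.mem_insert_self i t)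
      have ih' := ih fun h => h0 (Finset.mem_insert_of_mem h)
      have e : {z : Torus ν × Θ | z.1 ∈ U ∧ ∀ j ∈ insert i t,
          jointSample T v z ∈ closePair g c (Λ j) (Λ 0)}
          = {z | z.1 ∈ U ∧ ∀ j ∈ t, jointSample T v z ∈ closePair g c (Λ j) (Λ 0)}
            ∩ {z | jointSample T v z ∈ closePair g c (Λ i) (Λ 0)} := by
        ext z
        simp only [Finset.forall_mem_insert, Set.mem_ofPred_eq, Set.mem_inter_iff]
        tauto
      rw [e]
      have hstep := h.measure_inter_closePair_le hT hv hg hc hκ (hdisj i 0 hi0)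
        (fun x hx => hΛ i i x hx) (fun x hx => hΛ i 0 x hx)
        (S := {z | z.1 ∈ U ∧ ∀ j ∈ t, jointSample T v z ∈ closePair g c (Λ j) (Λ 0)})
        (fun x hx => by
          have e2 : {z : Torus ν × Θ | z.1 ∈ U ∧ ∀ j ∈ t,
              jointSample T v z ∈ closePair g c (Λ j) (Λ 0)}
              = Prod.fst ⁻¹' U ∩
                ⋂ j ∈ t, {z | jointSample T v z ∈ closePair g c (Λ j) (Λ 0)} := by
            ext z; simp
          rw [e2]
          refine @MeasurableSet.inter _ (𝔊 x) _ _ (h.measurable_fst x hU) ?_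
          refine @Finset.measurableSet_biInter _ _ (𝔊 x) _ t fun j hj => ?_
          have hij : i ≠ j := fun h => hit (h ▸ hj)
          exact h.measurableSet_closePair hc (hΛ i j x hx) (hΛ i 0 x hx)
            (Finset.disjoint_left.1 (hdisj i j hij) hx)
            (Finset.disjoint_left.1 (hdisj i 0 hi0) hx))
      refine hstep.trans ?_
      rw [Finset.card_insert_of_notMem hit, pow_succ', mul_assoc β]
      refine mul_le_mul' (ENNReal.ofReal_le_ofReal ?_) ih'
      have := hN i
      have := hN 0
      gcongr
  have h1 := key (Finset.univ.erase 0) (by simp)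
  have h2 : (Finset.univ.erase (0 : Fin (n + 1))).card = n := by simp
  rw [h2] at h1
  simpa using h1

end Wegner

instance isProbabilityMeasure_volume_torus (ν : ℕ) :
    IsProbabilityMeasure (volume : Measure (Torus ν)) := by
  have : IsProbabilityMeasure (volume : Measure UnitAddCircle) := ⟨by simp⟩
  infer_instance

/-! ### Translation covariance, and reduction of tunneling to close pairs. -/

section Translation

variable {d L₀ k : ℕ} {g : ℝ} {V : Site d → ℝ}

theorem IsResonant.shift {E : ℝ} {ℓ : ℕ} {w : Site d} (u : Site d)
    (h : IsResonant L₀ g k V E ℓ w) : IsResonant L₀ g k (shift u V) E ℓ (w - u) := by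
  unfold IsResonant at *
  rwa [spec_shift, sub_add_cancel]

theorem IsPartiallyResonant.shift {E : ℝ} {ℓ : ℕ} {w : Site d} (u : Site d)
    (h : IsPartiallyResonant L₀ g k V E ℓ w) :
    IsPartiallyResonant L₀ g k (shift u V) E ℓ (w - u) := by
  rcases h with h | ⟨r, w', h1, h2, h3⟩
  · exact Or.inl (h.shift u)
  · exact Or.inr ⟨r, w' - u, h1, cube_subset_translate u h2, h3.shift u⟩

theorem IsTunneling.shift {w : Site d} (u : Site d) (h : IsTunneling L₀ g k V w) :
    IsTunneling L₀ g k (shift u V) (w - u) := by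
  obtain ⟨E, r, r', w, w', h1, h2, h3, h4, h5, h6, h7⟩ := h
  exact ⟨E, r, r', w - u, w' - u, h1, h2, cube_subset_translate u h3, cube_subset_translate u h4,
    disjoint_cube_translate u h5, h6.shift u, h7.shift u⟩

theorem isTunneling_shift_iff (u : Site d) :
    IsTunneling L₀ g k (shift u V) 0 ↔ IsTunneling L₀ g k V u := by
  constructor
  · intro h
    have h1 := h.shift (-u)
    have e : DetAnderson.shift (-u) (DetAnderson.shift u V) = V := by
      funext x
      simp [DetAnderson.shift]
    rwa [e, zero_sub, neg_neg] at h1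
  · intro h
    have h1 := h.shift u
    rwa [sub_self] at h1

theorem IsPartiallyResonant.exists_cube {E : ℝ} {r : ℕ} {w : Site d}
    (h : IsPartiallyResonant L₀ g k V E r w) :
    ∃ (ℓ : ℕ) (w' : Site d), cube ℓ w' ⊆ cube r w ∧
      ∃ s ∈ spec g V (cube ℓ w'), |E - s| < g * delta L₀ g k := by
  rcases h with h | ⟨ℓ, w', -, h2, h3⟩
  · exact ⟨r, w, subset_rfl, h.exists_mem_spec⟩
  · exact ⟨ℓ, w', h2, h3.exists_mem_spec⟩

/-- Eliminates the energy: two spectra within `g δ_k` of the same `E` are within `2 g δ_k` of each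
other, which the pair bound can handle. -/
theorem IsTunneling.exists_closePair {u : Site d} (h : IsTunneling L₀ g k V u) :
    ∃ (ℓ ℓ' : ℕ) (w w' : Site d), cube ℓ w ⊆ cube (scale L₀ k) u ∧
      cube ℓ' w' ⊆ cube (scale L₀ k) u ∧ Disjoint (cube ℓ w) (cube ℓ' w') ∧
      V ∈ closePair g (2 * (g * delta L₀ g k)) (cube ℓ w) (cube ℓ' w') := by
  obtain ⟨E, r, r', w, w', -, -, h3, h4, h5, h6, h7⟩ := h
  obtain ⟨ℓ, z, h8, s, hs, hEs⟩ := h6.exists_cube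
  obtain ⟨ℓ', z', h8', s', hs', hEs'⟩ := h7.exists_cube
  refine ⟨ℓ, ℓ', z, z', h8.trans h3, h8'.trans h4,
    Finset.disjoint_of_subset_left h8 (Finset.disjoint_of_subset_right h8' h5),
    s, hs, s', hs', ?_⟩
  rw [abs_lt] at hEs hEs'
  rw [abs_le]
  constructor <;> linarith

theorem closePair_of_close (hg : 0 ≤ g) {V V' : Site d → ℝ} {c ε : ℝ} (hε : 0 ≤ ε)
    {Λ₁ Λ₂ : Finset (Site d)} (h₁ : ∀ x ∈ Λ₁, |V' x - V x| ≤ ε) (h₂ : ∀ x ∈ Λ₂, |V' x - V x| ≤ ε)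
    (h : V ∈ closePair g c Λ₁ Λ₂) : V' ∈ closePair g (c + 2 * (g * ε)) Λ₁ Λ₂ := by
  obtain ⟨s, hs, t, ht, hst⟩ := h
  obtain ⟨s', hs', h1⟩ := exists_mem_spec_near hg hε h₁ hs
  obtain ⟨t', ht', h2⟩ := exists_mem_spec_near hg hε h₂ ht
  refine ⟨s', hs', t', ht', ?_⟩
  rw [abs_le] at *
  constructor <;> linarith

end Translation

/-! ### Measurability and measure of the exceptional sets. -/

section Probability

variable {d ν : ℕ} {Θ : Type*} [MeasurableSpace Θ] {T : Site d → Torus ν → Torus ν}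
  {v : Torus ν → Θ → ℝ} {μ : Measure Θ} {g : ℝ}

theorem LVB.localVariation {B κ : ℝ} (h : LVB B κ T v μ) {L : ℕ} (hL : 1 ≤ L) :
    ∃ 𝔊 : Site d → MeasurableSpace (Torus ν × Θ),
      LocalVariation T v μ 𝔊 (L ^ 4) (κ * (L : ℝ) ^ B) := by
  obtain ⟨𝔊, h𝔊⟩ := h
  exact ⟨𝔊 L, fun x => (h𝔊 L hL x).1, fun x => (h𝔊 L hL x).2.1, fun x => (h𝔊 L hL x).2.2.1,
    fun x => (h𝔊 L hL x).2.2.2⟩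

variable {𝔊 : Site d → MeasurableSpace (Torus ν × Θ)} {M : ℕ} {κ : ℝ}

/-- The bound for families of close spectra at a given phase. -/
theorem LocalVariation.measure_family_at_le [IsProbabilityMeasure μ]
    (h : LocalVariation T v μ 𝔊 M κ) (hT : IsDynamicalSystem T)
    (hv : Measurable (Function.uncurry v)) (hg : 0 < g) {c ε : ℝ} (hc : 0 ≤ c) (hε : 0 < ε)
    (hκ : 0 ≤ κ) {n : ℕ} (Λ : Fin (n + 1) → Finset (Site d))
    (hdisj : ∀ i j, i ≠ j → Disjoint (Λ i) (Λ j))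
    (hΛ : ∀ i j, ∀ x ∈ Λ i, Λ j ⊆ cube M x) {N : ℝ} (hN : ∀ i, ((Λ i).card : ℝ) ≤ N)
    {ω₀ : Torus ν} {ℓip : ℝ} (hℓip : 0 ≤ ℓip)
    (hlip : ∀ i, ∀ x ∈ Λ i, ∀ ω θ, |sample T v ω θ x - sample T v ω₀ θ x| ≤ ℓip * dist ω ω₀) :
    μ {θ | ∀ j, j ≠ 0 → sample T v ω₀ θ ∈ closePair g c (Λ j) (Λ 0)}
      ≤ ENNReal.ofReal (N * (κ * (N * (2 * (c + 2 * (g * ε)) * N / g)))) ^ n := by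
  set F := {θ | ∀ j, j ≠ 0 → sample T v ω₀ θ ∈ closePair g c (Λ j) (Λ 0)}
  -- The density bound averages over `ω`, but a fixed phase is needed. On this ball the samples
  -- change by at most `ε`, so `U ×ˢ F` lies in a slightly enlarged event; since `𝔊` contains the
  -- events of `ω`, the factor `volume U` appears on both sides and cancels.
  set U := Metric.ball ω₀ (ε / (ℓip + 1))
  have hr : 0 < ε / (ℓip + 1) := by positivity
  have hU : volume U ≠ 0 := (Metric.measure_ball_pos volume ω₀ hr).ne'
  have h1 := h.measure_family_le hT hv hg (c := c + 2 * (g * ε)) (by positivity) hκ Λ hdisj hΛ hN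
    (U := U) Metric.isOpen_ball.measurableSet
  have hsub : U ×ˢ F ⊆ {z | z.1 ∈ U ∧
      ∀ j, j ≠ 0 → jointSample T v z ∈ closePair g (c + 2 * (g * ε)) (Λ j) (Λ 0)} := by
    rintro ⟨ω, θ⟩ ⟨hω, hθ⟩
    have hclose : ∀ i, ∀ x ∈ Λ i, |sample T v ω θ x - sample T v ω₀ θ x| ≤ ε := by
      intro i x hx
      refine (hlip i x hx ω θ).trans ?_
      have h2 : dist ω ω₀ ≤ ε / (ℓip + 1) := (Metric.mem_ball.1 hω).le
      rw [le_div_iff₀ (by positivity)] at h2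
      have : 0 ≤ dist ω ω₀ := dist_nonneg
      linarith
    exact ⟨hω, fun j hj => closePair_of_close hg.le hε.le (hclose j) (hclose 0) (hθ j hj)⟩
  have h2 := (measure_mono hsub).trans h1
  rw [Measure.prod_prod, mul_comm] at h2
  exact (ENNReal.mul_le_mul_iff_left hU (measure_ne_top _ _)).1 h2

theorem cube_subset_cube_two_mul {L M : ℕ} (h : 2 * L ≤ M) {x : Site d} {Λ Λ' : Finset (Site d)}
    (hΛ : Λ ⊆ cube L 0) (hΛ' : Λ' ⊆ cube L 0) (hx : x ∈ Λ) : Λ' ⊆ cube M x := by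
  intro y hy
  have h1 := hΛ hx
  have h2 := hΛ' hy
  rw [mem_cube_iff] at *
  intro i
  have h3 := h1 i
  have h4 := h2 i
  simp only [Pi.zero_apply] at h3 h4
  omega

theorem card_cube_le {ℓ L : ℕ} (h : ℓ ≤ L) (w : Site d) :
    ((cube ℓ w).card : ℝ) ≤ (2 * (L : ℝ) + 1) ^ d := by
  rw [card_cube]
  push_cast
  gcongr

/-- A union bound over radii and centres. The local variation bound is taken at `2 L_k` because two
points of `Λ_{L_k^4}(0)` are at distance at most `2 L_k ^ 4 ≤ (2 L_k) ^ 4`. The phase tolerance `δ_k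
/ 2` raises `4` to `5`, which the Wegner bound doubles to `10`. -/
theorem LocalVariation.measure_hasResonantFamily_le [IsProbabilityMeasure μ] {L₀ k : ℕ}
    (h : LocalVariation T v μ 𝔊 ((2 * scale L₀ k) ^ 4) κ) (hT : IsDynamicalSystem T)
    (hv : Measurable (Function.uncurry v)) (hg : 0 < g) (hκ : 0 ≤ κ) (n : ℕ)
    {ω₀ : Torus ν} {ℓip : ℝ} (hℓip : 0 ≤ ℓip)
    (hlip : ∀ x ∈ cube (scale L₀ k ^ 4) 0, ∀ ω θ,
      |sample T v ω θ x - sample T v ω₀ θ x| ≤ ℓip * dist ω ω₀) :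
    μ {θ | HasResonantFamily L₀ g k n (sample T v ω₀ θ)}
      ≤ ENNReal.ofReal ((((scale L₀ k : ℝ) + 1) * (2 * (scale L₀ k : ℝ) ^ 4 + 1) ^ d) ^ (n + 1)
        * (10 * κ * ((2 * (scale L₀ k : ℝ) + 1) ^ d) ^ 3 * delta L₀ g k) ^ n) := by
  set L := scale L₀ k with hL
  set N : ℝ := (2 * (L : ℝ) + 1) ^ d with hN
  have hδ := delta_pos L₀ hg k
  set δ := delta L₀ g k
  let valid : (Fin (n + 1) → Fin (L + 1) × cube (d := d) (L ^ 4) 0) → Prop := fun a =>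
    (∀ i j, i ≠ j → Disjoint (cube (a i).1.1 (a i).2.1) (cube (a j).1.1 (a j).2.1)) ∧
    ∀ i, cube (a i).1.1 (a i).2.1 ⊆ cube (L ^ 4) 0
  let F : (Fin (n + 1) → Fin (L + 1) × cube (d := d) (L ^ 4) 0) → Set Θ := fun a =>
    {θ | valid a ∧ ∀ j, j ≠ 0 → sample T v ω₀ θ ∈
      closePair g (4 * (g * δ)) (cube (a j).1.1 (a j).2.1) (cube (a 0).1.1 (a 0).2.1)}
  have hF : ∀ a, μ (F a) ≤ ENNReal.ofReal ((10 * κ * N ^ 3 * δ) ^ n) := by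
    intro a
    by_cases ha : valid a
    · have h1 := h.measure_family_at_le hT hv hg (c := 4 * (g * δ)) (ε := δ / 2) (by positivity)
        (by positivity) hκ (fun i => cube (a i).1.1 (a i).2.1) ha.1
        (fun i j x hx => cube_subset_cube_two_mul (L := L ^ 4)
          (by rw [mul_pow]; have := Nat.zero_le (L ^ 4); omega) (ha.2 i) (ha.2 j) hx)
        (N := N) (fun i => card_cube_le (Nat.lt_succ_iff.1 (a i).1.2) _) (ω₀ := ω₀) hℓip
        (fun i x hx => hlip x (ha.2 i hx))
      have e : N * (κ * (N * (2 * (4 * (g * δ) + 2 * (g * (δ / 2))) * N / g)))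
          = 10 * κ * N ^ 3 * δ := by
        field_simp
        ring
      rw [e, ← ENNReal.ofReal_pow (by positivity)] at h1
      refine (measure_mono ?_).trans h1
      exact fun θ hθ => hθ.2
    · have : F a = ∅ := by
        ext θ
        simp [F, ha]
      rw [this, measure_empty]
      exact zero_le
  have hsub : {θ | HasResonantFamily L₀ g k n (sample T v ω₀ θ)} ⊆ ⋃ a, F a := by
    rintro θ ⟨R, c, u, hR, hRc, hu, hdisj, hspec⟩
    have hin : ∀ j, cube (R j) (c j) ⊆ cube (L ^ 4) 0 := fun j => (hRc j).trans (hu j)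
    refine Set.mem_iUnion.2 ⟨fun j => (⟨R j, Nat.lt_succ_iff.2 (hR j).2⟩,
      ⟨c j, hin j (self_mem_cube _ _)⟩), ⟨hdisj, hin⟩, hspec⟩
  refine (measure_mono hsub).trans ((measure_iUnion_fintype_le _ _).trans ?_)
  refine (Finset.sum_le_card_nsmul _ _ _ fun a _ => hF a).trans (le_of_eq ?_)
  rw [nsmul_eq_mul, ENNReal.ofReal_mul (by positivity)]
  congr 1
  rw [Finset.card_univ, Fintype.card_fun, Fintype.card_prod, Fintype.card_fin, Fintype.card_fin,
    Fintype.card_coe, card_cube, ← ENNReal.ofReal_natCast]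
  push_cast
  rfl

theorem LocalVariation.measure_isTunneling_le [IsProbabilityMeasure μ] {L₀ k : ℕ}
    (h : LocalVariation T v μ 𝔊 ((2 * scale L₀ k) ^ 4) κ) (hd : 1 ≤ d) (hT : IsDynamicalSystem T)
    (hv : Measurable (Function.uncurry v)) (hg : 0 < g) (hκ : 0 ≤ κ) :
    ((volume : Measure (Torus ν)).prod μ) {z | IsTunneling L₀ g k (jointSample T v z) 0}
      ≤ ENNReal.ofReal ((((scale L₀ k : ℝ) + 1) * (2 * (scale L₀ k : ℝ) + 1) ^ d) ^ 2
        * (10 * κ * ((2 * (scale L₀ k : ℝ) + 1) ^ d) ^ 3 * delta L₀ g k)) := by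
  set L := scale L₀ k with hL
  set N : ℝ := (2 * (L : ℝ) + 1) ^ d with hN
  have hδ := delta_pos L₀ hg k
  set δ := delta L₀ g k
  let I := Fin (L + 1) × cube (d := d) L 0
  let Q : I → Finset (Site d) := fun a => cube a.1.1 a.2.1
  let valid : I × I → Prop := fun a =>
    Disjoint (Q a.1) (Q a.2) ∧ Q a.1 ⊆ cube L 0 ∧ Q a.2 ⊆ cube L 0
  let F : I × I → Set (Torus ν × Θ) := fun a =>
    {z | valid a ∧ jointSample T v z ∈ closePair g (2 * (g * δ)) (Q a.1) (Q a.2)}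
  have hF : ∀ a, ((volume : Measure (Torus ν)).prod μ) (F a)
      ≤ ENNReal.ofReal (10 * κ * N ^ 3 * δ) := by
    intro a
    by_cases ha : valid a
    · have hM : 2 * L ≤ (2 * L) ^ 4 := Nat.le_self_pow (by norm_num) _
      have h1 := h.measure_inter_closePair_le hT hv hg (c := 2 * (g * δ)) (by positivity) hκ ha.1
        (fun x hx => cube_subset_cube_two_mul hM ha.2.1 ha.2.1 hx)
        (fun x hx => cube_subset_cube_two_mul hM ha.2.1 ha.2.2 hx) (S := Set.univ)
        (fun x _ => @MeasurableSet.univ _ (𝔊 x))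
      rw [measure_univ, mul_one, Set.univ_inter] at h1
      refine (measure_mono fun z hz => ?_).trans (h1.trans (ENNReal.ofReal_le_ofReal ?_))
      · exact hz.2
      · have h2 : ((Q a.1).card : ℝ) ≤ N := card_cube_le (Nat.lt_succ_iff.1 a.1.1.2) _
        have h3 : ((Q a.2).card : ℝ) ≤ N := card_cube_le (Nat.lt_succ_iff.1 a.2.1.2) _
        calc ((Q a.1).card : ℝ) * (κ * ((Q a.2).card * (2 * (2 * (g * δ)) * (Q a.1).card / g)))
            ≤ N * (κ * (N * (2 * (2 * (g * δ)) * N / g))) := by gcongr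
          _ = 4 * (κ * N ^ 3 * δ) := by field_simp; ring
          _ ≤ 10 * (κ * N ^ 3 * δ) := by
              have : 0 ≤ κ * N ^ 3 * δ := by positivity
              linarith
          _ = 10 * κ * N ^ 3 * δ := by ring
    · have : F a = ∅ := by
        ext z
        simp [F, ha]
      rw [this, measure_empty]
      exact zero_le
  have hsub : {z | IsTunneling L₀ g k (jointSample T v z) 0} ⊆ ⋃ a, F a := by
    intro z hz
    obtain ⟨ℓ, ℓ', w, w', h1, h2, h3, h4⟩ := IsTunneling.exists_closePair hz
    refine Set.mem_iUnion.2 ⟨((⟨ℓ, Nat.lt_succ_iff.2 (radius_le_of_cube_subset hd h1)⟩,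
      ⟨w, h1 (self_mem_cube _ _)⟩), (⟨ℓ', Nat.lt_succ_iff.2 (radius_le_of_cube_subset hd h2)⟩,
      ⟨w', h2 (self_mem_cube _ _)⟩)), ⟨h3, h1, h2⟩, h4⟩
  refine (measure_mono hsub).trans ((measure_iUnion_fintype_le _ _).trans ?_)
  refine (Finset.sum_le_card_nsmul _ _ _ fun a _ => hF a).trans (le_of_eq ?_)
  rw [nsmul_eq_mul, ENNReal.ofReal_mul (p := (((L : ℝ) + 1) * N) ^ 2) (by positivity)]
  congr 1
  rw [Finset.card_univ, Fintype.card_prod, Fintype.card_prod, Fintype.card_fin,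
    Fintype.card_coe, card_cube, ← ENNReal.ofReal_natCast]
  push_cast
  rw [sq, hN]

theorem measurableSet_isTunneling (hT : IsDynamicalSystem T)
    (hv : Measurable (Function.uncurry v)) (hg : 0 < g) (L₀ k : ℕ) (u : Site d) :
    MeasurableSet {z | IsTunneling L₀ g k (jointSample T v z) u} :=
  measurable_jointSample hT hv (isOpen_isTunneling hg L₀ k u).measurableSet

theorem volume_isTunneling_eq (hT : IsDynamicalSystem T)
    (hv : Measurable (Function.uncurry v)) (hg : 0 < g) (L₀ k : ℕ) (u : Site d) (θ : Θ) :
    volume {ω | IsTunneling L₀ g k (sample T v ω θ) u}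
      = volume {ω | IsTunneling L₀ g k (sample T v ω θ) 0} := by
  have hm : MeasurableSet {ω | IsTunneling L₀ g k (sample T v ω θ) 0} :=
    measurable_prodMk_right (y := θ) (measurableSet_isTunneling hT hv hg L₀ k 0)
  rw [← (hT.measurePreserving u).measure_preimage hm.nullMeasurableSet]
  congr 1
  ext ω
  simp only [Set.mem_ofPred_eq, Set.mem_preimage]
  rw [← shift_sample hT, isTunneling_shift_iff]

theorem tunnelingSet_eq (hT : IsDynamicalSystem T)
    (hv : Measurable (Function.uncurry v)) (hg : 0 < g) (L₀ k : ℕ) :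
    tunnelingSet T v L₀ g k = {θ | ENNReal.ofReal (delta L₀ g k ^ (1 / 2 : ℝ)) ≤
      volume {ω | IsTunneling L₀ g k (sample T v ω θ) 0}} := by
  ext θ
  simp only [tunnelingSet, Set.mem_ofPred_eq, volume_isTunneling_eq hT hv hg, exists_const]

theorem measurable_volume_isTunneling (hT : IsDynamicalSystem T)
    (hv : Measurable (Function.uncurry v)) (hg : 0 < g) (L₀ k : ℕ) :
    Measurable fun θ => volume {ω | IsTunneling L₀ g k (sample T v ω θ) 0} :=
  measurable_measure_prodMk_right (measurableSet_isTunneling hT hv hg L₀ k 0)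

theorem measurableSet_tunnelingSet (hT : IsDynamicalSystem T)
    (hv : Measurable (Function.uncurry v)) (hg : 0 < g) (L₀ k : ℕ) :
    MeasurableSet (tunnelingSet T v L₀ g k) := by
  rw [tunnelingSet_eq hT hv hg]
  exact measurableSet_le measurable_const (measurable_volume_isTunneling hT hv hg L₀ k)

/-- Fubini turns the joint probability into the mean over `θ` of the probability in `ω`; Markov's
inequality does the rest. -/
theorem measure_tunnelingSet_le [IsProbabilityMeasure μ] (hT : IsDynamicalSystem T)
    (hv : Measurable (Function.uncurry v)) (hg : 0 < g) (L₀ k : ℕ) {b : ℝ}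
    (hb : ((volume : Measure (Torus ν)).prod μ) {z | IsTunneling L₀ g k (jointSample T v z) 0}
      ≤ ENNReal.ofReal b) :
    μ (tunnelingSet T v L₀ g k) ≤ ENNReal.ofReal (b / delta L₀ g k ^ (1 / 2 : ℝ)) := by
  have hδ : 0 < delta L₀ g k ^ (1 / 2 : ℝ) := Real.rpow_pos_of_pos (delta_pos L₀ hg k) _
  rw [Measure.prod_apply_symm (measurableSet_isTunneling hT hv hg L₀ k 0)] at hb
  rw [tunnelingSet_eq hT hv hg, ENNReal.ofReal_div_of_pos hδ]
  refine (meas_ge_le_lintegral_div (measurable_volume_isTunneling hT hv hg L₀ k).aemeasurable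
    (by simpa using hδ) ENNReal.ofReal_ne_top).trans ?_
  gcongr
  exact hb

/-- The discrete data range over countable sets, and for fixed data the condition is a finite
intersection of closed sets. -/
theorem measurableSet_hasResonantFamily (hg : 0 < g) (L₀ k n : ℕ) :
    MeasurableSet {V : Site d → ℝ | HasResonantFamily L₀ g k n V} := by
  have hδ := delta_pos L₀ hg k
  have e : {V : Site d → ℝ | HasResonantFamily L₀ g k n V}
      = ⋃ (R : Fin (n + 1) → ℕ) (c : Fin (n + 1) → Site d) (u : Fin (n + 1) → Site d)
        (_ : ∀ j, prevScale L₀ k ≤ R j ∧ R j ≤ scale L₀ k)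
        (_ : ∀ j, cube (R j) (c j) ⊆ cube (scale L₀ k) (u j))
        (_ : ∀ j, cube (scale L₀ k) (u j) ⊆ cube (scale L₀ k ^ 4) 0)
        (_ : ∀ i j, i ≠ j → Disjoint (cube (R i) (c i)) (cube (R j) (c j))),
        ⋂ (j) (_ : j ≠ 0), closePair g (4 * (g * delta L₀ g k)) (cube (R j) (c j))
          (cube (R 0) (c 0)) := by
    ext V
    simp only [Set.mem_iUnion, Set.mem_iInter, Set.mem_ofPred_eq, HasResonantFamily, closePair,
      exists_prop]
  rw [e]
  refine MeasurableSet.iUnion fun R => MeasurableSet.iUnion fun c => MeasurableSet.iUnion fun u =>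
    MeasurableSet.iUnion fun _ => MeasurableSet.iUnion fun _ => MeasurableSet.iUnion fun _ =>
    MeasurableSet.iUnion fun _ => MeasurableSet.iInter fun j => MeasurableSet.iInter fun _ =>
    (isClosed_closePair (by positivity) _ _).measurableSet

theorem measurableSet_nonResonantSet (hT : IsDynamicalSystem T)
    (hv : Measurable (Function.uncurry v)) (hg : 0 < g) (L₀ k : ℕ) :
    MeasurableSet (nonResonantSet T v L₀ g k) := by
  have e : nonResonantSet T v L₀ g k = ⋂ l : Fin ν → Fin (gridSize L₀ g k ν),
      {θ | HasResonantFamily L₀ g k (ν + 1) (sample T v (gridPoint _ l) θ)}ᶜ := by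
    ext θ
    simp [nonResonantSet]
  rw [e]
  refine MeasurableSet.iInter fun l => MeasurableSet.compl ?_
  exact ((measurable_jointSample hT hv).comp measurable_prodMk_left)
    (measurableSet_hasResonantFamily hg L₀ k (ν + 1))

theorem measurableSet_goodSetInfty (hT : IsDynamicalSystem T)
    (hv : Measurable (Function.uncurry v)) (hg : 0 < g) (L₀ : ℕ) :
    MeasurableSet (goodSetInfty T v L₀ g) :=
  MeasurableSet.iInter fun _ => MeasurableSet.iInter fun l => MeasurableSet.iInter fun _ =>
    (measurableSet_nonResonantSet hT hv hg L₀ l).diff (measurableSet_tunnelingSet hT hv hg L₀ l)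

theorem measure_compl_nonResonantSet_le {L₀ k : ℕ} {b : ℝ} (hb : ∀ ω₀,
      μ {θ | HasResonantFamily L₀ g k (ν + 1) (sample T v ω₀ θ)} ≤ ENNReal.ofReal b) :
    μ (nonResonantSet T v L₀ g k)ᶜ ≤ ENNReal.ofReal ((gridSize L₀ g k ν : ℝ) ^ ν * b) := by
  have e : (nonResonantSet T v L₀ g k)ᶜ = ⋃ l : Fin ν → Fin (gridSize L₀ g k ν),
      {θ | HasResonantFamily L₀ g k (ν + 1) (sample T v (gridPoint _ l) θ)} := by
    ext θ
    simp [nonResonantSet]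
  rw [e]
  refine (measure_iUnion_fintype_le _ _).trans ?_
  refine (Finset.sum_le_card_nsmul _ _ _ fun l _ => hb _).trans (le_of_eq ?_)
  rw [nsmul_eq_mul, ENNReal.ofReal_mul (by positivity), Finset.card_univ, Fintype.card_fun,
    Fintype.card_fin, Fintype.card_fin, ← ENNReal.ofReal_natCast]
  push_cast
  rfl

omit [MeasurableSpace Θ] in
theorem compl_goodSetInfty (T : Site d → Torus ν → Torus ν) (v : Torus ν → Θ → ℝ) (L₀ : ℕ)
    (g : ℝ) : (goodSetInfty T v L₀ g)ᶜ
      = ⋃ k, ((nonResonantSet T v L₀ g k)ᶜ ∪ tunnelingSet T v L₀ g k) := by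
  ext θ
  simp only [goodSetInfty, goodSet, Set.mem_compl_iff, Set.mem_iInter, Set.mem_iUnion,
    Set.mem_union, Set.mem_sdiff]
  constructor
  · intro h
    by_contra hcon
    push Not at hcon
    exact h fun k l _ => hcon l
  · rintro ⟨k, hk⟩ h
    have := h k k le_rfl
    tauto

end Probability

/-! ### Polynomials against stretched exponentials. -/

section Asymptotics

open Filter

theorem eventually_pow_le_exp_sqrt (s : ℕ) {η : ℝ} (hη : 0 < η) :
    ∀ᶠ L : ℕ in atTop, (L : ℝ) ^ s ≤ Real.exp (η * (L : ℝ) ^ (1 / 2 : ℝ)) := by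
  have h := tendsto_rpow_mul_exp_neg_mul_atTop_nhds_zero (2 * s) η hη
  have h1 : Tendsto (fun L : ℕ => (L : ℝ) ^ (1 / 2 : ℝ)) atTop atTop :=
    (tendsto_rpow_atTop (by norm_num)).comp tendsto_natCast_atTop_atTop
  filter_upwards [(h.comp h1).eventually (ge_mem_nhds one_pos)] with L hL
  have e : ((L : ℝ) ^ (1 / 2 : ℝ)) ^ (2 * (s : ℝ)) = (L : ℝ) ^ s := by
    rw [← Real.rpow_mul (Nat.cast_nonneg L), ← Real.rpow_natCast]
    ring_nf
  simp only [Function.comp_apply, e, neg_mul, Real.exp_neg] at hL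
  rwa [← div_eq_mul_inv, div_le_one (Real.exp_pos _)] at hL

/-- Polynomial factors are absorbed by the stretched exponentials, at all large scales. -/
structure LargeScale (d ν : ℕ) (A' C' B C'' K : ℝ) (L : ℕ) : Prop where
  family : 2 ^ ν * ((((L : ℝ) + 1) * (2 * (L : ℝ) ^ 4 + 1) ^ d) ^ (ν + 2) *
    (10 * (C'' * (((2 * L : ℕ) : ℝ)) ^ B) * ((2 * (L : ℝ) + 1) ^ d) ^ 3) ^ (ν + 1)) *
    ((L : ℝ) + 1) ^ 2 ≤ Real.exp (2 * (L : ℝ) ^ (1 / 2 : ℝ))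
  tunneling : (((L : ℝ) + 1) * (2 * (L : ℝ) + 1) ^ d) ^ 2 *
    (10 * (C'' * (((2 * L : ℕ) : ℝ)) ^ B) * ((2 * (L : ℝ) + 1) ^ d) ^ 3) *
    ((L : ℝ) + 1) ^ 2 ≤ Real.exp (2 * (L : ℝ) ^ (1 / 2 : ℝ))
  grid : ν * K * ((C' + 1) * ((L ^ 4 : ℕ) : ℝ) ^ A') ≤ Real.exp (2 / ν * (L : ℝ) ^ (1 / 2 : ℝ))

/-- Once `L` exceeds every constant involved, each factor is bounded by a power of `L`; the
exponents below are the sums of these powers. -/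
theorem eventually_largeScale (d : ℕ) {ν : ℕ} (hν : 1 ≤ ν) {A' C' B C'' K : ℝ}
    (hC' : 0 < C') (hB : 0 < B) (hC'' : 0 < C'') (hK : 0 < K) :
    ∀ᶠ L : ℕ in atTop, LargeScale d ν A' C' B C'' K L := by
  set D := ⌈2 * B⌉₊
  set D' := ⌈4 * A'⌉₊
  have hν0 : (0 : ℝ) < ν := by exact_mod_cast hν
  have hη : (0 : ℝ) < 2 / ν := by positivity
  have hreal : ∀ c : ℝ, ∀ᶠ L : ℕ in atTop, c ≤ (L : ℝ) := fun c =>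
    tendsto_natCast_atTop_atTop.eventually_ge_atTop c
  filter_upwards [eventually_pow_le_exp_sqrt
      (ν + ((2 + 5 * d) * (ν + 2) + (1 + (1 + D) + 2 * d * 3) * (ν + 1)) + 2 * 2)
      (η := 2) two_pos,
    eventually_pow_le_exp_sqrt ((2 + 2 * d) * 2 + (1 + (1 + D) + 2 * d * 3) + 2 * 2)
      (η := 2) two_pos,
    eventually_pow_le_exp_sqrt (1 + 1 + (1 + D')) hη, hreal 10, hreal C'', hreal ν, hreal K,
    hreal (C' + 1)] with L h1 h2 h3 h10 hLC hLν hLK hLC'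
  have hL0 : (0 : ℝ) < L := by linarith
  have hL1 : (1 : ℝ) ≤ L := by linarith
  have b1 : (L : ℝ) + 1 ≤ (L : ℝ) ^ 2 := by nlinarith
  have b2 : 2 * (L : ℝ) + 1 ≤ (L : ℝ) ^ 2 := by nlinarith
  have b3 : 2 * (L : ℝ) ^ 4 + 1 ≤ (L : ℝ) ^ 5 := by
    have := one_le_pow₀ (n := 4) hL1
    have e : (L : ℝ) ^ 5 = L * L ^ 4 := by ring
    nlinarith
  have b4 : (((2 * L : ℕ) : ℝ)) ^ B ≤ (L : ℝ) ^ D := by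
    calc (((2 * L : ℕ) : ℝ)) ^ B ≤ ((L : ℝ) ^ (2 : ℝ)) ^ B := by
          refine Real.rpow_le_rpow (by positivity) ?_ hB.le
          push_cast
          rw [Real.rpow_two]
          nlinarith
      _ = (L : ℝ) ^ (2 * B) := by rw [← Real.rpow_mul hL0.le]
      _ ≤ (L : ℝ) ^ (D : ℝ) := Real.rpow_le_rpow_of_exponent_le hL1 (Nat.le_ceil _)
      _ = (L : ℝ) ^ D := Real.rpow_natCast _ _
  have b5 : ((L ^ 4 : ℕ) : ℝ) ^ A' ≤ (L : ℝ) ^ D' := by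
    calc ((L ^ 4 : ℕ) : ℝ) ^ A' = (L : ℝ) ^ (4 * A') := by
          push_cast
          rw [← Real.rpow_natCast, ← Real.rpow_mul hL0.le]
          norm_num
      _ ≤ (L : ℝ) ^ (D' : ℝ) := Real.rpow_le_rpow_of_exponent_le hL1 (Nat.le_ceil _)
      _ = (L : ℝ) ^ D' := Real.rpow_natCast _ _
  have b6 : 10 * (C'' * (((2 * L : ℕ) : ℝ)) ^ B) * ((2 * (L : ℝ) + 1) ^ d) ^ 3
      ≤ (L : ℝ) ^ (1 + (1 + D) + 2 * d * 3) := by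
    calc _ ≤ (L : ℝ) * (L * L ^ D) * (((L : ℝ) ^ 2) ^ d) ^ 3 := by gcongr
      _ = _ := by ring
  refine ⟨?_, ?_, ?_⟩
  · refine le_trans ?_ h1
    calc _ ≤ (L : ℝ) ^ ν * ((L ^ 2 * (L ^ 5) ^ d) ^ (ν + 2) *
          (L ^ (1 + (1 + D) + 2 * d * 3)) ^ (ν + 1)) * (L ^ 2) ^ 2 := by
          gcongr
          linarith
      _ = _ := by ring
  · refine le_trans ?_ h2
    calc _ ≤ ((L : ℝ) ^ 2 * (L ^ 2) ^ d) ^ 2 * L ^ (1 + (1 + D) + 2 * d * 3) * (L ^ 2) ^ 2 := by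
          gcongr
      _ = _ := by ring
  · refine le_trans ?_ h3
    calc ν * K * ((C' + 1) * ((L ^ 4 : ℕ) : ℝ) ^ A') ≤ (L : ℝ) * L * (L * L ^ D') := by gcongr
      _ = _ := by ring

end Asymptotics

/-! ### Choice of exponents and of the coupling. -/

section Estimates

variable {L₀ k d ν : ℕ} {g A' C' B C'' K : ℝ}

theorem sqrt_delta_eq (L₀ : ℕ) (hg : 0 < g) (k : ℕ) :
    delta L₀ g k ^ (1 / 2 : ℝ)
      = g ^ (-(1 / 2 : ℝ) / 2) * Real.exp (-(2 * (scale L₀ k : ℝ) ^ (1 / 2 : ℝ))) := by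
  rw [delta, Real.mul_rpow (by positivity) (by positivity), ← Real.rpow_mul hg.le, ← Real.exp_mul]
  ring_nf

theorem delta_le_one (L₀ : ℕ) (hg : 1 ≤ g) (k : ℕ) : delta L₀ g k ≤ 1 := by
  unfold delta
  have h1 : g ^ (-(1 / 2) : ℝ) ≤ 1 := Real.rpow_le_one_of_one_le_of_nonpos hg (by norm_num)
  have h2 : Real.exp (-4 * (scale L₀ k : ℝ) ^ (1 / 2 : ℝ)) ≤ 1 := by
    rw [Real.exp_le_one_iff]
    have : (0 : ℝ) ≤ (scale L₀ k : ℝ) ^ (1 / 2 : ℝ) := by positivity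
    linarith
  exact mul_le_one₀ h1 (Real.exp_pos _).le h2

/-- The number of grid points is at most `2 ^ ν * δ_k ^ (-ν - 1/2)`. This is why families of `ν + 2`
cubes, with probability of order `δ_k ^ (ν + 1)`, are excluded: a half power of `δ_k` survives. -/
theorem gridSize_pow_mul_le (L₀ : ℕ) (hg : 1 ≤ g) (k : ℕ) (hν : 1 ≤ ν) :
    (gridSize L₀ g k ν : ℝ) ^ ν * delta L₀ g k ^ (ν + 1)
      ≤ 2 ^ ν * delta L₀ g k ^ (1 / 2 : ℝ) := by
  have hδ := delta_pos L₀ (by linarith) (g := g) k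
  have hδ1 := delta_le_one L₀ hg k
  have hν0 : (0 : ℝ) < ν := by exact_mod_cast hν
  unfold gridSize
  set δ := delta L₀ g k
  set p : ℝ := δ ^ (1 + 1 / (2 * (ν : ℝ))) with hp
  have hp0 : 0 < p := by positivity
  have hp1 : p ≤ 1 := Real.rpow_le_one hδ.le hδ1 (by positivity)
  have h1 : (⌈(2 * p)⁻¹⌉₊ : ℝ) ≤ 2 / p := by
    have := Nat.ceil_lt_add_one (show 0 ≤ (2 * p)⁻¹ by positivity)
    have h2 : (2 * p)⁻¹ + 1 ≤ 2 / p := by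
      rw [le_div_iff₀ hp0]
      have : (2 * p)⁻¹ * p = 1 / 2 := by field_simp
      nlinarith
    linarith
  have h3 : p ^ ν * δ ^ (1 / 2 : ℝ) = δ ^ (ν + 1) := by
    rw [hp, ← Real.rpow_natCast, ← Real.rpow_mul hδ.le, ← Real.rpow_add hδ, ← Real.rpow_natCast]
    congr 1
    push_cast
    field_simp
    ring
  calc (⌈(2 * p)⁻¹⌉₊ : ℝ) ^ ν * δ ^ (ν + 1) ≤ (2 / p) ^ ν * δ ^ (ν + 1) := by gcongr
    _ = 2 ^ ν * δ ^ (1 / 2 : ℝ) := by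
      rw [← h3, div_pow]
      field_simp

/-- The spare factor `(L_k + 1) ^ 2` becomes the summable weight `1 / (k + 1) ^ 2`, because `k ≤
L_k`. -/
theorem mul_sqrt_delta_le (hg : 0 < g) {P : ℝ}
    (hP : P * ((scale L₀ k : ℝ) + 1) ^ 2 ≤ Real.exp (2 * (scale L₀ k : ℝ) ^ (1 / 2 : ℝ))) :
    P * delta L₀ g k ^ (1 / 2 : ℝ) ≤ g ^ (-(1 / 2 : ℝ) / 2) * (1 / ((k : ℝ) + 1) ^ 2) := by
  have hk : (k : ℝ) ≤ scale L₀ k := by exact_mod_cast (scale_strictMono L₀).le_apply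
  rw [sqrt_delta_eq L₀ hg, mul_left_comm, Real.exp_neg]
  gcongr
  rw [← div_eq_mul_inv, div_le_div_iff₀ (Real.exp_pos _) (by positivity), one_mul]
  rcases le_or_gt P 0 with h | h
  · exact (mul_nonpos_of_nonpos_of_nonneg h (by positivity)).trans (Real.exp_pos _).le
  · refine le_trans ?_ hP
    gcongr

theorem LargeScale.family_le (h : LargeScale d ν A' C' B C'' K (scale L₀ k)) (hν : 1 ≤ ν)
    (hg : 1 ≤ g) (hC'' : 0 ≤ C'') :
    (gridSize L₀ g k ν : ℝ) ^ ν * ((((scale L₀ k : ℝ) + 1) *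
        (2 * (scale L₀ k : ℝ) ^ 4 + 1) ^ d) ^ (ν + 1 + 1) *
      (10 * (C'' * (((2 * scale L₀ k : ℕ) : ℝ)) ^ B) * ((2 * (scale L₀ k : ℝ) + 1) ^ d) ^ 3
        * delta L₀ g k) ^ (ν + 1))
      ≤ g ^ (-(1 / 2 : ℝ) / 2) * (1 / ((k : ℝ) + 1) ^ 2) := by
  refine le_trans ?_ (mul_sqrt_delta_le (by linarith) h.family)
  have h1 := gridSize_pow_mul_le L₀ hg k hν
  set X := (((scale L₀ k : ℝ) + 1) * (2 * (scale L₀ k : ℝ) ^ 4 + 1) ^ d) ^ (ν + 2)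
  set Y := 10 * (C'' * (((2 * scale L₀ k : ℕ) : ℝ)) ^ B) * ((2 * (scale L₀ k : ℝ) + 1) ^ d) ^ 3
  have hY : 0 ≤ Y := by positivity
  calc (gridSize L₀ g k ν : ℝ) ^ ν * (X * (Y * delta L₀ g k) ^ (ν + 1))
      = X * Y ^ (ν + 1) * ((gridSize L₀ g k ν : ℝ) ^ ν * delta L₀ g k ^ (ν + 1)) := by
        rw [mul_pow]; ring
    _ ≤ X * Y ^ (ν + 1) * (2 ^ ν * delta L₀ g k ^ (1 / 2 : ℝ)) := by gcongr
    _ = _ := by ring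

theorem LargeScale.tunneling_le (h : LargeScale d ν A' C' B C'' K (scale L₀ k)) (hg : 1 ≤ g) :
    (((scale L₀ k : ℝ) + 1) * (2 * (scale L₀ k : ℝ) + 1) ^ d) ^ 2 *
      (10 * (C'' * (((2 * scale L₀ k : ℕ) : ℝ)) ^ B) * ((2 * (scale L₀ k : ℝ) + 1) ^ d) ^ 3
        * delta L₀ g k) / delta L₀ g k ^ (1 / 2 : ℝ)
      ≤ g ^ (-(1 / 2 : ℝ) / 2) * (1 / ((k : ℝ) + 1) ^ 2) := by
  refine le_trans (le_of_eq ?_) (mul_sqrt_delta_le (by linarith) h.tunneling)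
  have hδ := delta_pos L₀ (by linarith) (g := g) k
  have e : delta L₀ g k = delta L₀ g k ^ (1 / 2 : ℝ) * delta L₀ g k ^ (1 / 2 : ℝ) := by
    rw [← Real.rpow_add hδ]
    norm_num
  have h0 : delta L₀ g k ^ (1 / 2 : ℝ) ≠ 0 := (Real.rpow_pos_of_pos hδ _).ne'
  rw [div_eq_iff h0]
  nth_rw 1 [e]
  ring

/-- The extra `1 / (2 ν)` in the grid exponent gives `exp (-(2 / ν) √L_k)`, which beats the
polynomial divergence of trajectories. -/
theorem LargeScale.grid_le (h : LargeScale d ν A' C' B C'' K (scale L₀ k)) (hν : 1 ≤ ν)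
    (hg : 1 ≤ g) :
    ν * K * ((C' + 1) * ((scale L₀ k ^ 4 : ℕ) : ℝ) ^ A' *
      delta L₀ g k ^ (1 + 1 / (2 * (ν : ℝ)))) ≤ delta L₀ g k := by
  have hδ := delta_pos L₀ (by linarith) (g := g) k
  have hν0 : (0 : ℝ) < ν := by exact_mod_cast hν
  have h1 : delta L₀ g k ^ (1 / (2 * (ν : ℝ)))
      ≤ Real.exp (-(2 / ν * (scale L₀ k : ℝ) ^ (1 / 2 : ℝ))) := by
    have h2 : delta L₀ g k ≤ Real.exp (-4 * (scale L₀ k : ℝ) ^ (1 / 2 : ℝ)) := by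
      unfold delta
      exact mul_le_of_le_one_left (Real.exp_pos _).le
        (Real.rpow_le_one_of_one_le_of_nonpos hg (by norm_num))
    calc delta L₀ g k ^ (1 / (2 * (ν : ℝ)))
        ≤ Real.exp (-4 * (scale L₀ k : ℝ) ^ (1 / 2 : ℝ)) ^ (1 / (2 * (ν : ℝ))) := by gcongr
      _ = _ := by
        rw [← Real.exp_mul]
        congr 1
        field_simp
        ring
  have h3 := h.grid
  rw [Real.rpow_add hδ, Real.rpow_one]
  calc ν * K * ((C' + 1) * ((scale L₀ k ^ 4 : ℕ) : ℝ) ^ A' *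
        (delta L₀ g k * delta L₀ g k ^ (1 / (2 * (ν : ℝ)))))
      = delta L₀ g k * ((ν * K * ((C' + 1) * ((scale L₀ k ^ 4 : ℕ) : ℝ) ^ A'))
          * delta L₀ g k ^ (1 / (2 * (ν : ℝ)))) := by ring
    _ ≤ delta L₀ g k * (Real.exp (2 / ν * (scale L₀ k : ℝ) ^ (1 / 2 : ℝ))
          * Real.exp (-(2 / ν * (scale L₀ k : ℝ) ^ (1 / 2 : ℝ)))) := by gcongr
    _ = delta L₀ g k := by rw [← Real.exp_add]; simp

/-- Here `g δ_0 = g ^ (1/2) exp (-4 √L_0)`. Volume and exponential together are at most `g ^ (1/4)`,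
leaving `g ^ (-1/4) = exp (-2 m)` with `m = log g / 8`. -/
theorem initial_quotient_le (hg : Real.exp 8 ≤ g)
    (h : ((((2 * L₀ + 1) ^ d : ℕ) : ℝ) * Real.exp (4 * (L₀ : ℝ) ^ (1 / 2 : ℝ))) ^ 4 ≤ g) :
    (((2 * L₀ + 1) ^ d : ℕ) : ℝ) / (g * delta L₀ g 0) ≤ Real.exp (-(2 * (Real.log g / 8))) := by
  have hg0 : 0 < g := (Real.exp_pos 8).trans_le hg
  set X := (((2 * L₀ + 1) ^ d : ℕ) : ℝ) * Real.exp (4 * (L₀ : ℝ) ^ (1 / 2 : ℝ)) with hX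
  have hX0 : 0 ≤ X := by positivity
  have h1 : X ≤ g ^ (1 / 4 : ℝ) := by
    calc X = (X ^ 4) ^ (1 / 4 : ℝ) := by
          rw [← Real.rpow_natCast, ← Real.rpow_mul hX0]; norm_num
      _ ≤ _ := by gcongr
  have h2 : Real.exp (-(2 * (Real.log g / 8))) = g ^ (-(1 / 4) : ℝ) := by
    rw [Real.rpow_def_of_pos hg0]; ring_nf
  rw [h2, mul_delta_eq L₀ hg0, div_le_iff₀ (by positivity)]
  have e : g ^ (-(1 / 4) : ℝ) * (g ^ (1 / 2 : ℝ) * Real.exp (-4 * (scale L₀ 0 : ℝ) ^ (1 / 2 : ℝ)))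
      = g ^ (1 / 4 : ℝ) * Real.exp (-4 * (L₀ : ℝ) ^ (1 / 2 : ℝ)) := by
    rw [← mul_assoc, ← Real.rpow_add hg0]
    norm_num [scale]
  rw [e]
  have h3 := mul_le_mul_of_nonneg_right h1 (Real.exp_pos (-4 * (L₀ : ℝ) ^ (1 / 2 : ℝ))).le
  refine le_trans (le_of_eq ?_) h3
  rw [hX, mul_assoc, ← Real.exp_add]
  simp

end Estimates

/-! ### Measure of the good set, and localization for good parameters. -/

section Good

variable {d ν : ℕ} {Θ : Type*} [MeasurableSpace Θ] {T : Site d → Torus ν → Torus ν}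
  {v : Torus ν → Θ → ℝ} {μ : Measure Θ} {g A' C' B C'' K : ℝ} {L₀ : ℕ}

theorem summable_one_div_succ_sq : Summable fun k : ℕ => 1 / ((k : ℝ) + 1) ^ 2 := by
  have h := (summable_nat_add_iff 1).2 (Real.summable_one_div_nat_pow.2 (by norm_num : 1 < 2))
  simpa using h

theorem measure_compl_goodSetInfty_le [IsProbabilityMeasure μ] (hd : 1 ≤ d) (hν : 1 ≤ ν)
    (hT : IsDynamicalSystem T) (hv : Measurable (Function.uncurry v)) (hA' : 0 < A')
    (hC' : 0 < C') (hC'' : 0 ≤ C'') (hK : 0 ≤ K) (hDIV : DIV A' C' T) (hLVB : LVB B C'' T v μ)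
    (hC1 : ∀ θ, HasC1Bound K fun ω => v ω θ) (hL₀ : 1 ≤ L₀) (hg : 1 ≤ g)
    (hlarge : ∀ k, LargeScale d ν A' C' B C'' K (scale L₀ k)) :
    μ (goodSetInfty T v L₀ g)ᶜ
      ≤ ENNReal.ofReal (2 * (∑' k : ℕ, 1 / ((k : ℝ) + 1) ^ 2) * g ^ (-(1 / 2 : ℝ) / 2)) := by
  have hg0 : 0 < g := by linarith
  have hstep : ∀ k, μ ((nonResonantSet T v L₀ g k)ᶜ ∪ tunnelingSet T v L₀ g k)
      ≤ ENNReal.ofReal (2 * g ^ (-(1 / 2 : ℝ) / 2) * (1 / ((k : ℝ) + 1) ^ 2)) := by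
    intro k
    have hscale : 1 ≤ scale L₀ k := hL₀.trans (le_scale L₀ k)
    obtain ⟨𝔊, h𝔊⟩ := hLVB.localVariation (L := 2 * scale L₀ k) (by omega)
    have hκ : 0 ≤ C'' * (((2 * scale L₀ k : ℕ) : ℝ)) ^ B := by positivity
    have h1 : μ (nonResonantSet T v L₀ g k)ᶜ
        ≤ ENNReal.ofReal (g ^ (-(1 / 2 : ℝ) / 2) * (1 / ((k : ℝ) + 1) ^ 2)) :=
      (measure_compl_nonResonantSet_le fun ω₀ =>
        h𝔊.measure_hasResonantFamily_le hT hv hg0 hκ (ν + 1)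
          (ℓip := ν * K * ((C' + 1) * ((scale L₀ k ^ 4 : ℕ) : ℝ) ^ A')) (by positivity)
          fun x hx ω θ => by
            have := abs_sample_sub_le hT hA' hC' hK hDIV (hC1 θ)
              (Nat.one_le_pow 4 _ hscale) hx ω ω₀
            rwa [← mul_assoc] at this).trans
      (ENNReal.ofReal_le_ofReal ((hlarge k).family_le hν hg hC''))
    have h2 : μ (tunnelingSet T v L₀ g k)
        ≤ ENNReal.ofReal (g ^ (-(1 / 2 : ℝ) / 2) * (1 / ((k : ℝ) + 1) ^ 2)) :=
      (measure_tunnelingSet_le hT hv hg0 L₀ k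
        (h𝔊.measure_isTunneling_le hd hT hv hg0 hκ)).trans
      (ENNReal.ofReal_le_ofReal ((hlarge k).tunneling_le hg))
    refine (measure_union_le _ _).trans ((add_le_add h1 h2).trans (le_of_eq ?_))
    rw [← ENNReal.ofReal_add (by positivity) (by positivity)]
    ring_nf
  rw [compl_goodSetInfty]
  refine (measure_iUnion_le _).trans ((ENNReal.tsum_le_tsum hstep).trans (le_of_eq ?_))
  rw [← ENNReal.ofReal_tsum_of_nonneg (fun k => by positivity)
    (summable_one_div_succ_sq.mul_left _), tsum_mul_left]
  ring_nf

omit [MeasurableSpace Θ] in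
theorem volume_not_isLocalized_le {n : ℕ} {m T₀ : ℝ} {k : ℕ} (h : Admissible d n L₀ g m T₀)
    {θ : Θ} (hsparse : ∀ ω, IsSparse L₀ g n (sample T v ω θ))
    (hθ : θ ∉ tunnelingSet T v L₀ g k) (u : Site d) :
    volume {ω : Torus ν | ¬ IsLocalized L₀ g (m / 128) k (sample T v ω θ) u}
      ≤ ENNReal.ofReal (g ^ (-(1 / 2 : ℝ) / 2) *
        Real.exp (-(scale L₀ k : ℝ) ^ (1 / 2 : ℝ))) := by
  have hsub : {ω : Torus ν | ¬ IsLocalized L₀ g (m / 128) k (sample T v ω θ) u}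
      ⊆ {ω | IsTunneling L₀ g k (sample T v ω θ) u} := by
    intro ω hω
    by_contra hcon
    exact hω (isLocalized_of_not_isTunneling h (hsparse ω) hcon)
  have h1 : volume {ω : Torus ν | IsTunneling L₀ g k (sample T v ω θ) u}
      < ENNReal.ofReal (delta L₀ g k ^ (1 / 2 : ℝ)) := by
    by_contra hcon
    exact hθ ⟨u, not_lt.1 hcon⟩
  refine (measure_mono hsub).trans (h1.le.trans (ENNReal.ofReal_le_ofReal ?_))
  have hg : 0 < g := by linarith [h.one_le_g]
  rw [sqrt_delta_eq L₀ hg]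
  gcongr
  have : (0 : ℝ) ≤ (scale L₀ k : ℝ) ^ (1 / 2 : ℝ) := by positivity
  linarith

end Good
end DetAnderson

end

open DetAnderson MeasureTheory
theorem mainTheorem3 (d ν : ℕ) (hd : 1 ≤ d) (hν : 1 ≤ ν)
    (A C A' C' B C'' K : ℝ) (hA : 0 < A) (hC : 0 < C) (hA' : 0 < A') (hC' : 0 < C')
    (hB : 0 < B) (hC'' : 0 < C'') (hK : 0 < K) :
    ∃ (C₇ c₁ : ℝ) (Lmin : ℕ), 0 < C₇ ∧ 0 < c₁ ∧ 2 < Lmin ∧ ∀ L₀ : ℕ, Lmin ≤ L₀ →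
    ∃ g₀ : ℝ, 1 < g₀ ∧ ∀ g : ℝ, g₀ ≤ g → ∃ m : ℝ, c₁ * Real.log g < m ∧
    ∀ (Θ : Type*) [MeasurableSpace Θ] (μ : Measure Θ) [IsProbabilityMeasure μ]
      (T : Site d → Torus ν → Torus ν) (v : Torus ν → Θ → ℝ),
      IsDynamicalSystem T → Measurable (Function.uncurry v) →
      USR A C T → DIV A' C' T → LVB B C'' T v μ → (∀ θ, HasC1Bound K fun ω => v ω θ) →
      (MeasurableSet (goodSetInfty T v L₀ g) ∧
        1 - C₇ * g ^ (-(1 / 2 : ℝ) / 2) ≤ μ.real (goodSetInfty T v L₀ g)) ∧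
      ∀ θ ∈ goodSetInfty T v L₀ g, ∀ (k : ℕ) (u : Site d),
        volume {ω : Torus ν | ¬ IsLocalized L₀ g m k (sample T v ω θ) u} ≤
          ENNReal.ofReal (g ^ (-(1 / 2 : ℝ) / 2) *
            Real.exp (-(scale L₀ k : ℝ) ^ (1 / 2 : ℝ))) := by
  obtain ⟨T₀, hT₀, hn, hTd⟩ := exists_threshold d (3 * (ν + 1) + 3)
  obtain ⟨L₁, hL₁⟩ := Filter.eventually_atTop.1 (eventually_largeScale d hν hC' hB hC'' hK)
  have hsum : 0 < ∑' k : ℕ, 1 / ((k : ℝ) + 1) ^ 2 :=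
    summable_one_div_succ_sq.tsum_pos (fun k => by positivity) 0 (by norm_num)
  -- The factor `2` in `C₇` counts the two exceptional sets at each scale. The final rate is `log g
  -- / (8 * 128) = log g / 1024`, so `c₁ = 1 / 2048` makes the inequality strict.
  refine ⟨2 * ∑' k : ℕ, 1 / ((k : ℝ) + 1) ^ 2, 1 / 2048, max 3 (max L₁ ⌈T₀ ^ 16⌉₊),
    by positivity, by norm_num, lt_of_lt_of_le (by norm_num) (le_max_left _ _), fun L₀ hL₀ => ?_⟩
  rw [max_le_iff, max_le_iff] at hL₀
  obtain ⟨hL3, hL1, hLT⟩ := hL₀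
  have hexp : 1 < Real.exp 8 := Real.one_lt_exp_iff.2 (by norm_num)
  set X := ((((2 * L₀ + 1) ^ d : ℕ) : ℝ) * Real.exp (4 * (L₀ : ℝ) ^ (1 / 2 : ℝ))) ^ 4 with hX
  have hX0 : 0 ≤ X := by positivity
  -- `exp 8` ensures that `log g / 8 ≥ 1`, and `X` that the descent contracts at the initial scale.
  refine ⟨Real.exp 8 + X, by linarith, fun g hg => ?_⟩
  have hg8 : Real.exp 8 ≤ g := by linarith
  have hg1 : 1 ≤ g := by linarith
  have hg0 : 0 < g := by linarith
  have hlog : 8 ≤ Real.log g := (Real.le_log_iff_exp_le hg0).2 hg8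
  have hadm : Admissible d (ν + 1) L₀ g (Real.log g / 8) T₀ :=
    { one_le_g := hg1
      one_le_m := by linarith
      hT := hT₀
      hn := hn
      hTd := hTd
      hL₀ := (Nat.le_ceil _).trans (by exact_mod_cast hLT)
      initial := initial_quotient_le hg8 (by rw [← hX]; linarith) }
  have hlarge : ∀ k, LargeScale d ν A' C' B C'' K (scale L₀ k) :=
    fun k => hL₁ _ (hL1.trans (le_scale L₀ k))
  refine ⟨Real.log g / 8 / 128, by linarith, ?_⟩
  intro Θ _ μ _ T v hT hv _ hDIV hLVB hC1
  have hmeas := measurableSet_goodSetInfty hT hv hg0 L₀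
  refine ⟨⟨hmeas, ?_⟩, fun θ hθ k u => ?_⟩
  · have h1 := measure_compl_goodSetInfty_le hd hν hT hv hA' hC' hC''.le hK.le hDIV hLVB hC1
      (by omega) hg1 hlarge
    have h2 : μ.real (goodSetInfty T v L₀ g)ᶜ
        ≤ 2 * (∑' k : ℕ, 1 / ((k : ℝ) + 1) ^ 2) * g ^ (-(1 / 2 : ℝ) / 2) :=
      ENNReal.toReal_le_of_le_ofReal (by positivity) h1
    rw [probReal_compl_eq_one_sub hmeas] at h2
    linarith
  · have hgood : ∀ l, θ ∈ nonResonantSet T v L₀ g l \ tunnelingSet T v L₀ g l := fun l =>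
      Set.mem_iInter₂.1 (Set.mem_iInter.1 hθ l) l le_rfl
    exact volume_not_isLocalized_le hadm
      (isSparse_sample hd hT hA' hC' hK.le hDIV (hC1 θ) (by omega) hg0 (fun l => (hgood l).1)
        fun l => (hlarge l).grid_le hν hg1) (hgood k).2 u
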